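/- Let $n\ge 1$, let $\Omega\subset\mathbb R^n$ be a bounded domain with smooth boundary, let $\sigma>1$, and let $K=\{\lambda\in\mathbb R^n:\lambda_i>0 \text{ for all } i\}$. Let $f$ be a continuous function on $\overline K$, differentiable in $K$, such that: * $f$ is symmetric, $f_i=\partial f/\partial\lambda_i>0$ in $K$ for $1\le i\le n$, and $f$ is concave in $K$; * the dual function $f^*(\lambda)=f(1/\lambda_1,\dots,1/\lambda_n)^{-1}$ is concave in $K$; * $f>0$ in $K$ and $f=0$ on $\partial K$; * $f(1,\dots,1)=1$ and $f$ is homogeneous of degree one; * for some $\varepsilon_0>0$ and $\delta_0>0$, $\lim_{R\to+\infty}f(\lambda_1,\dots,\lambda_{n-1},\lambda_n+R)\ge 1+\varepsilon_0$ uniformly for $\lambda\in B_{\delta_0}(\mathbf 1)\cap K$, where $B_{\delta_0}(\mathbf 1)$ is the ball of radius $\delta_0$ about $\mathbf 1=(1,\dots,1)$ (the limit may be $+\infty$). For a function $u$ with $|Du|<1$ put $w=\sqrt{1-|Du|^2}$, $\gamma^{ij}=\delta_{ij}+\frac{u_iu_j}{w(1+w)}$, and let $A[u]$ be the symmetric matrix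 with entries $$a_{ij}[u]=\frac1w\Big(\delta_{ij}-u\sum_{k,l}\gamma^{ik}u_{kl}\gamma^{lj}\Big),$$ whose eigenvalues $\kappa[u]=(\kappa_1,\dots,\kappa_n)$ are the principal curvatures of the graph of $u$ in the half space model, with metric $x_{n+1}^{-2}(dx^2-dx_{n+1}^2)$, of the steady state space (half of de Sitter space). Put $G(D^2u,Du,u)=f(\kappa[u])$. For $\epsilon>0$ an admissible solution of the approximate Dirichlet problem is a function $u\in C^\infty(\overline\Omega)$ with $$G(D^2u,Du,u)=\sigma,\quad u>0\quad\text{in }\Omega,\qquad u=\epsilon\quad\text{on }\partial\Omega,$$ such that $|Du|<1$ in $\overline\Omega$ and $|x|^2-u^2$ has positive definite Hessian in $\Omega$. Then there are $\epsilon_1>0$ and a constant $C$, depending only on $n$, $\Omega$, $\sigma$ and $f$, such that for every $\epsilon\in(0,\epsilon_1]$ every admissible solution $u$ of the approximate Dirichlet problem satisfies $$u\,|D^2u|\le C\quad\text{on }\partial\Omega,$$ where $|D^2u|=\big(\sum_{i,j}u_{ij}^2\big)^{1/2}$. In particular $C$ is independent of $\epsilon$ and of $u$. -/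

import Mathlib

open scoped ContDiff

noncomputable section

namespace DeSitter

/-- Euclidean space `ℝⁿ`. -/
abbrev E (n : ℕ) : Type := EuclideanSpace ℝ (Fin n)

/-- The partial derivative `∂ᵢ g` at `x`. -/
def pd {n : ℕ} (i : Fin n) (g : E n → ℝ) (x : E n) : ℝ :=
  fderiv ℝ g x (EuclideanSpace.single i 1)

/-- The gradient vector `(g₁, …, gₙ)` at `x`. -/
def grad {n : ℕ} (g : E n → ℝ) (x : E n) : E n :=
  WithLp.toLp 2 fun i => pd i g x

/-- The Hessian matrix `(gᵢⱼ)` at `x`. -/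
def hess {n : ℕ} (g : E n → ℝ) (x : E n) : Matrix (Fin n) (Fin n) ℝ :=
  Matrix.of fun i j => pd j (pd i g) x

/-- The norm `|D²g| = (∑ gᵢⱼ²)^(1/2)` at `x`. -/
def hessNorm {n : ℕ} (g : E n → ℝ) (x : E n) : ℝ :=
  Real.sqrt (∑ i, ∑ j, hess g x i j ^ 2)

/-! ### Curvature functions -/

/-- The open positive cone `K = Kₙ⁺`. -/
def posCone (n : ℕ) : Set (E n) := {lam | ∀ i, 0 < lam i}

/-- The vector `(1, …, 1)`. -/
def oneVec (n : ℕ) : E n := WithLp.toLp 2 fun _ => 1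

/-- The dual function `f*(λ) = 1 / f(1/λ₁, …, 1/λₙ)`. -/
def dualFun {n : ℕ} (f : E n → ℝ) (lam : E n) : ℝ :=
  (f (WithLp.toLp 2 fun i => 1 / lam i))⁻¹

/-- The structure conditions on the curvature function `f`. Only the values of `f` on the closure of
the cone `K` matter. -/
structure IsCurvatureFunction {n : ℕ} (f : E n → ℝ) : Prop where
  /-- `f` is symmetric. -/
  symm : ∀ lam ∈ posCone n, ∀ e : Equiv.Perm (Fin n),
    f (WithLp.toLp 2 fun i => lam (e i)) = f lam
  /-- `f` is differentiable in `K`. -/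
  diff : ∀ lam ∈ posCone n, DifferentiableAt ℝ f lam
  /-- `fᵢ > 0` in `K`. -/
  mono : ∀ lam ∈ posCone n, ∀ i, 0 < pd i f lam
  /-- `f` is concave in `K`. -/
  concave : ConcaveOn ℝ (posCone n) f
  /-- The dual function is concave in `K`. -/
  dual_concave : ConcaveOn ℝ (posCone n) (dualFun f)
  /-- `f` is positive in `K`. -/
  pos : ∀ lam ∈ posCone n, 0 < f lam
  /-- `f` is continuous up to the boundary of `K`. -/
  cont : ContinuousOn f (closure (posCone n))
  /-- `f` vanishes on the boundary of `K`. -/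
  zero : ∀ lam ∈ frontier (posCone n), f lam = 0
  /-- `f(1, …, 1) = 1`. -/
  normalized : f (oneVec n) = 1
  /-- `f` is homogeneous of degree one. -/
  homog : ∀ t : ℝ, 0 < t → ∀ lam ∈ posCone n, f (t • lam) = t * f lam
  /-- `lim_{R → ∞} f(λ₁, …, λₙ₋₁, λₙ + R) ≥ 1 + ε₀` uniformly for `λ` in the ball of radius `δ₀`
  about `(1, …, 1)`, for some `ε₀, δ₀ > 0`; the limit may be `+∞`. -/
  growth : ∃ eps0 : ℝ, 0 < eps0 ∧ ∃ delta0 : ℝ, 0 < delta0 ∧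
    ∀ last : Fin n, (last : ℕ) + 1 = n →
      ∀ eta : ℝ, 0 < eta → ∀ᶠ R : ℝ in Filter.atTop,
        ∀ lam ∈ Metric.ball (oneVec n) delta0 ∩ posCone n,
          1 + eps0 - eta ≤ f (lam + EuclideanSpace.single last R)

/-! ### The curvature operator -/

/-- `w = √(1 - |p|²)`. -/
def wFun {n : ℕ} (p : E n) : ℝ := Real.sqrt (1 - ‖p‖ ^ 2)

/-- `γⁱʲ = δᵢⱼ + pᵢ pⱼ / (w (1 + w))`. -/
def gammaMat {n : ℕ} (p : E n) : Matrix (Fin n) (Fin n) ℝ :=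
  Matrix.of fun i j => (if i = j then 1 else 0) + p i * p j / (wFun p * (1 + wFun p))

/-- `aᵢⱼ = (1/w) (δᵢⱼ - z γⁱᵏ rₖₗ γˡʲ)`. For `r = D²u`, `p = Du`, `z = u` its eigenvalues are the
principal curvatures, in the half space model of the steady state space, of the graph of `u`. -/
def curvMat {n : ℕ} (r : Matrix (Fin n) (Fin n) ℝ) (p : E n) (z : ℝ) :
    Matrix (Fin n) (Fin n) ℝ :=
  (1 / wFun p) • (1 - z • (gammaMat p * r * gammaMat p))

open Classical in
/-- `F(A) = f(κ[A])`, with `κ[A]` the eigenvalues (with multiplicity) of the symmetric matrix `A`;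
the value for nonsymmetric `A` is irrelevant. -/
def matFun {n : ℕ} (f : E n → ℝ) (A : Matrix (Fin n) (Fin n) ℝ) : ℝ :=
  if h : A.IsHermitian then f (WithLp.toLp 2 h.eigenvalues) else 0

/-- `G(r, p, z) = F(A)`, with `A` the curvature matrix of `(r, p, z)`. -/
def GFun {n : ℕ} (f : E n → ℝ) (r : Matrix (Fin n) (Fin n) ℝ) (p : E n) (z : ℝ) : ℝ :=
  matFun f (curvMat r p z)

/-! ### Smooth domains and admissible solutions -/

/-- Bounded smooth domains: bounded, open, connected, nonempty, and near each boundary point a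
strict sublevel set of a smooth function with nonzero differential at that point. -/
structure IsBoundedSmoothDomain {n : ℕ} (Ω : Set (E n)) : Prop where
  isOpen : IsOpen Ω
  connected : IsConnected Ω
  bounded : Bornology.IsBounded Ω
  smooth : ∀ x ∈ frontier Ω, ∃ U : Set (E n), IsOpen U ∧ x ∈ U ∧
    ∃ psi : E n → ℝ, ContDiffOn ℝ ∞ psi U ∧ fderiv ℝ psi x ≠ 0 ∧
      Ω ∩ U = {y ∈ U | psi y < 0}

/-- `u ∈ C^∞(Ω̄)` is an admissible solution of `G(D²u, Du, u) = σ`, `u > 0` in `Ω`, `u = ε` on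
`∂Ω`. -/
structure IsAdmissibleSolution {n : ℕ} (f : E n → ℝ) (Ω : Set (E n)) (sig eps : ℝ)
    (u : E n → ℝ) : Prop where
  /-- `u` is smooth in a neighbourhood of the closure of `Ω`. -/
  smooth : ∃ V : Set (E n), IsOpen V ∧ closure Ω ⊆ V ∧ ContDiffOn ℝ ∞ u V
  /-- `u > 0` in `Ω`. -/
  pos : ∀ x ∈ Ω, 0 < u x
  /-- `u` is spacelike. -/
  spacelike : ∀ x ∈ closure Ω, ‖grad u x‖ < 1
  /-- `|x|² - u²` is locally strictly convex in `Ω`. -/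
  convex : ∀ x ∈ Ω, (hess (fun y => ‖y‖ ^ 2 - u y ^ 2) x).PosDef
  /-- The curvature equation. -/
  eqn : ∀ x ∈ Ω, GFun f (hess u x) (grad u x) (u x) = sig
  /-- The boundary condition. -/
  bdry : ∀ x ∈ frontier Ω, u x = eps

end DeSitter

end

noncomputable section

namespace DeSitter
open Matrix Filter Topology

/-! ### One-sided derivative test -/

/-! At a boundary point `z` with inner normal `m`, the Hessian splits into tangential, mixed and
double normal parts, each bounded by a different argument.

Everything rests on barriers for the height. Umbilic graphs are pieces of hyperboloids `|x-a|² + ρ²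
= (u-c)²`. One touching `u` from below or above bounds `σ` by its own curvature
(`sig_le_of_touching`, `le_sig_of_touching`). Sweeping by dilates of such graphs puts a cap over an
interior ball below `u`, and a hyperboloid around an exterior ball above `u`. So `u - ε` lies
between `slopeLo` and `slopeHi` times the normal coordinate, up to `|x-z|²/(2R)` (`height_ge`,
`height_le`), and both slopes tend to `β = √(σ²-1)/σ` as `ε → 0`.

Tangential part: along a parabola through `z` inside the interior ball, `u` is squeezed between `ε`
and the upper height bound, so `D²u(e,e)` is bounded independently of `ε`
(`abs_hess_tangential_le`).

Mixed part: convexity of `|x|² - u²` makes `u` semiconcave with constant `1/ε`. Semiconcavity turns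
the height bounds into `Du ≈ βm` and `w ≈ 1/σ` on a ball of radius comparable to `ε`
(`exists_grad_near`). The linearized operator `L` annihilates the fields generated by ambient
isometries: translations and rotations (`linOp_antisymm`) and dilations (`linOp_dilation`). An
infinitesimal rotation is chosen tangent to `∂Ω` up to second order at `z` (`exists_rotation`); the
derivative of `u` along it is then quadratically small on `∂Ω`. It is dominated by a multiple of `w
b`, with `b` as in `barrier`, for which `L(w b)` exceeds the dilation terms (`linOp_barrier_ge`,
`barrier_operator_pos`). The zeroth order coefficient of `L` has no sign, so the maximum principle
is applied to the quotient by the positive solution `u - ⟨x-z, Du⟩` (`rotation_comparison`). The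
normal derivative at `z` gives `ε |D²u(e,m)| ≤ C`.

Double normal part: convexity gives the upper bound. If `ε D²u(m,m)` were very negative, the
curvature matrix would dominate `σ(1-θ) I + R' m mᵀ`, and the growth condition would force its
curvature above `σ` (`exists_double_normal_bound`).

The function of eigenvalues is never differentiated. Concavity and symmetry give a supergradient `P`
(`exists_supergradient`), and along a line the trace of `P` times the curvature matrix is minimal at
the base point, so its derivative vanishes there. This is the linearized equation
(`exists_linearized`). -/

lemma deriv_nonneg_of_eventually_le {g : ℝ → ℝ} {g' : ℝ} (h : HasDerivAt g g' 0)
    (h0 : ∀ᶠ t in 𝓝[>] (0 : ℝ), g 0 ≤ g t) : 0 ≤ g' := by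
  have h1 := (hasDerivWithinAt_iff_tendsto_slope' (s := Set.Ioi (0 : ℝ)) (by simp)).1
    h.hasDerivWithinAt
  refine ge_of_tendsto h1 ?_
  filter_upwards [h0, self_mem_nhdsWithin] with t ht ht0
  have : (0 : ℝ) < t := ht0
  rw [slope_def_field]
  exact div_nonneg (by linarith) (by linarith)

/-! ### Curvature functions on the positive cone -/

variable {n : ℕ} {f : E n → ℝ}

lemma fderiv_apply_eq_sum (g : E n → ℝ) (x v : E n) :
    fderiv ℝ g x v = ∑ i, v i * pd i g x := by
  have hv : v = ∑ i, v i • EuclideanSpace.single i (1 : ℝ) := by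
    ext j
    simp [Finset.sum_apply, Pi.single_apply]
  conv_lhs => rw [hv]
  simp [map_sum, pd]

lemma hasDerivAt_line {g : E n → ℝ} {x v : E n} {t : ℝ} (h : DifferentiableAt ℝ g (x + t • v)) :
    HasDerivAt (fun t : ℝ => g (x + t • v)) (fderiv ℝ g (x + t • v) v) t := by
  have h2 : HasDerivAt (fun t : ℝ => x + t • v) v t := by
    simpa using ((hasDerivAt_id t).smul_const v).const_add x
  exact h.hasFDerivAt.comp_hasDerivAt t h2

namespace IsCurvatureFunction

lemma le_tangent (hf : IsCurvatureFunction f) {k m : E n} (hk : k ∈ posCone n)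
    (hm : m ∈ posCone n) : f m ≤ f k + ∑ i, pd i f k * (m i - k i) := by
  have hd : HasDerivAt (fun t : ℝ => f (k + t • (m - k))) (fderiv ℝ f k (m - k)) 0 := by
    have := hasDerivAt_line (g := f) (x := k) (v := m - k) (t := 0) (by simpa using hf.diff k hk)
    simpa using this
  have h2 : HasDerivAt (fun t : ℝ => f (k + t • (m - k)) - t * (f m - f k))
      (fderiv ℝ f k (m - k) - (f m - f k)) 0 := by
    have := hd.sub ((hasDerivAt_id (0 : ℝ)).mul_const (f m - f k))
    rw [one_mul] at this
    exact this
  have h3 := deriv_nonneg_of_eventually_le h2 (by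
    filter_upwards [Ioo_mem_nhdsGT (show (0 : ℝ) < 1 by norm_num)] with t ht
    have := hf.concave.2 hk hm (sub_nonneg.2 ht.2.le) ht.1.le (sub_add_cancel 1 t)
    have e : (1 - t) • k + t • m = k + t • (m - k) := by module
    rw [e] at this
    simp only [smul_eq_mul] at this
    simp only [zero_smul, add_zero, zero_mul, sub_zero]
    linarith)
  rw [fderiv_apply_eq_sum] at h3
  have : ∑ i, (m - k) i * pd i f k = ∑ i, pd i f k * (m i - k i) :=
    Finset.sum_congr rfl fun i _ => by simp [mul_comm]
  linarith

lemma euler (hf : IsCurvatureFunction f) {k : E n} (hk : k ∈ posCone n) :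
    ∑ i, pd i f k * k i = f k := by
  have hd : HasDerivAt (fun t : ℝ => f (k + t • k)) (fderiv ℝ f k k) 0 := by
    have := hasDerivAt_line (g := f) (x := k) (v := k) (t := 0) (by simpa using hf.diff k hk)
    simpa using this
  have h2 : HasDerivAt (fun t : ℝ => (1 + t) * f k) (f k) 0 := by
    simpa using ((hasDerivAt_id (0 : ℝ)).const_add 1).mul_const (f k)
  have h3 : (fun t : ℝ => f (k + t • k)) =ᶠ[𝓝 0] fun t : ℝ => (1 + t) * f k := by
    filter_upwards [Ioo_mem_nhds (show (-1 : ℝ) < 0 by norm_num) one_pos] with t ht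
    rw [← hf.homog (1 + t) (by linarith [ht.1]) k hk]
    congr 1; module
  have := hd.unique (h2.congr_of_eventuallyEq h3)
  rw [fderiv_apply_eq_sum] at this
  rw [← this]
  exact Finset.sum_congr rfl fun i _ => by ring

/-- Euler's relation cancels the constant terms of the tangent inequality. The bound `∑ fᵢ ≥ 1` is
the case `m = 1`, and monotonicity follows without integrating along a segment. -/
lemma le_sum_pd (hf : IsCurvatureFunction f) {k m : E n} (hk : k ∈ posCone n)
    (hm : m ∈ posCone n) : f m ≤ ∑ i, pd i f k * m i := by
  have := hf.le_tangent hk hm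
  simp only [mul_sub, Finset.sum_sub_distrib, hf.euler hk] at this
  linarith

lemma oneVec_mem : oneVec n ∈ posCone n := fun i => by simp [oneVec]

lemma one_le_sum_pd (hf : IsCurvatureFunction f) {k : E n} (hk : k ∈ posCone n) :
    1 ≤ ∑ i, pd i f k := by
  have := hf.le_sum_pd hk oneVec_mem
  rw [hf.normalized] at this
  simpa [oneVec] using this

lemma monotone (hf : IsCurvatureFunction f) {k m : E n} (hk : k ∈ posCone n)
    (hm : m ∈ posCone n) (h : ∀ i, k i ≤ m i) : f k ≤ f m := by
  have := hf.le_sum_pd hm hk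
  rw [← hf.euler hm]
  exact this.trans (Finset.sum_le_sum fun i _ => mul_le_mul_of_nonneg_left (h i) (hf.mono m hm i).le)

lemma apply_smul_oneVec (hf : IsCurvatureFunction f) {c : ℝ} (hc : 0 < c) :
    f (c • oneVec n) = c := by
  rw [hf.homog c hc _ oneVec_mem, hf.normalized, mul_one]

/-- Jensen's inequality along permutations of a vector. -/
lemma le_doublyStochastic (hf : IsCurvatureFunction f) {S : Matrix (Fin n) (Fin n) ℝ}
    (hS : S ∈ doublyStochastic ℝ (Fin n)) {k : Fin n → ℝ} (hk : ∀ i, 0 < k i) :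
    f (WithLp.toLp 2 k) ≤ f (WithLp.toLp 2 (S *ᵥ k)) := by
  -- Birkhoff: `S` is a convex combination of permutation matrices, on which `f` is constant by
  -- symmetry.
  obtain ⟨c, hc0, hc1, hcS⟩ := exists_eq_sum_perm_of_mem_doublyStochastic hS
  have hmem : ∀ e : Equiv.Perm (Fin n), WithLp.toLp 2 (fun i => k (e i)) ∈ posCone n :=
    fun e i => hk _
  have h1 := hf.concave.le_map_sum (t := Finset.univ) (w := c)
    (p := fun e : Equiv.Perm (Fin n) => WithLp.toLp 2 (fun i => k (e i)))
    (fun e _ => hc0 e) hc1 (fun e _ => hmem e)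
  have h2 : ∀ e : Equiv.Perm (Fin n), f (WithLp.toLp 2 (fun i => k (e i))) = f (WithLp.toLp 2 k) :=
    fun e => hf.symm (WithLp.toLp 2 k) hk e
  simp only [h2, smul_eq_mul, ← Finset.sum_mul, hc1, one_mul] at h1
  refine h1.trans_eq (congrArg f ?_)
  rw [← hcS]
  ext i
  simp [Matrix.sum_mulVec, Finset.sum_apply, Matrix.smul_mulVec, Equiv.Perm.permMatrix, PEquiv.toMatrix_toPEquiv_mulVec]

end IsCurvatureFunction

/-! ### Functions of eigenvalues -/

lemma exists_spectral (f : E n → ℝ) {A : Matrix (Fin n) (Fin n) ℝ} (hA : A.PosDef) :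
    ∃ (Q : Matrix (Fin n) (Fin n) ℝ) (k : Fin n → ℝ), Qᵀ * Q = 1 ∧ Q * Qᵀ = 1 ∧
      A = Q * diagonal k * Qᵀ ∧ (∀ i, 0 < k i) ∧ matFun f A = f (WithLp.toLp 2 k) := by
  have h := hA.isHermitian
  refine ⟨h.eigenvectorUnitary, h.eigenvalues, ?_, ?_, ?_, hA.eigenvalues_pos, ?_⟩
  · simpa [star_eq_conjTranspose] using Unitary.coe_star_mul_self h.eigenvectorUnitary
  · simpa [star_eq_conjTranspose] using Unitary.coe_mul_star_self h.eigenvectorUnitary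
  · conv_lhs => rw [h.spectral_theorem]
    simp [Unitary.conjStarAlgAut_apply, star_eq_conjTranspose]
  · rw [matFun, dif_pos h]

lemma conj_diagonal_apply_diag (M : Matrix (Fin n) (Fin n) ℝ) (k : Fin n → ℝ) (i : Fin n) :
    (M * diagonal k * Mᵀ) i i = ∑ j, M i j ^ 2 * k j := by
  simp only [Matrix.mul_apply, diagonal_apply, mul_ite, mul_zero, Finset.sum_ite_eq', Finset.mem_univ, if_true, transpose_apply]
  exact Finset.sum_congr rfl fun j _ => by ring

/-- Schur's inequality for a concave symmetric function. -/
lemma matFun_le_diag (hf : IsCurvatureFunction f) {B Q : Matrix (Fin n) (Fin n) ℝ} (hB : B.PosDef)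
    (hQ : Qᵀ * Q = 1) (hQ' : Q * Qᵀ = 1) :
    matFun f B ≤ f (WithLp.toLp 2 fun i => (Qᵀ * B * Q) i i) := by
  obtain ⟨R, m, hR, hR', hBR, hm, hfm⟩ := exists_spectral f hB
  rw [hfm]
  set M := Qᵀ * R with hM
  have e : Qᵀ * B * Q = M * diagonal m * Mᵀ := by
    rw [hBR, hM, transpose_mul, transpose_transpose]
    simp only [Matrix.mul_assoc]
  have hM1 : M * Mᵀ = 1 := by
    rw [hM, transpose_mul, transpose_transpose, Matrix.mul_assoc, ← Matrix.mul_assoc R, hR',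
      Matrix.one_mul, hQ]
  have hM2 : Mᵀ * M = 1 := by
    rw [hM, transpose_mul, transpose_transpose, Matrix.mul_assoc, ← Matrix.mul_assoc Q, hQ',
      Matrix.one_mul, hR]
  -- The squared entries of the orthogonal matrix `M` form a doubly stochastic matrix carrying the
  -- eigenvalues of `B` to its diagonal in the basis `Q`.
  set S : Matrix (Fin n) (Fin n) ℝ := Matrix.of fun i j => M i j ^ 2 with hS
  have hSd : S ∈ doublyStochastic ℝ (Fin n) := by
    rw [mem_doublyStochastic_iff_sum]
    refine ⟨fun i j => sq_nonneg _, fun i => ?_, fun j => ?_⟩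
    · have := congrFun (congrFun hM1 i) i
      simpa [Matrix.mul_apply, hS, sq] using this
    · have := congrFun (congrFun hM2 j) j
      simpa [Matrix.mul_apply, hS, sq] using this
  have h := hf.le_doublyStochastic hSd hm
  have e2 : (fun i => (Qᵀ * B * Q) i i) = S *ᵥ m := by
    ext i
    rw [e, conj_diagonal_apply_diag]
    simp [hS, mulVec, dotProduct]
  rwa [e2]

lemma posDef_conj_diag_pos {B Q : Matrix (Fin n) (Fin n) ℝ} (hB : B.PosDef)
    (hQ : Qᵀ * Q = 1) (i : Fin n) : 0 < (Qᵀ * B * Q) i i := by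
  have h : (Qᵀ * B * Q) i i = (Q.col i) ⬝ᵥ (B *ᵥ (Q.col i)) := by
    rw [Matrix.mul_assoc]
    simp [Matrix.mul_apply, mulVec, dotProduct]
  rw [h]
  have := hB.dotProduct_mulVec_pos (x := Q.col i) (by
    intro h0
    have h1 := congrFun (congrFun hQ i) i
    have h2 : ∀ k, Q k i = 0 := fun k => congrFun h0 k
    simp [Matrix.mul_apply, h2] at h1)
  simpa using this

/-- The supergradient of `F` at a positive definite matrix. -/
theorem exists_supergradient (hf : IsCurvatureFunction f) {A : Matrix (Fin n) (Fin n) ℝ}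
    (hA : A.PosDef) : ∃ P : Matrix (Fin n) (Fin n) ℝ, P.PosSemidef ∧ P * A = A * P ∧
      (P * A).trace = matFun f A ∧ 1 ≤ P.trace ∧ (P * A * A).PosSemidef ∧
      ∀ B : Matrix (Fin n) (Fin n) ℝ, B.PosDef → matFun f B ≤ (P * B).trace := by
  obtain ⟨Q, k, hQ, hQ', hAQ, hk, hfk⟩ := exists_spectral f hA
  have hkK : WithLp.toLp 2 k ∈ posCone n := hk
  set d : Fin n → ℝ := fun i => pd i f (WithLp.toLp 2 k) with hd
  have hd0 : ∀ i, 0 < d i := fun i => hf.mono _ hkK i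
  have hdiag : ∀ a b : Fin n → ℝ, (Q * diagonal a * Qᵀ) * (Q * diagonal b * Qᵀ)
      = Q * diagonal (fun i => a i * b i) * Qᵀ := by
    intro a b
    calc (Q * diagonal a * Qᵀ) * (Q * diagonal b * Qᵀ)
        = Q * diagonal a * (Qᵀ * Q) * diagonal b * Qᵀ := by simp only [Matrix.mul_assoc]
      _ = _ := by rw [hQ, Matrix.mul_one, Matrix.mul_assoc Q, diagonal_mul_diagonal]
  have htr : ∀ (a : Fin n → ℝ) (B : Matrix (Fin n) (Fin n) ℝ),
      (Q * diagonal a * Qᵀ * B).trace = ∑ i, a i * (Qᵀ * B * Q) i i := by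
    intro a B
    rw [Matrix.mul_assoc, Matrix.mul_assoc, trace_mul_comm, Matrix.mul_assoc]
    simp [trace, diagonal_mul]
  have hpsd : ∀ a : Fin n → ℝ, (∀ i, 0 ≤ a i) → (Q * diagonal a * Qᵀ).PosSemidef := by
    intro a ha
    have := (PosSemidef.diagonal (n := Fin n) (d := a) ha).mul_mul_conjTranspose_same Q
    simpa using this
  -- `P` has the eigenvectors of `A` and the eigenvalues `fᵢ(κ)`; hence it commutes with `A`, and `P
  -- A²` has eigenvalues `fᵢ κᵢ²`.
  refine ⟨Q * diagonal d * Qᵀ, hpsd d fun i => (hd0 i).le, ?_, ?_, ?_, ?_, ?_⟩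
  · rw [hAQ, hdiag, hdiag]; simp only [mul_comm]
  · rw [htr, hfk, ← hf.euler hkK]
    refine Finset.sum_congr rfl fun i _ => ?_
    have : Qᵀ * A * Q = diagonal k := by
      rw [hAQ]
      calc Qᵀ * (Q * diagonal k * Qᵀ) * Q = (Qᵀ * Q) * diagonal k * (Qᵀ * Q) := by
            simp only [Matrix.mul_assoc]
        _ = _ := by rw [hQ, Matrix.one_mul, Matrix.mul_one]
    rw [this]; simp [hd]
  · have := htr d 1
    rw [Matrix.mul_one] at this
    rw [this]
    simp only [Matrix.mul_one, hQ]
    simpa using hf.one_le_sum_pd hkK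
  · rw [hAQ, hdiag, hdiag]
    exact hpsd _ fun i => by have := hd0 i; have := hk i; positivity
  -- Schur replaces `B` by its diagonal in the eigenbasis of `A`, where the scalar supporting
  -- inequality applies.
  · intro B hB
    rw [htr]
    refine (matFun_le_diag hf hB hQ hQ').trans ?_
    exact hf.le_sum_pd hkK (fun i => posDef_conj_diag_pos hB hQ i)

lemma spectral_le {A Q : Matrix (Fin n) (Fin n) ℝ} {k : Fin n → ℝ} (hQ : Qᵀ * Q = 1)
    (hA : A = Q * diagonal k * Qᵀ) (i : Fin n) : k i = Q.col i ⬝ᵥ A *ᵥ Q.col i := by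
  have h : (Qᵀ * A * Q) i i = (Q.col i) ⬝ᵥ (A *ᵥ (Q.col i)) := by
    rw [Matrix.mul_assoc]
    simp [Matrix.mul_apply, mulVec, dotProduct]
  rw [← h, hA]
  have : Qᵀ * (Q * diagonal k * Qᵀ) * Q = diagonal k := by
    calc Qᵀ * (Q * diagonal k * Qᵀ) * Q = (Qᵀ * Q) * diagonal k * (Qᵀ * Q) := by
          simp only [Matrix.mul_assoc]
      _ = _ := by rw [hQ, Matrix.one_mul, Matrix.mul_one]
  rw [this]; simp

lemma col_dotProduct_self {Q : Matrix (Fin n) (Fin n) ℝ} (hQ : Qᵀ * Q = 1) (i : Fin n) :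
    Q.col i ⬝ᵥ Q.col i = 1 := by
  have := congrFun (congrFun hQ i) i
  simpa [Matrix.mul_apply, dotProduct] using this

lemma matFun_le_of_le (hf : IsCurvatureFunction f) {A : Matrix (Fin n) (Fin n) ℝ} (hA : A.PosDef)
    {c : ℝ} (hc : 0 < c) (h : ∀ v : Fin n → ℝ, v ⬝ᵥ A *ᵥ v ≤ c * (v ⬝ᵥ v)) : matFun f A ≤ c := by
  obtain ⟨Q, k, hQ, hQ', hAQ, hk, hfk⟩ := exists_spectral f hA
  rw [hfk, ← hf.apply_smul_oneVec hc]
  refine hf.monotone hk (fun i => by simpa [oneVec] using hc) fun i => ?_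
  have := h (Q.col i)
  rw [← spectral_le hQ hAQ, col_dotProduct_self hQ] at this
  simpa [oneVec] using this

lemma le_matFun_of_le (hf : IsCurvatureFunction f) {A : Matrix (Fin n) (Fin n) ℝ} (hA : A.PosDef)
    {c : ℝ} (hc : 0 < c) (h : ∀ v : Fin n → ℝ, c * (v ⬝ᵥ v) ≤ v ⬝ᵥ A *ᵥ v) : c ≤ matFun f A := by
  obtain ⟨Q, k, hQ, hQ', hAQ, hk, hfk⟩ := exists_spectral f hA
  rw [hfk, ← hf.apply_smul_oneVec hc]
  refine hf.monotone (fun i => by simpa [oneVec] using hc) hk fun i => ?_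
  have := h (Q.col i)
  rw [← spectral_le hQ hAQ, col_dotProduct_self hQ] at this
  simpa [oneVec] using this

/-- Lower bound for `F(A)` when `A ≥ a I + R m mᵀ` with a unit vector `m`. -/
lemma le_matFun_of_rank_one_le (hf : IsCurvatureFunction f) {A : Matrix (Fin n) (Fin n) ℝ}
    (hA : A.PosDef) {a R : ℝ} (ha : 0 < a) (hR : 0 ≤ R) {m : Fin n → ℝ} (hm : m ⬝ᵥ m = 1)
    (h : ∀ v : Fin n → ℝ, a * (v ⬝ᵥ v) + R * (m ⬝ᵥ v) ^ 2 ≤ v ⬝ᵥ A *ᵥ v) (last : Fin n) :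
    f (a • oneVec n + EuclideanSpace.single last R) ≤ matFun f A := by
  obtain ⟨Q, k, hQ, hQ', hAQ, hk, hfk⟩ := exists_spectral f hA
  rw [hfk]
  -- The squared components of `m` in the eigenbasis are convex weights, and `a + R cᵢ` is the
  -- corresponding average of the vectors `a·1 + R eⱼ`, on all of which `f` has the same value.
  set c : Fin n → ℝ := fun i => (m ⬝ᵥ Q.col i) ^ 2 with hc
  have hc1 : ∑ i, c i = 1 := by
    have e : ∑ i, c i = (m ᵥ* Q) ⬝ᵥ (m ᵥ* Q) := by
      simp [hc, dotProduct, vecMul, sq]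
    rw [e, ← dotProduct_mulVec, ← mulVec_transpose, mulVec_mulVec, hQ', one_mulVec, hm]
  have hmem : ∀ i : Fin n, a • oneVec n + EuclideanSpace.single i R ∈ posCone n := by
    intro i j
    have : (0 : ℝ) ≤ (if j = i then R else 0) := by split_ifs <;> simp [hR]
    simp [oneVec, Pi.single_apply]
    linarith
  have hsym : ∀ i : Fin n, f (a • oneVec n + EuclideanSpace.single i R)
      = f (a • oneVec n + EuclideanSpace.single last R) := by
    intro i
    rw [← hf.symm _ (hmem last) (Equiv.swap i last)]
    congr 1
    ext j
    simp only [oneVec, PiLp.add_apply, PiLp.smul_apply, PiLp.single_apply]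
    congr 2
    rw [eq_iff_iff, Equiv.swap_apply_eq_iff, Equiv.swap_apply_right]
  have h1 := hf.concave.le_map_sum (t := Finset.univ) (w := c)
    (p := fun i => a • oneVec n + EuclideanSpace.single i R)
    (fun e _ => sq_nonneg _) hc1 (fun e _ => hmem e)
  simp only [hsym, smul_eq_mul, ← Finset.sum_mul, hc1, one_mul] at h1
  refine h1.trans (hf.monotone (hf.concave.1.sum_mem (fun e _ => sq_nonneg _) hc1
    (fun e _ => hmem e)) hk fun i => ?_)
  have h2 := h (Q.col i)
  rw [← spectral_le hQ hAQ, col_dotProduct_self hQ] at h2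
  have h3 : (∑ j, c j • (a • oneVec n + EuclideanSpace.single j R)) i = a + R * c i := by
    simp only [oneVec, WithLp.ofLp_sum, WithLp.ofLp_smul, WithLp.ofLp_add, Finset.sum_apply, Pi.smul_apply,
      Pi.add_apply, smul_eq_mul, mul_one, mul_add, Finset.sum_add_distrib, ← Finset.sum_mul, hc1,
      one_mul, PiLp.single_apply, mul_ite, mul_zero, Finset.sum_ite_eq, Finset.mem_univ, if_true]
    ring
  rw [h3]
  simpa using h2

end DeSitter

end

noncomputable section

namespace DeSitter
open Matrix Filter Topology

variable {n : ℕ}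

/-! ### Partial derivatives -/

lemma pd_congr {g h : E n → ℝ} {x : E n} (i : Fin n) (e : g =ᶠ[𝓝 x] h) : pd i g x = pd i h x := by
  rw [pd, pd, e.fderiv_eq]

lemma pd_eventuallyEq {g h : E n → ℝ} {x : E n} (i : Fin n) (e : g =ᶠ[𝓝 x] h) :
    pd i g =ᶠ[𝓝 x] pd i h := by
  filter_upwards [e.eventuallyEq_nhds] with y hy using pd_congr i hy

lemma pd_add {g h : E n → ℝ} {x : E n} (i : Fin n) (hg : DifferentiableAt ℝ g x)
    (hh : DifferentiableAt ℝ h x) : pd i (fun y => g y + h y) x = pd i g x + pd i h x := by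
  rw [pd, fderiv_fun_add hg hh]; rfl

lemma pd_const_mul {g : E n → ℝ} {x : E n} (i : Fin n) (c : ℝ) (hg : DifferentiableAt ℝ g x) :
    pd i (fun y => c * g y) x = c * pd i g x := by
  rw [pd, fderiv_const_mul hg]; rfl

lemma pd_mul {g h : E n → ℝ} {x : E n} (i : Fin n) (hg : DifferentiableAt ℝ g x)
    (hh : DifferentiableAt ℝ h x) :
    pd i (fun y => g y * h y) x = g x * pd i h x + h x * pd i g x := by
  rw [pd, fderiv_fun_mul hg hh]; rfl

lemma pd_const (i : Fin n) (c : ℝ) (x : E n) : pd i (fun _ => c) x = 0 := by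
  simp [pd]

lemma contDiffAt_pd {g : E n → ℝ} {x : E n} (i : Fin n) {m : ℕ} (hg : ContDiffAt ℝ (m + 1) g x) :
    ContDiffAt ℝ m (pd i g) x :=
  (hg.fderiv_right (m := m) le_rfl).clm_apply contDiffAt_const

lemma pd_comm {g : E n → ℝ} {x : E n} (hg : ContDiffAt ℝ 2 g x) (i j : Fin n) :
    pd j (pd i g) x = pd i (pd j g) x := by
  have hs : IsSymmSndFDerivAt ℝ g x := hg.isSymmSndFDerivAt (by simp)
  have hd : DifferentiableAt ℝ (fderiv ℝ g) x :=
    (hg.fderiv_right (m := 1) (by norm_num)).differentiableAt (by norm_num)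
  have key : ∀ a b : Fin n, pd b (pd a g) x
      = fderiv ℝ (fderiv ℝ g) x (EuclideanSpace.single b 1) (EuclideanSpace.single a 1) := by
    intro a b
    change fderiv ℝ (fun y => fderiv ℝ g y (EuclideanSpace.single a 1)) x _ = _
    rw [fderiv_clm_apply hd (differentiableAt_const _)]
    simp
  rw [key, key]
  exact hs.eq _ _

lemma hess_isSymm {g : E n → ℝ} {x : E n} (hg : ContDiffAt ℝ 2 g x) : (hess g x)ᵀ = hess g x := by
  ext i j
  exact pd_comm hg j i

/-! ### Second order jets -/

/-- `φ` is `C²` at `x` with value `c`, gradient `d` and Hessian `H`. -/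
structure HasJet (φ : E n → ℝ) (x : E n) (c : ℝ) (d : Fin n → ℝ) (H : Matrix (Fin n) (Fin n) ℝ) :
    Prop where
  smooth : ContDiffAt ℝ 2 φ x
  val : φ x = c
  grad : ∀ i, pd i φ x = d i
  hess : ∀ i j, pd j (pd i φ) x = H i j

lemma ContDiffAt.hasJet {φ : E n → ℝ} {x : E n} (h : ContDiffAt ℝ 2 φ x) :
    HasJet φ x (φ x) (fun i => pd i φ x) (DeSitter.hess φ x) :=
  ⟨h, rfl, fun _ => rfl, fun _ _ => rfl⟩

namespace HasJet

variable {φ ψ : E n → ℝ} {x : E n} {c c' : ℝ} {d d' : Fin n → ℝ} {H H' : Matrix (Fin n) (Fin n) ℝ}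

lemma diff_nhds (h : HasJet φ x c d H) : ∀ᶠ y in 𝓝 x, DifferentiableAt ℝ φ y := by
  filter_upwards [h.smooth.eventually (by simp)] with y hy using hy.differentiableAt (by norm_num)

lemma diff_pd (h : HasJet φ x c d H) (i : Fin n) : DifferentiableAt ℝ (pd i φ) x :=
  (contDiffAt_pd i (m := 1) (h.smooth.of_le (by norm_num))).differentiableAt (by norm_num)

lemma const (c : ℝ) (x : E n) : HasJet (fun _ => c) x c 0 0 := by
  refine ⟨contDiffAt_const, rfl, fun i => pd_const i c x, fun i j => ?_⟩
  have : pd i (fun _ : E n => c) = fun _ => 0 := funext fun y => pd_const i c y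
  rw [this, pd_const]; rfl

lemma coord (k : Fin n) (x : E n) : HasJet (fun y => y k) x (x k) (Pi.single k 1) 0 := by
  have key : ∀ i (y : E n), pd i (fun y => y k) y = (Pi.single k 1 : Fin n → ℝ) i := by
    intro i y
    have : fderiv ℝ (fun y : E n => y k) y = EuclideanSpace.proj k :=
      (EuclideanSpace.proj k : E n →L[ℝ] ℝ).hasFDerivAt.fderiv
    rw [pd, this]
    simp [Pi.single_apply, eq_comm]
  refine ⟨(EuclideanSpace.proj k : E n →L[ℝ] ℝ).contDiff.contDiffAt, rfl,
    fun i => key i x, fun i j => ?_⟩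
  have : pd i (fun y : E n => y k) = fun _ => (Pi.single k 1 : Fin n → ℝ) i := funext (key i)
  rw [this, pd_const]; rfl

lemma add (h : HasJet φ x c d H) (h' : HasJet ψ x c' d' H') :
    HasJet (fun y => φ y + ψ y) x (c + c') (d + d') (H + H') := by
  refine ⟨h.smooth.add h'.smooth, by simp [h.val, h'.val], fun i => ?_, fun i j => ?_⟩
  · rw [pd_add i (h.smooth.differentiableAt (by norm_num)) (h'.smooth.differentiableAt (by norm_num)),
      h.grad, h'.grad]; rfl
  · have e : pd i (fun y => φ y + ψ y) =ᶠ[𝓝 x] fun y => pd i φ y + pd i ψ y := by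
      filter_upwards [h.diff_nhds, h'.diff_nhds] with y h1 h2 using pd_add i h1 h2
    rw [pd_congr j e, pd_add j (h.diff_pd i) (h'.diff_pd i), h.hess, h'.hess]; rfl

lemma const_mul (a : ℝ) (h : HasJet φ x c d H) :
    HasJet (fun y => a * φ y) x (a * c) (a • d) (a • H) := by
  refine ⟨contDiffAt_const.mul h.smooth, by simp [h.val], fun i => ?_, fun i j => ?_⟩
  · rw [pd_const_mul i a (h.smooth.differentiableAt (by norm_num)), h.grad]; rfl
  · have e : pd i (fun y => a * φ y) =ᶠ[𝓝 x] fun y => a * pd i φ y := by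
      filter_upwards [h.diff_nhds] with y h1 using pd_const_mul i a h1
    rw [pd_congr j e, pd_const_mul j a (h.diff_pd i), h.hess]; rfl

lemma sub (h : HasJet φ x c d H) (h' : HasJet ψ x c' d' H') :
    HasJet (fun y => φ y - ψ y) x (c - c') (d - d') (H - H') := by
  have := h.add (h'.const_mul (-1))
  simpa [sub_eq_add_neg] using this

lemma mul (h : HasJet φ x c d H) (h' : HasJet ψ x c' d' H') :
    HasJet (fun y => φ y * ψ y) x (c * c') (c • d' + c' • d)
      (c • H' + c' • H + vecMulVec d d' + vecMulVec d' d) := by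
  have hd := h.smooth.differentiableAt (by norm_num)
  have hd' := h'.smooth.differentiableAt (by norm_num)
  refine ⟨h.smooth.mul h'.smooth, by simp [h.val, h'.val], fun i => ?_, fun i j => ?_⟩
  · rw [pd_mul i hd hd', h.grad, h'.grad, h.val, h'.val]; rfl
  · have e : pd i (fun y => φ y * ψ y) =ᶠ[𝓝 x] fun y => φ y * pd i ψ y + ψ y * pd i φ y := by
      filter_upwards [h.diff_nhds, h'.diff_nhds] with y h1 h2 using pd_mul i h1 h2
    rw [pd_congr j e, pd_add j (hd.fun_mul (h'.diff_pd i)) (hd'.fun_mul (h.diff_pd i)),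
      pd_mul j hd (h'.diff_pd i), pd_mul j hd' (h.diff_pd i), h.hess, h'.hess, h.grad, h'.grad,
      h.grad, h'.grad, h.val, h'.val]
    simp [vecMulVec_apply]
    ring

lemma sum {ι : Type*} (s : Finset ι) {φ : ι → E n → ℝ} {c : ι → ℝ} {d : ι → Fin n → ℝ}
    {H : ι → Matrix (Fin n) (Fin n) ℝ} (h : ∀ k, HasJet (φ k) x (c k) (d k) (H k)) :
    HasJet (fun y => ∑ k ∈ s, φ k y) x (∑ k ∈ s, c k) (∑ k ∈ s, d k) (∑ k ∈ s, H k) := by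
  classical
  induction s using Finset.induction_on with
  | empty => simpa using const (n := n) 0 x
  | insert a s ha ih =>
    simp only [Finset.sum_insert ha]
    exact (h a).add ih

lemma unique (h : HasJet φ x c d H) (h' : HasJet φ x c' d' H') : c = c' ∧ d = d' ∧ H = H' :=
  ⟨h.val.symm.trans h'.val, funext fun i => (h.grad i).symm.trans (h'.grad i),
    Matrix.ext fun i j => (h.hess i j).symm.trans (h'.hess i j)⟩

lemma congr (h : HasJet φ x c d H) (e : φ =ᶠ[𝓝 x] ψ) : HasJet ψ x c d H :=
  ⟨h.smooth.congr_of_eventuallyEq e.symm, by rw [← e.eq_of_nhds, h.val],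
    fun i => by rw [← pd_congr i e, h.grad],
    fun i j => by rw [← pd_congr j (pd_eventuallyEq i e), h.hess]⟩

/-- Obtained by comparing the product jet of `√φ · √φ` with that of `φ`, so no second order chain
rule is needed. -/
lemma sqrt (h : HasJet φ x c d H) (hc : 0 < c) :
    ∃ d' H', HasJet (fun y => √(φ y)) x (√c) d' H' ∧ d = (2 * √c) • d' ∧
      H = (2 * √c) • H' + (2 : ℝ) • vecMulVec d' d' := by
  have hv := h.val
  have hsm : ContDiffAt ℝ 2 (fun y => √(φ y)) x := h.smooth.sqrt (by rw [hv]; exact hc.ne')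
  have hj := ContDiffAt.hasJet hsm
  have hm := hj.mul hj
  have hpos : ∀ᶠ y in 𝓝 x, 0 < φ y :=
    h.smooth.continuousAt.eventually (lt_mem_nhds (by rw [hv]; exact hc))
  have hm' := hm.congr (ψ := φ) (by
    filter_upwards [hpos] with y hy using Real.mul_self_sqrt hy.le)
  obtain ⟨-, h2, h3⟩ := h.unique hm'
  refine ⟨_, _, hv ▸ hj, ?_, ?_⟩
  · rw [h2, ← hv]; module
  · rw [h3, ← hv]; module

end HasJet

/-! ### Necessary conditions at a local minimum -/

/-- A negative second derivative would make `a` a local maximum as well, so `g` would be locally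
constant and the second derivative zero. -/
lemma deriv2_nonneg_of_isLocalMin {g : ℝ → ℝ} {a : ℝ} (hg : ContDiffAt ℝ 2 g a)
    (hmin : IsLocalMin g a) : 0 ≤ deriv (deriv g) a := by
  by_contra hlt
  push Not at hlt
  have h1 : deriv g a = 0 := hmin.deriv_eq_zero
  have hmax := isLocalMax_of_deriv_deriv_neg hlt h1 hg.continuousAt
  have hc : g =ᶠ[𝓝 a] fun _ => g a := by
    filter_upwards [hmin, hmax] with y h1 h2 using le_antisymm h2 h1
  have h2 : deriv g =ᶠ[𝓝 a] fun _ => 0 := by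
    filter_upwards [hc.eventuallyEq_nhds] with y hy
    rw [hy.deriv_eq]; simp
  rw [h2.deriv_eq] at hlt
  simp at hlt

lemma hasDerivAt_fderiv_line {g : E n → ℝ} {x v : E n} {t : ℝ} (h : ContDiffAt ℝ 2 g (x + t • v)) :
    HasDerivAt (fun t : ℝ => fderiv ℝ g (x + t • v) v)
      ((v : Fin n → ℝ) ⬝ᵥ hess g (x + t • v) *ᵥ v) t := by
  have hpd : ∀ i, DifferentiableAt ℝ (pd i g) (x + t • v) := fun i =>
    (contDiffAt_pd i (m := 1) (h.of_le (by norm_num))).differentiableAt (by norm_num)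
  have h1 : ∀ i, HasDerivAt (fun t : ℝ => v i * pd i g (x + t • v))
      (v i * fderiv ℝ (pd i g) (x + t • v) v) t := fun i =>
    (hasDerivAt_line (hpd i)).const_mul _
  have h2 := HasDerivAt.fun_sum (u := Finset.univ) fun i _ => h1 i
  simp only [fderiv_apply_eq_sum] at h2
  have e : (fun t : ℝ => fderiv ℝ g (x + t • v) v) = fun t => ∑ i, v i * pd i g (x + t • v) :=
    funext fun t => fderiv_apply_eq_sum g _ v
  have e2 : (v : Fin n → ℝ) ⬝ᵥ hess g (x + t • v) *ᵥ v
      = ∑ i, v i * ∑ j, v j * pd j (pd i g) (x + t • v) := by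
    simp only [dotProduct, mulVec, DeSitter.hess, of_apply]
    exact Finset.sum_congr rfl fun i _ => by
      congr 1; exact Finset.sum_congr rfl fun j _ => by ring
  rw [e, e2]
  exact h2

lemma HasJet.of_isLocalMin {φ : E n → ℝ} {x : E n} {c : ℝ} {d : Fin n → ℝ}
    {H : Matrix (Fin n) (Fin n) ℝ} (h : HasJet φ x c d H) (hmin : IsLocalMin φ x) :
    d = 0 ∧ H.PosSemidef := by
  constructor
  · ext i
    rw [← h.grad i, pd, hmin.fderiv_eq_zero]; rfl
  have hH : H = DeSitter.hess φ x := by ext i j; exact (h.hess i j).symm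
  refine .of_dotProduct_mulVec_nonneg ?_ fun v => ?_
  · rw [hH]
    simpa [IsHermitian] using hess_isSymm h.smooth
  · set V : E n := WithLp.toLp 2 v
    have hc : ContDiffAt ℝ 2 (fun t : ℝ => φ (x + t • V)) 0 := by
      refine ContDiffAt.comp (0 : ℝ) (f := fun t : ℝ => x + t • V) (g := φ) (by simpa using h.smooth) ?_
      fun_prop
    have hm : IsLocalMin (fun t : ℝ => φ (x + t • V)) 0 := by
      have ht : Tendsto (fun t : ℝ => x + t • V) (𝓝 0) (𝓝 x) := by
        have : Continuous (fun t : ℝ => x + t • V) := by fun_prop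
        simpa using this.tendsto 0
      have := ht.eventually hmin
      simpa [IsLocalMin, IsMinFilter] using this
    have h2 := deriv2_nonneg_of_isLocalMin hc hm
    have hnear : ∀ᶠ t : ℝ in 𝓝 0, DifferentiableAt ℝ φ (x + t • V) := by
      have ht : Tendsto (fun t : ℝ => x + t • V) (𝓝 0) (𝓝 x) := by
        have : Continuous (fun t : ℝ => x + t • V) := by fun_prop
        simpa using this.tendsto 0
      exact ht.eventually h.diff_nhds
    have e : deriv (fun t : ℝ => φ (x + t • V)) =ᶠ[𝓝 0] fun t => fderiv ℝ φ (x + t • V) V := by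
      filter_upwards [hnear] with t ht using (hasDerivAt_line ht).deriv
    rw [e.deriv_eq, (hasDerivAt_fderiv_line (by simpa using h.smooth)).deriv] at h2
    simpa [hH, V] using h2

/-- Writing `A = Cᴴ C`, the trace becomes that of `C B Cᴴ`. This gives the second order part of the
linearized operator its sign at a minimum. -/
lemma trace_mul_nonneg_of_posSemidef {A B : Matrix (Fin n) (Fin n) ℝ} (hA : A.PosSemidef)
    (hB : B.PosSemidef) : 0 ≤ (A * B).trace := by
  obtain ⟨C, rfl⟩ : ∃ C : Matrix (Fin n) (Fin n) ℝ, A = Cᴴ * C := by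
    classical
    open MatrixOrder in
    obtain ⟨C, hC⟩ := CStarAlgebra.nonneg_iff_eq_star_mul_self.1 hA.nonneg
    exact ⟨C, hC⟩
  rw [Matrix.mul_assoc, trace_mul_comm]
  exact (hB.mul_mul_conjTranspose_same C).trace_nonneg

end DeSitter

end

noncomputable section

namespace DeSitter
open Matrix Filter Topology

variable {n : ℕ}

/-! ### The metric and its square root -/

/-- The induced Minkowski metric `δᵢⱼ - pᵢ pⱼ`. -/
def metMat (p : E n) : Matrix (Fin n) (Fin n) ℝ := 1 - vecMulVec p p

/-- The inverse metric `δᵢⱼ + pᵢ pⱼ / w²`. -/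
def invMet (p : E n) : Matrix (Fin n) (Fin n) ℝ := 1 + (1 / wFun p ^ 2) • vecMulVec p p

/-- Half the Hessian of `|x|² - u²`, as a function of `(D²u, Du, u)`. -/
def convMat (r : Matrix (Fin n) (Fin n) ℝ) (p : E n) (z : ℝ) : Matrix (Fin n) (Fin n) ℝ :=
  metMat p - z • r

lemma dotProduct_self_eq (p : E n) : (p : Fin n → ℝ) ⬝ᵥ p = ‖p‖ ^ 2 := by
  rw [EuclideanSpace.real_norm_sq_eq]
  simp [dotProduct, sq]

lemma inner_eq_dotProduct (x y : E n) : inner ℝ x y = (x : Fin n → ℝ) ⬝ᵥ y := by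
  rw [EuclideanSpace.inner_eq_star_dotProduct, dotProduct_comm]
  simp

lemma wFun_pos {p : E n} (hp : ‖p‖ < 1) : 0 < wFun p := by
  apply Real.sqrt_pos.2
  nlinarith [norm_nonneg p]

lemma wFun_sq {p : E n} (hp : ‖p‖ < 1) : wFun p ^ 2 = 1 - (p : Fin n → ℝ) ⬝ᵥ p := by
  rw [wFun, Real.sq_sqrt (by nlinarith [norm_nonneg p]), dotProduct_self_eq]

lemma gammaMat_eq (p : E n) :
    gammaMat p = 1 + (1 / (wFun p * (1 + wFun p))) • vecMulVec (p : Fin n → ℝ) p := by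
  ext i j
  simp only [gammaMat, Matrix.one_apply, vecMulVec_apply, of_apply, Matrix.add_apply, Matrix.smul_apply, smul_eq_mul]
  ring

lemma vecMulVec_mul_self (p : Fin n → ℝ) :
    vecMulVec p p * vecMulVec p p = (p ⬝ᵥ p) • vecMulVec p p := by
  rw [vecMulVec_mul_vecMulVec]
  simp [vecMulVec_smul]

lemma gammaMat_transpose (p : E n) : (gammaMat p)ᵀ = gammaMat p := by
  rw [gammaMat_eq]
  simp [transpose_vecMulVec]

lemma gammaMat_mul_self {p : E n} (hp : ‖p‖ < 1) : gammaMat p * gammaMat p = invMet p := by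
  have hw := wFun_pos hp
  have hs : (p : Fin n → ℝ) ⬝ᵥ p = 1 - wFun p ^ 2 := by rw [wFun_sq hp]; ring
  rw [gammaMat_eq, invMet]
  have hc : 1 / wFun p ^ 2 = 2 * (1 / (wFun p * (1 + wFun p)))
      + (1 / (wFun p * (1 + wFun p))) ^ 2 * (1 - wFun p ^ 2) := by
    field_simp
    ring
  rw [hc]
  generalize 1 / (wFun p * (1 + wFun p)) = c
  simp only [add_mul, mul_add, one_mul, mul_one, smul_mul_assoc, mul_smul_comm, vecMulVec_mul_self,
    hs]
  module

lemma invMet_mul_metMat {p : E n} (hp : ‖p‖ < 1) : invMet p * metMat p = 1 := by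
  have hw := wFun_pos hp
  have hs : (p : Fin n → ℝ) ⬝ᵥ p = 1 - wFun p ^ 2 := by rw [wFun_sq hp]; ring
  rw [invMet, metMat]
  have hc : (1 - wFun p ^ 2) * (1 / wFun p ^ 2) = 1 / wFun p ^ 2 - 1 := by
    field_simp
  generalize 1 / wFun p ^ 2 = c at hc ⊢
  simp only [add_mul, mul_sub, one_mul, mul_one, smul_mul_assoc, vecMulVec_mul_self, hs, smul_smul,
    mul_comm c, hc]
  module

lemma gammaMat_comm_metMat (p : E n) : gammaMat p * metMat p = metMat p * gammaMat p := by
  rw [gammaMat_eq, metMat]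
  generalize 1 / (wFun p * (1 + wFun p)) = c
  simp only [add_mul, mul_add, sub_mul, mul_sub, one_mul, mul_one, smul_mul_assoc, mul_smul_comm]
  module

lemma gammaMat_metMat_gammaMat {p : E n} (hp : ‖p‖ < 1) :
    gammaMat p * metMat p * gammaMat p = 1 := by
  rw [Matrix.mul_assoc, ← gammaMat_comm_metMat, ← Matrix.mul_assoc, gammaMat_mul_self hp,
    invMet_mul_metMat hp]

/-- Because `γ g γ = 1`, the curvature matrix is congruent, up to `1/w`, to half the Hessian of
`|x|² - u²`; so admissibility makes every principal curvature positive. -/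
lemma curvMat_eq {p : E n} (hp : ‖p‖ < 1) (r : Matrix (Fin n) (Fin n) ℝ) (z : ℝ) :
    curvMat r p z = (1 / wFun p) • (gammaMat p * convMat r p z * gammaMat p) := by
  rw [curvMat, convMat, mul_sub, sub_mul, gammaMat_metMat_gammaMat hp]
  simp

lemma isUnit_gammaMat {p : E n} (hp : ‖p‖ < 1) : IsUnit (gammaMat p) := by
  have h := gammaMat_metMat_gammaMat hp
  rw [Matrix.mul_assoc] at h
  exact IsUnit.of_mul_eq_one _ h

lemma curvMat_posDef {p : E n} (hp : ‖p‖ < 1) {r : Matrix (Fin n) (Fin n) ℝ} {z : ℝ}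
    (h : (convMat r p z).PosDef) : (curvMat r p z).PosDef := by
  rw [curvMat_eq hp]
  have hw := wFun_pos hp
  refine PosDef.smul ?_ (by positivity)
  have := (IsUnit.posDef_star_left_conjugate_iff (isUnit_gammaMat hp) (x := convMat r p z)).2 h
  rw [star_eq_conjTranspose, conjTranspose_eq_transpose_of_trivial, gammaMat_transpose] at this
  exact this

lemma dotProduct_curvMat {p : E n} (hp : ‖p‖ < 1) (r : Matrix (Fin n) (Fin n) ℝ) (z : ℝ)
    (v : Fin n → ℝ) : v ⬝ᵥ curvMat r p z *ᵥ v
      = (1 / wFun p) * ((gammaMat p *ᵥ v) ⬝ᵥ convMat r p z *ᵥ (gammaMat p *ᵥ v)) := by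
  rw [curvMat_eq hp, smul_mulVec, dotProduct_smul, smul_eq_mul, ← mulVec_mulVec, ← mulVec_mulVec]
  congr 1
  rw [dotProduct_mulVec, ← mulVec_transpose, gammaMat_transpose]

/-- In the variable `γ v` the Euclidean length becomes the length for the induced metric, so
eigenvalue bounds for the curvature matrix can be stated without `γ`. -/
lemma dotProduct_eq_metMat {p : E n} (hp : ‖p‖ < 1) (v : Fin n → ℝ) :
    v ⬝ᵥ v = (gammaMat p *ᵥ v) ⬝ᵥ metMat p *ᵥ (gammaMat p *ᵥ v) := by
  have h : v ⬝ᵥ (gammaMat p * metMat p * gammaMat p) *ᵥ v = v ⬝ᵥ v := by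
    rw [gammaMat_metMat_gammaMat hp, one_mulVec]
  rw [← h, ← mulVec_mulVec, ← mulVec_mulVec]
  rw [dotProduct_mulVec v, ← mulVec_transpose, gammaMat_transpose]

/-! ### Admissible solutions at interior points -/

lemma hasJet_coord_sub (z x : E n) (k : Fin n) :
    HasJet (fun y : E n => y k - z k) x (x k - z k) (Pi.single k 1) 0 := by
  simpa using (HasJet.coord k x).sub (HasJet.const (z k) x)

lemma hasJet_normSq_sub (z x : E n) :
    HasJet (fun y : E n => ‖y - z‖ ^ 2) x (‖x - z‖ ^ 2) ((2 : ℝ) • (x - z : E n).ofLp)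
      ((2 : ℝ) • 1) := by
  have h1 := HasJet.sum Finset.univ fun i => (hasJet_coord_sub z x i).mul (hasJet_coord_sub z x i)
  have e : ∀ y : E n, ∑ i, (y i - z i) * (y i - z i) = ‖y - z‖ ^ 2 := fun y => by
    rw [EuclideanSpace.real_norm_sq_eq]; simp [sq]
  simp only [e] at h1
  convert h1 using 1
  · ext i
    simp only [WithLp.ofLp_sub, Pi.smul_apply, Pi.sub_apply, smul_eq_mul, Finset.sum_apply,
      Pi.add_apply, Pi.single_apply, mul_ite, mul_one, mul_zero, Finset.sum_add_distrib,
      Finset.sum_ite_eq, Finset.mem_univ, if_true]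
    ring
  · ext i j
    simp only [Matrix.smul_apply, Matrix.one_apply, smul_eq_mul, Matrix.sum_apply, smul_zero,
      Matrix.add_apply, Matrix.zero_apply, vecMulVec_apply, Pi.single_apply, mul_ite, mul_one, mul_zero,
      add_zero, zero_add, Finset.sum_add_distrib, Finset.sum_ite_eq, Finset.mem_univ, if_true]
    split_ifs <;> ring

lemma hasJet_sq {u : E n → ℝ} {x : E n} (hu : ContDiffAt ℝ 2 u x) :
    HasJet (fun y => u y ^ 2) x (u x ^ 2) ((2 * u x) • (grad u x).ofLp)
      ((2 : ℝ) • (u x • hess u x + vecMulVec (grad u x).ofLp (grad u x).ofLp)) := by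
  have hj := ContDiffAt.hasJet hu
  have h := hj.mul hj
  simp only [← sq] at h
  convert h using 1
  · ext i; simp [grad]; ring
  · ext i j; simp [grad, vecMulVec_apply]; ring

lemma hasJet_normSq_sub_sq {u : E n → ℝ} {x : E n} (z : E n) (hu : ContDiffAt ℝ 2 u x) :
    HasJet (fun y => ‖y - z‖ ^ 2 - u y ^ 2) x (‖x - z‖ ^ 2 - u x ^ 2)
      ((2 : ℝ) • ((x - z : E n).ofLp - u x • (grad u x).ofLp))
      ((2 : ℝ) • convMat (hess u x) (grad u x) (u x)) := by
  convert (hasJet_normSq_sub z x).sub (hasJet_sq hu) using 1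
  · module
  · rw [convMat, metMat]; module

namespace IsAdmissibleSolution

variable {f : E n → ℝ} {Ω : Set (E n)} {sig eps : ℝ} {u : E n → ℝ}

lemma contDiffAt (hu : IsAdmissibleSolution f Ω sig eps u) {x : E n} (hx : x ∈ closure Ω) :
    ContDiffAt ℝ ∞ u x := by
  obtain ⟨V, hV, hΩV, huV⟩ := hu.smooth
  exact huV.contDiffAt (hV.mem_nhds (hΩV hx))

lemma contDiffAt_nat (hu : IsAdmissibleSolution f Ω sig eps u) {x : E n} (hx : x ∈ closure Ω)
    (m : ℕ) : ContDiffAt ℝ m u x :=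
  (hu.contDiffAt hx).of_le (by exact_mod_cast le_top)

lemma convMat_posDef (hu : IsAdmissibleSolution f Ω sig eps u) {x : E n} (hx : x ∈ Ω) :
    (convMat (hess u x) (grad u x) (u x)).PosDef := by
  have h := hu.convex x hx
  have hj := hasJet_normSq_sub_sq 0 (hu.contDiffAt_nat (subset_closure hx) 2)
  simp only [sub_zero] at hj
  have e : hess (fun y => ‖y‖ ^ 2 - u y ^ 2) x
      = (2 : ℝ) • convMat (hess u x) (grad u x) (u x) := by
    ext i j; exact hj.hess i j
  rw [e] at h
  have := h.smul (show (0 : ℝ) < 1 / 2 by norm_num)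
  rwa [smul_smul, show (1 / 2 : ℝ) * 2 = 1 by norm_num, one_smul] at this

lemma curvMat_posDef (hu : IsAdmissibleSolution f Ω sig eps u) {x : E n} (hx : x ∈ Ω) :
    (curvMat (hess u x) (grad u x) (u x)).PosDef :=
  DeSitter.curvMat_posDef (hu.spacelike x (subset_closure hx)) (hu.convMat_posDef hx)

/-- The principal curvatures are the eigenvalues of the convexity matrix relative to `w g`. A form
inequality with constant `c` thus bounds them all, and `f(c, …, c) = c`. -/
lemma sig_le_of_le (hf : IsCurvatureFunction f) (hu : IsAdmissibleSolution f Ω sig eps u) {x : E n}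
    (hx : x ∈ Ω) {c : ℝ} (hc : 0 < c) (h : ∀ v : Fin n → ℝ,
      v ⬝ᵥ convMat (hess u x) (grad u x) (u x) *ᵥ v
        ≤ c * wFun (grad u x) * (v ⬝ᵥ metMat (grad u x) *ᵥ v)) : sig ≤ c := by
  have hp := hu.spacelike x (subset_closure hx)
  have hw := wFun_pos hp
  rw [← hu.eqn x hx, GFun]
  refine matFun_le_of_le hf (hu.curvMat_posDef hx) hc fun v => ?_
  rw [dotProduct_curvMat hp, dotProduct_eq_metMat hp v, one_div, inv_mul_le_iff₀ hw]
  calc _ ≤ _ := h _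
    _ = _ := by ring

lemma le_sig_of_le (hf : IsCurvatureFunction f) (hu : IsAdmissibleSolution f Ω sig eps u) {x : E n}
    (hx : x ∈ Ω) {c : ℝ} (hc : 0 < c) (h : ∀ v : Fin n → ℝ,
      c * wFun (grad u x) * (v ⬝ᵥ metMat (grad u x) *ᵥ v)
        ≤ v ⬝ᵥ convMat (hess u x) (grad u x) (u x) *ᵥ v) : c ≤ sig := by
  have hp := hu.spacelike x (subset_closure hx)
  have hw := wFun_pos hp
  rw [← hu.eqn x hx, GFun]
  refine le_matFun_of_le hf (hu.curvMat_posDef hx) hc fun v => ?_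
  rw [dotProduct_curvMat hp, dotProduct_eq_metMat hp v, one_div, le_inv_mul_iff₀ hw]
  calc _ = _ := by ring
    _ ≤ _ := h _

end IsAdmissibleSolution

/-! ### Derivatives of matrix-valued curves -/

/-- Entrywise derivative at `0` of a curve of matrices. -/
def MDeriv (M : ℝ → Matrix (Fin n) (Fin n) ℝ) (M' : Matrix (Fin n) (Fin n) ℝ) : Prop :=
  ∀ i j, HasDerivAt (fun t => M t i j) (M' i j) 0

namespace MDeriv

variable {M N : ℝ → Matrix (Fin n) (Fin n) ℝ} {M' N' : Matrix (Fin n) (Fin n) ℝ}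

lemma const (C : Matrix (Fin n) (Fin n) ℝ) : MDeriv (fun _ => C) 0 :=
  fun _ _ => hasDerivAt_const _ _

lemma sub (hM : MDeriv M M') (hN : MDeriv N N') : MDeriv (fun t => M t - N t) (M' - N') :=
  fun i j => (hM i j).sub (hN i j)

lemma add (hM : MDeriv M M') (hN : MDeriv N N') : MDeriv (fun t => M t + N t) (M' + N') :=
  fun i j => (hM i j).add (hN i j)

lemma smul {c : ℝ → ℝ} {c' : ℝ} (hc : HasDerivAt c c' 0) (hM : MDeriv M M') :
    MDeriv (fun t => c t • M t) (c' • M 0 + c 0 • M') :=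
  fun i j => hc.mul (hM i j)

lemma mul (hM : MDeriv M M') (hN : MDeriv N N') :
    MDeriv (fun t => M t * N t) (M' * N 0 + M 0 * N') := by
  intro i j
  have := HasDerivAt.fun_sum (u := Finset.univ) fun k _ => (hM i k).mul (hN k j)
  simp only [Finset.sum_add_distrib] at this
  exact this

lemma vecMulVec {a b : ℝ → Fin n → ℝ} {a' b' : Fin n → ℝ}
    (ha : ∀ i, HasDerivAt (fun t => a t i) (a' i) 0)
    (hb : ∀ i, HasDerivAt (fun t => b t i) (b' i) 0) :
    MDeriv (fun t => Matrix.vecMulVec (a t) (b t))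
      (Matrix.vecMulVec a' (b 0) + Matrix.vecMulVec (a 0) b') :=
  fun i j => (ha i).mul (hb j)

lemma trace (hM : MDeriv M M') : HasDerivAt (fun t => (M t).trace) M'.trace 0 :=
  HasDerivAt.fun_sum (u := Finset.univ) fun i _ => hM i i

lemma unique (hM : MDeriv M M') (hM2 : MDeriv M N') : M' = N' :=
  Matrix.ext fun i j => (hM i j).unique (hM2 i j)

lemma congr (hM : MDeriv M M') (h : M =ᶠ[𝓝 0] N) : MDeriv N M' := fun i j =>
  (hM i j).congr_of_eventuallyEq (by filter_upwards [h] with t ht; rw [ht])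

end MDeriv

end DeSitter

end

noncomputable section

namespace DeSitter
open Matrix Filter Topology

variable {n : ℕ}

/-! ### The linearized operator -/

/-- The linearized operator acting on the jet `(c, d, H)`. -/
def linOp (sig z : ℝ) (p : Fin n → ℝ) (w : ℝ) (U a e : Matrix (Fin n) (Fin n) ℝ)
    (c : ℝ) (d : Fin n → ℝ) (H : Matrix (Fin n) (Fin n) ℝ) : ℝ :=
  -z * (a * H).trace - c * (a * U).trace - 2 * (p ⬝ᵥ a *ᵥ d) + 2 * (p ⬝ᵥ e *ᵥ d)
    + sig / w ^ 2 * (p ⬝ᵥ d)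

lemma trace_mul_vecMulVec (a : Matrix (Fin n) (Fin n) ℝ) (p q : Fin n → ℝ) :
    (a * vecMulVec p q).trace = q ⬝ᵥ a *ᵥ p := by
  rw [mul_vecMulVec, trace_vecMulVec, dotProduct_comm]

lemma dotProduct_mulVec_symm {a : Matrix (Fin n) (Fin n) ℝ} (ha : aᵀ = a) (p q : Fin n → ℝ) :
    q ⬝ᵥ a *ᵥ p = p ⬝ᵥ a *ᵥ q := by
  rw [dotProduct_mulVec, ← mulVec_transpose, ha, dotProduct_comm]

/-- Algebraic form of the differentiated equation `tr(P A') = 0`, `A = ν γ B γ`. -/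
lemma trace_deriv_identity {P G G1 g g1 B B1 : Matrix (Fin n) (Fin n) ℝ} {v v1 : ℝ}
    (hG : G * g * G = 1) (hcomm : G * g = g * G) (hPA : P * (G * B * G) = G * B * G * P)
    (hG1 : G1 * g * G + G * g1 * G + G * g * G1 = 0)
    (hder : (P * (v1 • (G * B * G) + v • (G1 * B * G + G * B1 * G + G * B * G1))).trace = 0) :
    v1 * (P * (G * B * G)).trace + ((v • (G * P * G)) * B1).trace
      - ((v • (G * P * G)) * B * G * G * g1).trace = 0 := by
  set J := G * g with hJ
  set A := G * B * G with hA
  have hGJ : G * J = 1 := by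
    rw [hcomm, ← Matrix.mul_assoc]; exact hG
  have hJG : J * G = 1 := hG
  have e1 : B * G = J * A := by
    rw [hA, ← Matrix.mul_assoc, ← Matrix.mul_assoc, hJG, Matrix.one_mul]
  have e2 : G * B = A * J := by
    rw [hA, Matrix.mul_assoc, hGJ, Matrix.mul_one]
  have t1 : (P * (G1 * B * G)).trace = (P * A * (G1 * J)).trace := by
    rw [Matrix.mul_assoc G1, e1, hPA, Matrix.mul_assoc A, trace_mul_comm A]
    simp only [Matrix.mul_assoc]
  have t2 : (P * (G * B * G1)).trace = (P * A * (J * G1)).trace := by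
    rw [e2]; simp only [Matrix.mul_assoc]
  -- Differentiating `G g G = 1` trades the derivative of the square root `G` for that of the
  -- metric; `P` commuting with `A` is what lets the two terms in `G1` be combined.
  have t3 : (P * A * (G1 * J)).trace + (P * A * (J * G1)).trace = -(P * A * (G * g1 * G)).trace := by
    have : G1 * J + J * G1 = -(G * g1 * G) := by
      rw [hJ]
      have h' : G1 * (G * g) = G1 * g * G := by
        rw [Matrix.mul_assoc, ← hcomm]
      rw [h', eq_neg_iff_add_eq_zero, ← hG1]
      abel
    rw [← trace_add, ← mul_add, this, mul_neg, trace_neg]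
  have t4 : ((v • (G * P * G)) * B1).trace = v * (P * (G * B1 * G)).trace := by
    rw [smul_mul_assoc, trace_smul, smul_eq_mul]
    congr 1
    rw [Matrix.mul_assoc, Matrix.mul_assoc, trace_mul_comm]
    simp only [Matrix.mul_assoc]
  have t5 : ((v • (G * P * G)) * B * G * G * g1).trace = v * (P * A * (G * g1 * G)).trace := by
    simp only [smul_mul_assoc]
    rw [trace_smul, smul_eq_mul, hA]
    congr 1
    have : G * P * G * B * G * G * g1 = G * (P * (G * B * G) * (G * g1)) := by
      simp only [Matrix.mul_assoc]
    rw [this, trace_mul_comm]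
    simp only [Matrix.mul_assoc]
  rw [t4, t5]
  simp only [mul_add, trace_add, mul_smul_comm, trace_smul, smul_eq_mul] at hder
  rw [t1, t2] at hder
  have t3' : (P * A * (G1 * J)).trace = -(P * A * (G * g1 * G)).trace - (P * A * (J * G1)).trace := by
    linarith
  rw [t3'] at hder
  linarith

section Curve

variable {u : E n → ℝ} {x : E n}

lemma hasDerivAt_coord_line {g : E n → ℝ} (hg : DifferentiableAt ℝ g x) (k : Fin n) :
    HasDerivAt (fun t : ℝ => g (x + t • EuclideanSpace.single k 1)) (pd k g x) 0 := by
  have := hasDerivAt_line (g := g) (x := x) (v := EuclideanSpace.single k 1) (t := 0)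
    (by simpa using hg)
  simpa [pd] using this

lemma contDiffAt_hess_entry (hu : ContDiffAt ℝ 3 u x) (i j : Fin n) :
    DifferentiableAt ℝ (fun y => hess u y i j) x := by
  have h1 : ContDiffAt ℝ (2 : ℕ) (pd i u) x := contDiffAt_pd i (hu.of_le (by norm_num))
  have h2 : ContDiffAt ℝ (1 : ℕ) (pd j (pd i u)) x := contDiffAt_pd j (h1.of_le (by norm_num))
  exact h2.differentiableAt (by norm_num)

lemma differentiableAt_pd (hu : ContDiffAt ℝ 2 u x) (i : Fin n) :
    DifferentiableAt ℝ (pd i u) x :=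
  (contDiffAt_pd i (m := 1) (hu.of_le (by norm_num))).differentiableAt (by norm_num)

/-- Third derivatives commute. -/
lemma pd_hess (hu : ContDiffAt ℝ 3 u x) (i j k : Fin n) :
    pd k (fun y => hess u y i j) x = hess (pd k u) x i j := by
  have h1 : ContDiffAt ℝ 2 (pd i u) x := contDiffAt_pd i (m := 2) (hu.of_le (by norm_num))
  have e : pd k (pd i u) =ᶠ[𝓝 x] pd i (pd k u) := by
    filter_upwards [hu.eventually (by simp)] with y hy
    exact pd_comm (hy.of_le (by norm_num)) i k
  calc pd k (pd j (pd i u)) x = pd j (pd k (pd i u)) x := pd_comm h1 j k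
    _ = pd j (pd i (pd k u)) x := pd_congr j e

lemma hasDerivAt_wFun {p : ℝ → E n} {q : Fin n → ℝ} (hp : ‖p 0‖ < 1)
    (h : ∀ i, HasDerivAt (fun t => p t i) (q i) 0) :
    HasDerivAt (fun t => wFun (p t)) (-((p 0).ofLp ⬝ᵥ q) / wFun (p 0)) 0 := by
  have h1 := HasDerivAt.fun_sum (u := Finset.univ) fun i _ => (h i).fun_mul (h i)
  have h2 := (h1.const_sub 1).sqrt (by
    have := wFun_sq hp
    have hw := wFun_pos hp
    simp only [dotProduct] at this
    rw [← this]; positivity)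
  have e : ∀ t, √(1 - ∑ i, p t i * p t i) = wFun (p t) := by
    intro t
    rw [wFun, ← dotProduct_self_eq]; rfl
  simp only [e] at h2
  convert h2 using 1
  have hw := wFun_pos hp
  have : ∑ i, (q i * (p 0) i + (p 0) i * q i) = 2 * ((p 0).ofLp ⬝ᵥ q) := by
    simp only [dotProduct, Finset.mul_sum]
    exact Finset.sum_congr rfl fun i _ => by ring
  rw [this]
  field_simp

end Curve

namespace IsAdmissibleSolution

variable {f : E n → ℝ} {Ω : Set (E n)} {sig eps : ℝ} {u : E n → ℝ}

/-- The differentiated curvature equation at an interior point. -/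
theorem exists_linearized (hf : IsCurvatureFunction f) (hΩ : IsOpen Ω)
    (hu : IsAdmissibleSolution f Ω sig eps u) {x : E n} (hx : x ∈ Ω) :
    ∃ a e : Matrix (Fin n) (Fin n) ℝ, a.PosSemidef ∧ eᵀ = e ∧
      e * metMat (grad u x) = a * convMat (hess u x) (grad u x) (u x) ∧
      (a * convMat (hess u x) (grad u x) (u x)).trace = sig ∧
      1 ≤ wFun (grad u x) * (a * metMat (grad u x)).trace ∧
      0 ≤ (a * convMat (hess u x) (grad u x) (u x) * invMet (grad u x)
        * convMat (hess u x) (grad u x) (u x)).trace ∧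
      ∀ k, linOp sig (u x) (grad u x).ofLp (wFun (grad u x)) (hess u x) a e
        (pd k u x) (fun i => pd i (pd k u) x) (hess (pd k u) x) = 0 := by
  have hxc := subset_closure hx
  have hp := hu.spacelike x hxc
  have hw := wFun_pos hp
  have hu3 : ContDiffAt ℝ 3 u x := hu.contDiffAt_nat hxc 3
  have hu2 : ContDiffAt ℝ 2 u x := hu.contDiffAt_nat hxc 2
  obtain ⟨P, hP, hPA, hPtr, hP1, hPAA, hPF⟩ := exists_supergradient hf (hu.curvMat_posDef hx)
  have hsig : matFun f (curvMat (hess u x) (grad u x) (u x)) = sig := hu.eqn x hx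
  set p := grad u x with hpdef
  set U := hess u x with hU
  set w := wFun p with hwdef
  set G := gammaMat p with hGdef
  set g := metMat p with hgdef
  set B := convMat U p (u x) with hB
  have hA : curvMat U p (u x) = (1 / w) • (G * B * G) := curvMat_eq hp _ _
  have hGgG : G * g * G = 1 := gammaMat_metMat_gammaMat hp
  have hGg : G * g = g * G := gammaMat_comm_metMat p
  have hGt : Gᵀ = G := gammaMat_transpose p
  have hBt : Bᵀ = B := by
    have := (hu.convMat_posDef hx).isHermitian
    simpa [IsHermitian] using this
  have hPt : Pᵀ = P := by simpa [IsHermitian] using hP.isHermitian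
  have hUt : Uᵀ = U := hess_isSymm hu2
  rw [hsig] at hPtr
  rw [hA] at hPA hPtr hPAA
  have hPA' : P * (G * B * G) = G * B * G * P := by
    have := congrArg (fun M => w • M) hPA
    simpa [smul_smul, hw.ne'] using this
  have hPtr' : (P * (G * B * G)).trace = w * sig := by
    rw [mul_smul_comm, trace_smul, smul_eq_mul] at hPtr
    rw [← hPtr]; field_simp
  have hGG : G * G = invMet p := gammaMat_mul_self hp
  have hap : ((1 / w) • (G * P * G)).PosSemidef := by
    have := hP.conjTranspose_mul_mul_same G
    rw [conjTranspose_eq_transpose_of_trivial, hGt] at this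
    exact this.smul (by positivity)
  have het : ((1 / w) • (G * P * G) * B * G * G)ᵀ = (1 / w) • (G * P * G) * B * G * G := by
    simp only [transpose_mul, transpose_smul, hGt, hPt, hBt, smul_mul_assoc, mul_smul_comm]
    congr 1
    calc G * (G * (B * (G * (P * G)))) = G * (G * B * G * P) * G := by simp only [Matrix.mul_assoc]
      _ = G * (P * (G * B * G)) * G := by rw [hPA']
      _ = _ := by simp only [Matrix.mul_assoc]
  -- The coefficients are `a = γ P γ / w` and `e = a B g⁻¹`, using `γ² = g⁻¹`; `e` is symmetric
  -- because `P` commutes with `γ B γ`.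
  refine ⟨(1 / w) • (G * P * G), (1 / w) • (G * P * G) * B * G * G, hap, het, ?_, ?_, ?_, ?_, ?_⟩
  · rw [Matrix.mul_assoc, Matrix.mul_assoc, hGg, ← Matrix.mul_assoc G, hGgG, Matrix.mul_one]
  · rw [smul_mul_assoc, trace_smul, smul_eq_mul, Matrix.mul_assoc, Matrix.mul_assoc,
      trace_mul_comm, Matrix.mul_assoc, Matrix.mul_assoc, ← Matrix.mul_assoc G, hPtr']
    field_simp
  · rw [smul_mul_assoc, trace_smul, smul_eq_mul, Matrix.mul_assoc, Matrix.mul_assoc,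
      trace_mul_comm, Matrix.mul_assoc, hGgG, Matrix.mul_one]
    field_simp
    exact hP1
  · have h0 := hPAA.trace_nonneg
    have e : ((1 / w) • (G * P * G) * B * invMet p * B).trace
        = w * (P * (1 / w) • (G * B * G) * (1 / w) • (G * B * G)).trace := by
      rw [← hGG]
      simp only [smul_mul_assoc, mul_smul_comm, trace_smul, smul_eq_mul]
      have : G * P * G * B * (G * G) * B = G * (P * (G * B * G) * (G * B)) := by
        simp only [Matrix.mul_assoc]
      rw [this, trace_mul_comm]
      simp only [Matrix.mul_assoc]
      field_simp
    rw [e]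
    positivity
  intro k
  set c : ℝ → E n := fun t => x + t • EuclideanSpace.single k 1 with hc
  have hc0 : c 0 = x := by simp [hc]
  have hcc : Continuous c := by fun_prop
  have hcΩ : ∀ᶠ t in 𝓝 (0 : ℝ), c t ∈ Ω :=
    hcc.continuousAt.eventually (by rw [hc0]; exact hΩ.mem_nhds hx)
  set q : Fin n → ℝ := fun i => pd i (pd k u) x with hq
  have hpd : ∀ i, HasDerivAt (fun t => grad u (c t) i) (q i) 0 := by
    intro i
    have := hasDerivAt_coord_line (differentiableAt_pd hu2 i) k
    rw [pd_comm hu2 i k] at this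
    exact this
  have hud : HasDerivAt (fun t => u (c t)) (pd k u x) 0 :=
    hasDerivAt_coord_line (hu2.differentiableAt (by norm_num)) k
  have hUd : MDeriv (fun t => hess u (c t)) (hess (pd k u) x) := by
    intro i j
    have := hasDerivAt_coord_line (contDiffAt_hess_entry hu3 i j) k
    rw [pd_hess hu3] at this
    exact this
  have hwd : HasDerivAt (fun t => wFun (grad u (c t))) (-(p.ofLp ⬝ᵥ q) / w) 0 := by
    have := hasDerivAt_wFun (p := fun t => grad u (c t)) (q := q) (by simpa [hc0] using hp) hpd
    simpa only [hc0] using this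
  have hNd : MDeriv (fun t => vecMulVec (grad u (c t)).ofLp (grad u (c t)).ofLp)
      (vecMulVec q p.ofLp + vecMulVec p.ofLp q) := by
    have := MDeriv.vecMulVec hpd hpd
    simpa only [hc0] using this
  have hgd : MDeriv (fun t => metMat (grad u (c t))) (-(vecMulVec q p.ofLp + vecMulVec p.ofLp q)) := by
    have := (MDeriv.const 1).sub hNd
    rw [zero_sub] at this
    exact this
  have hBd : MDeriv (fun t => convMat (hess u (c t)) (grad u (c t)) (u (c t)))
      (-(vecMulVec q p.ofLp + vecMulVec p.ofLp q) - (pd k u x • U + u x • hess (pd k u) x)) := by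
    have := hgd.sub (MDeriv.smul hud hUd)
    simp only [hc0] at this
    exact this
  -- Only the existence of the derivative of `γ` matters, since `trace_deriv_identity` eliminates
  -- its value.
  obtain ⟨G1, hGd⟩ : ∃ G1, MDeriv (fun t => gammaMat (grad u (c t))) G1 := by
    simp only [gammaMat_eq]
    have h1 : HasDerivAt (fun t => 1 / (wFun (grad u (c t)) * (1 + wFun (grad u (c t))))) _ 0 :=
      (hasDerivAt_const (0 : ℝ) (1 : ℝ)).fun_div (hwd.fun_mul (hwd.const_add 1))
        (by rw [hc0]; positivity)
    exact ⟨_, (MDeriv.const 1).add (MDeriv.smul h1 hNd)⟩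
  have hν : HasDerivAt (fun t => 1 / wFun (grad u (c t))) ((p.ofLp ⬝ᵥ q) / w ^ 3) 0 := by
    have := (hasDerivAt_const (0 : ℝ) (1 : ℝ)).fun_div hwd (by rw [hc0]; positivity)
    rw [hc0, ← hpdef, ← hwdef] at this
    refine this.congr_deriv ?_
    field_simp
    ring
  have hG1 : G1 * g * G + G * (-(vecMulVec q p.ofLp + vecMulVec p.ofLp q)) * G + G * g * G1 = 0 := by
    have h1 := (hGd.mul hgd).mul hGd
    have h2 : MDeriv (fun t => gammaMat (grad u (c t)) * metMat (grad u (c t))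
        * gammaMat (grad u (c t))) 0 := by
      refine (MDeriv.const 1).congr ?_
      filter_upwards [hcΩ] with t ht
      exact (gammaMat_metMat_gammaMat (hu.spacelike _ (subset_closure ht))).symm
    have h3 := h1.unique h2
    simp only [hc0] at h3
    rw [← h3, add_mul]
  have hAd : MDeriv (fun t => curvMat (hess u (c t)) (grad u (c t)) (u (c t)))
      (((p.ofLp ⬝ᵥ q) / w ^ 3) • (G * B * G) + (1 / w) • (G1 * B * G
        + G * (-(vecMulVec q p.ofLp + vecMulVec p.ofLp q)
          - (pd k u x • U + u x • hess (pd k u) x)) * G + G * B * G1)) := by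
    have h1 := MDeriv.smul hν ((hGd.mul hBd).mul hGd)
    simp only [hc0] at h1
    rw [add_mul] at h1
    refine h1.congr ?_
    filter_upwards [hcΩ] with t ht
    exact (curvMat_eq (hu.spacelike _ (subset_closure ht)) _ _).symm
  have hΘ := ((MDeriv.const P).mul hAd).trace
  simp only [Matrix.zero_mul, zero_add] at hΘ
  -- The supergradient inequality bounds the trace below by `F = σ` along the line, with equality at
  -- `t = 0`; the first order condition replaces differentiating `F`.
  have hmin : IsLocalMin (fun t => (P * curvMat (hess u (c t)) (grad u (c t)) (u (c t))).trace) 0 := by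
    filter_upwards [hcΩ] with t ht
    have h1 := hPF _ (hu.curvMat_posDef ht)
    have h2 : matFun f (curvMat (hess u (c t)) (grad u (c t)) (u (c t))) = sig := hu.eqn _ ht
    rw [hc0, ← hpdef, ← hU, hA, hPtr]
    rwa [h2] at h1
  have hder := hmin.hasDerivAt_eq_zero hΘ
  have key := trace_deriv_identity hGgG hGg hPA' hG1 hder
  rw [hPtr'] at key
  set a := (1 / w) • (G * P * G) with ha
  have hat : aᵀ = a := by simpa [IsHermitian] using hap.isHermitian
  set e := a * B * G * G with he
  rw [linOp]
  simp only [mul_sub, mul_add, mul_neg, trace_sub, trace_neg, trace_add, mul_smul_comm, trace_smul,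
    smul_eq_mul, trace_mul_vecMulVec] at key
  rw [dotProduct_mulVec_symm hat p.ofLp q, dotProduct_mulVec_symm het p.ofLp q] at key
  have e3 : p.ofLp ⬝ᵥ q / w ^ 3 * (w * sig) = sig / w ^ 2 * (p.ofLp ⬝ᵥ q) := by field_simp
  rw [e3] at key
  linarith

end IsAdmissibleSolution

end DeSitter

end

/-! ### Algebra of the linearized operator: isometry fields, `w`, and the barrier. -/

noncomputable section

namespace DeSitter
open Matrix Filter Topology

variable {n : ℕ}

section LinOpAlgebra

variable {sig z w : ℝ} {p : Fin n → ℝ} {U a e : Matrix (Fin n) (Fin n) ℝ}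

lemma linOp_add (c c' : ℝ) (d d' : Fin n → ℝ) (H H' : Matrix (Fin n) (Fin n) ℝ) :
    linOp sig z p w U a e (c + c') (d + d') (H + H')
      = linOp sig z p w U a e c d H + linOp sig z p w U a e c' d' H' := by
  simp only [linOp, mul_add, trace_add, mulVec_add, dotProduct_add]
  ring

lemma linOp_smul (t c : ℝ) (d : Fin n → ℝ) (H : Matrix (Fin n) (Fin n) ℝ) :
    linOp sig z p w U a e (t * c) (t • d) (t • H) = t * linOp sig z p w U a e c d H := by
  simp only [linOp, mul_smul_comm, trace_smul, mulVec_smul, dotProduct_smul, smul_eq_mul]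
  ring

lemma linOp_sub (c c' : ℝ) (d d' : Fin n → ℝ) (H H' : Matrix (Fin n) (Fin n) ℝ) :
    linOp sig z p w U a e (c - c') (d - d') (H - H')
      = linOp sig z p w U a e c d H - linOp sig z p w U a e c' d' H' := by
  simp only [linOp, mul_sub, trace_sub, mulVec_sub, dotProduct_sub]
  ring

lemma linOp_zero : linOp sig z p w U a e 0 0 0 = 0 := by simp [linOp]

lemma linOp_sum {ι : Type*} (s : Finset ι) (c : ι → ℝ) (d : ι → Fin n → ℝ)
    (H : ι → Matrix (Fin n) (Fin n) ℝ) :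
    linOp sig z p w U a e (∑ k ∈ s, c k) (∑ k ∈ s, d k) (∑ k ∈ s, H k)
      = ∑ k ∈ s, linOp sig z p w U a e (c k) (d k) (H k) := by
  classical
  induction s using Finset.induction_on with
  | empty => simp [linOp_zero]
  | insert b s hb ih => simp only [Finset.sum_insert hb, linOp_add, ih]

end LinOpAlgebra

/-- The algebraic data of the linearized equation at a point. -/
structure LinData (sig z : ℝ) (p : Fin n → ℝ) (w : ℝ) (U a e : Matrix (Fin n) (Fin n) ℝ)
    (H : Fin n → Matrix (Fin n) (Fin n) ℝ) : Prop where
  z_pos : 0 < z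
  w_pos : 0 < w
  w_sq : w ^ 2 = 1 - p ⬝ᵥ p
  U_symm : Uᵀ = U
  a_psd : a.PosSemidef
  e_symm : eᵀ = e
  e_mul : e * (1 - vecMulVec p p) = a * (1 - vecMulVec p p - z • U)
  trace_eq : (a * (1 - vecMulVec p p - z • U)).trace = sig
  one_le : 1 ≤ w * (a * (1 - vecMulVec p p)).trace
  sq_nonneg : 0 ≤ (a * (1 - vecMulVec p p - z • U) * (1 + (1 / w ^ 2) • vecMulVec p p)
    * (1 - vecMulVec p p - z • U)).trace
  lin : ∀ k, linOp sig z p w U a e (p k) (U k) (H k) = 0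

namespace LinData

variable {sig z w : ℝ} {p : Fin n → ℝ} {U a e : Matrix (Fin n) (Fin n) ℝ}
  {H : Fin n → Matrix (Fin n) (Fin n) ℝ}

lemma a_symm (h : LinData sig z p w U a e H) : aᵀ = a := by
  simpa [IsHermitian] using h.a_psd.isHermitian

lemma trace_a_U (h : LinData sig z p w U a e H) :
    z * (a * U).trace = a.trace - p ⬝ᵥ a *ᵥ p - sig := by
  have := h.trace_eq
  simp only [mul_sub, mul_one, trace_sub, trace_mul_vecMulVec, mul_smul_comm, trace_smul,
    smul_eq_mul] at this
  linarith

lemma trace_e (h : LinData sig z p w U a e H) : e.trace - p ⬝ᵥ e *ᵥ p = sig := by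
  rw [← h.trace_eq, ← h.e_mul]
  simp only [mul_sub, mul_one, trace_sub, trace_mul_vecMulVec]

/-- The transpose of `e g = a (g - zU)`. It exchanges the products `z U a` appearing in cross terms
for the first order coefficients `a` and `e`, which is why those terms cancel below. -/
lemma smul_U_mul_a (h : LinData sig z p w U a e H) :
    z • (U * a) = (1 - vecMulVec p p) * (a - e) := by
  have h1 := congrArg transpose h.e_mul
  simp only [transpose_mul, transpose_sub, transpose_one, transpose_vecMulVec, transpose_smul,
    h.e_symm, h.a_symm, h.U_symm] at h1
  rw [mul_sub, h1, sub_mul _ (z • U), smul_mul_assoc]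
  abel

/-- The operator applied to `∑ cₖ uₖ` with affine coefficients. -/
lemma linOp_affine (h : LinData sig z p w U a e H) (c : Fin n → ℝ) (M : Matrix (Fin n) (Fin n) ℝ) :
    linOp sig z p w U a e (∑ k, c k * p k) (∑ k, (c k • U k + p k • M k))
      (∑ k, (c k • H k + p k • (0 : Matrix (Fin n) (Fin n) ℝ) + vecMulVec (M k) (U k)
        + vecMulVec (U k) (M k)))
      = -2 * (a * Mᵀ).trace + 2 * (e * Mᵀ).trace + sig / w ^ 2 * (p ⬝ᵥ Mᵀ *ᵥ p) := by
  have h1 : ∀ k, linOp sig z p w U a e (c k * p k) (c k • U k + p k • M k)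
      (c k • H k + p k • (0 : Matrix (Fin n) (Fin n) ℝ) + vecMulVec (M k) (U k)
        + vecMulVec (U k) (M k)) = -2 * z * (U k ⬝ᵥ a *ᵥ M k)
        + p k * (-2 * (p ⬝ᵥ a *ᵥ M k) + 2 * (p ⬝ᵥ e *ᵥ M k) + sig / w ^ 2 * (p ⬝ᵥ M k)) := by
    intro k
    have e1 : linOp sig z p w U a e (c k * p k) (c k • U k + p k • M k)
      (c k • H k + p k • (0 : Matrix (Fin n) (Fin n) ℝ) + vecMulVec (M k) (U k)
        + vecMulVec (U k) (M k)) = linOp sig z p w U a e (c k * p k) (c k • U k) (c k • H k)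
        + linOp sig z p w U a e 0 (p k • M k) (vecMulVec (M k) (U k) + vecMulVec (U k) (M k)) := by
      rw [← linOp_add]
      congr 1
      · simp
      · rw [smul_zero]; abel
    -- The part carrying third derivatives is `cₖ` times the differentiated equation and vanishes;
    -- only derivatives of the coefficients remain.
    rw [e1, linOp_smul, h.lin, linOp]
    simp only [mul_add, trace_add, trace_mul_vecMulVec, mulVec_smul, dotProduct_smul, smul_eq_mul]
    rw [dotProduct_mulVec_symm h.a_symm (U k) (M k)]
    ring
  rw [linOp_sum]
  simp only [h1, Finset.sum_add_distrib, ← Finset.mul_sum, mul_add]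
  have e1 : ∑ k, U k ⬝ᵥ a *ᵥ M k = (U * a * Mᵀ).trace := by
    simp only [trace, Matrix.diag_apply, Matrix.mul_assoc, Matrix.mul_apply, dotProduct, mulVec,
      transpose_apply]
  have hsum : ∀ v : Fin n → ℝ, ∑ k, p k * (v ⬝ᵥ M k) = v ⬝ᵥ Mᵀ *ᵥ p := by
    intro v
    simp only [dotProduct, mulVec, transpose_apply, Finset.mul_sum]
    rw [Finset.sum_comm]
    exact Finset.sum_congr rfl fun i _ => Finset.sum_congr rfl fun k _ => by ring
  have e2 : ∀ b : Matrix (Fin n) (Fin n) ℝ, ∑ k, p k * (p ⬝ᵥ b *ᵥ M k) = p ⬝ᵥ b *ᵥ (Mᵀ *ᵥ p) := by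
    intro b
    simp only [dotProduct_mulVec p b]
    exact hsum _
  have e3 : z * (U * a * Mᵀ).trace = (a * Mᵀ).trace - p ⬝ᵥ a *ᵥ (Mᵀ *ᵥ p)
      - (e * Mᵀ).trace + p ⬝ᵥ e *ᵥ (Mᵀ *ᵥ p) := by
    rw [← smul_eq_mul, ← trace_smul, ← smul_mul_assoc, h.smul_U_mul_a]
    have e4 : ∀ b : Matrix (Fin n) (Fin n) ℝ, ((1 - vecMulVec p p) * b * Mᵀ).trace
        = (b * Mᵀ).trace - p ⬝ᵥ b *ᵥ (Mᵀ *ᵥ p) := by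
      intro b
      rw [Matrix.mul_assoc, sub_mul, one_mul, trace_sub, trace_mul_comm (vecMulVec p p),
        trace_mul_vecMulVec, mulVec_mulVec]
    rw [mul_sub, sub_mul, trace_sub, e4, e4]
    ring
  have e5 : ∑ k, p k * (-2 * (p ⬝ᵥ a *ᵥ M k)) = -2 * ∑ k, p k * (p ⬝ᵥ a *ᵥ M k) := by
    rw [Finset.mul_sum]; exact Finset.sum_congr rfl fun k _ => by ring
  have e6 : ∑ k, p k * (2 * (p ⬝ᵥ e *ᵥ M k)) = 2 * ∑ k, p k * (p ⬝ᵥ e *ᵥ M k) := by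
    rw [Finset.mul_sum]; exact Finset.sum_congr rfl fun k _ => by ring
  have e7 : ∑ k, p k * (sig / w ^ 2 * (p ⬝ᵥ M k)) = sig / w ^ 2 * ∑ k, p k * (p ⬝ᵥ M k) := by
    rw [Finset.mul_sum]; exact Finset.sum_congr rfl fun k _ => by ring
  rw [e1, e5, e6, e7, e2, e2, hsum]
  linear_combination -2 * e3

/-- Translations and rotations are isometries. Algebraically, the symmetric matrices `a`, `e` and `p
pᵀ` all pair to zero with the skew matrix `M`. -/
lemma linOp_antisymm (h : LinData sig z p w U a e H) (c : Fin n → ℝ)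
    {M : Matrix (Fin n) (Fin n) ℝ} (hM : Mᵀ = -M) :
    linOp sig z p w U a e (∑ k, c k * p k) (∑ k, (c k • U k + p k • M k))
      (∑ k, (c k • H k + p k • (0 : Matrix (Fin n) (Fin n) ℝ) + vecMulVec (M k) (U k)
        + vecMulVec (U k) (M k))) = 0 := by
  rw [h.linOp_affine]
  have h1 : ∀ b : Matrix (Fin n) (Fin n) ℝ, bᵀ = b → (b * Mᵀ).trace = 0 := by
    intro b hb
    have : (b * Mᵀ).trace = -(b * Mᵀ).trace := by
      conv_lhs => rw [← trace_transpose, transpose_mul, transpose_transpose, hb, trace_mul_comm]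
      rw [hM, mul_neg, trace_neg, neg_neg]
    linarith
  have h2 : p ⬝ᵥ Mᵀ *ᵥ p = 0 := by
    have : p ⬝ᵥ Mᵀ *ᵥ p = -(p ⬝ᵥ Mᵀ *ᵥ p) := by
      conv_lhs => rw [dotProduct_mulVec, ← mulVec_transpose, transpose_transpose, dotProduct_comm]
      rw [hM, neg_mulVec, dotProduct_neg, neg_neg]
    linarith
  rw [h1 a h.a_symm, h1 e h.e_symm, h2]
  ring

/-- The dilation field is annihilated. -/
lemma linOp_dilation (h : LinData sig z p w U a e H) (c : Fin n → ℝ) :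
    linOp sig z p w U a e (z - ∑ k, c k * p k)
      (p - ∑ k, (c k • U k + p k • (1 : Matrix (Fin n) (Fin n) ℝ) k))
      (U - ∑ k, (c k • H k + p k • (0 : Matrix (Fin n) (Fin n) ℝ)
        + vecMulVec ((1 : Matrix (Fin n) (Fin n) ℝ) k) (U k)
        + vecMulVec (U k) ((1 : Matrix (Fin n) (Fin n) ℝ) k))) = 0 := by
  rw [linOp_sub, h.linOp_affine, linOp]
  have h1 := h.trace_a_U
  have h2 := h.trace_e
  simp only [transpose_one, mul_one, one_mulVec]
  linear_combination -2 * h1 - 2 * h2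

/-- Lower bound for the operator applied to `w`. -/
lemma linOp_w_ge (h : LinData sig z p w U a e H) {dw : Fin n → ℝ} {Hw : Matrix (Fin n) (Fin n) ℝ}
    (hd : w • dw = -(∑ k, p k • U k))
    (hH : w • Hw = -(∑ k, (p k • H k + vecMulVec (U k) (U k))) - vecMulVec dw dw) :
    -sig / (z * w) ≤ linOp sig z p w U a e w dw Hw := by
  have hw := h.w_pos
  have hz := h.z_pos
  set q : Fin n → ℝ := ∑ k, p k • U k with hq
  have hqU : q = U *ᵥ p := by
    rw [← h.U_symm]
    ext i
    simp [hq, Finset.sum_apply, mulVec, dotProduct, mul_comm]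
  have hUU : ∑ k, vecMulVec (U k) (U k) = U * U := by
    ext i j
    have hs : ∀ k, U i k = U k i := fun k => by
      conv_lhs => rw [← h.U_symm]
      rfl
    simp [Matrix.sum_apply, vecMulVec_apply, Matrix.mul_apply, hs]
  -- The differentiated equations contracted with `p`; this removes the third derivatives from the
  -- operator applied to `w`.
  have hlin : -z * ∑ k, p k * (a * H k).trace - (p ⬝ᵥ p) * (a * U).trace - 2 * (p ⬝ᵥ a *ᵥ q)
      + 2 * (p ⬝ᵥ e *ᵥ q) + sig / w ^ 2 * (p ⬝ᵥ q) = 0 := by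
    have h1 : linOp sig z p w U a e (∑ k, p k * p k) (∑ k, p k • U k) (∑ k, p k • H k) = 0 := by
      rw [linOp_sum]
      exact Finset.sum_eq_zero fun k _ => by rw [linOp_smul, h.lin, mul_zero]
    rw [linOp] at h1
    rw [← h1, Matrix.mul_sum, trace_sum]
    simp only [mul_smul_comm, trace_smul, smul_eq_mul]
    rfl
  have hdd : dw = (-(1 / w)) • q := by
    have := congrArg (fun v => (1 / w) • v) hd
    simp only [smul_smul, one_div_mul_cancel hw.ne', one_smul] at this
    rw [this]; module
  have hwL : w * linOp sig z p w U a e w dw Hw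
      = -(a * U).trace + z * ((a * (U * U)).trace + 1 / w ^ 2 * (q ⬝ᵥ a *ᵥ q)) := by
    have h1 : linOp sig z p w U a e (w * w) (w • dw) (w • Hw)
        = w * linOp sig z p w U a e w dw Hw := linOp_smul w w dw Hw
    rw [← h1, hd, hH, linOp, Finset.sum_add_distrib, hUU]
    simp only [mul_sub, mul_neg, mul_add, trace_sub, trace_neg, trace_add, Matrix.mul_sum, trace_sum,
      mul_smul_comm, trace_smul, smul_eq_mul, trace_mul_vecMulVec, mulVec_neg, dotProduct_neg]
    rw [hdd]
    simp only [mulVec_smul, dotProduct_smul, smul_dotProduct, smul_eq_mul]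
    have hww := h.w_sq
    have e1 : -(1 / w) * (-(1 / w) * (q ⬝ᵥ a *ᵥ q)) = 1 / w ^ 2 * (q ⬝ᵥ a *ᵥ q) := by
      field_simp
    rw [e1]
    linear_combination -hlin - (a * U).trace * hww
  have hqq : q ⬝ᵥ a *ᵥ q = (a * (U * vecMulVec p p * U)).trace := by
    rw [mul_vecMulVec, vecMulVec_mul, trace_mul_vecMulVec, ← hqU]
    congr 1
    rw [← mulVec_transpose, h.U_symm, ← hqU]
  have hsq := h.sq_nonneg
  set N := vecMulVec p p with hN
  have hNN : N * N = (1 - w ^ 2) • N := by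
    rw [hN, vecMulVec_mul_self, h.w_sq]; congr 1; ring
  have hginv : (1 - N) * (1 + (1 / w ^ 2) • N) = 1 := by
    have hc : (1 / w ^ 2) * (1 - w ^ 2) = 1 / w ^ 2 - 1 := by field_simp
    generalize 1 - w ^ 2 = s at hNN hc
    simp only [sub_mul, mul_add, one_mul, mul_one, mul_smul_comm, hNN]
    rw [smul_sub, show (1 / w ^ 2) • s • N = (1 / w ^ 2 - 1) • N by rw [smul_smul, hc]]
    module
  have hginv' : (1 + (1 / w ^ 2) • N) * (1 - N) = 1 := by
    have hc : (1 / w ^ 2) * (1 - w ^ 2) = 1 / w ^ 2 - 1 := by field_simp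
    generalize 1 - w ^ 2 = s at hNN hc
    simp only [mul_sub, add_mul, one_mul, mul_one, smul_mul_assoc, hNN]
    rw [show (1 / w ^ 2) • s • N = (1 / w ^ 2 - 1) • N by rw [smul_smul, hc]]
    module
  set gi := 1 + (1 / w ^ 2) • N with hgi
  set g := 1 - N with hg
  -- Expanding the nonnegative trace of `a B g⁻¹ B` with `B = g - zU`, and subtracting `tr(aB) = σ`,
  -- leaves exactly `z w L(w) ≥ -σ`.
  have e2 : a * (g - z • U) * gi * (g - z • U)
      = a * g - z • (a * U) - z • (a * U) + (z * z) • (a * (U * gi * U)) := by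
    have : a * (g - z • U) * gi * (g - z • U) = a * ((g * gi) * g) - z • (a * (g * gi * U))
        - z • (a * (U * (gi * g))) + (z * z) • (a * (U * gi * U)) := by
      simp only [mul_sub, sub_mul, mul_smul_comm, smul_mul_assoc, Matrix.mul_assoc, smul_sub,
        smul_smul]
      abel
    rw [this, hginv, hginv', one_mul, one_mul, mul_one]
  have e3 : (a * (U * gi * U)).trace = (a * (U * U)).trace + 1 / w ^ 2 * (q ⬝ᵥ a *ᵥ q) := by
    rw [hqq, hgi]
    simp only [mul_add, add_mul, mul_one, trace_add, mul_smul_comm, smul_mul_assoc, trace_smul,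
      smul_eq_mul]
  rw [e2] at hsq
  simp only [trace_add, trace_sub, trace_smul, smul_eq_mul] at hsq
  rw [e3] at hsq
  have htr := h.trace_eq
  simp only [mul_sub, mul_smul_comm, trace_sub, trace_smul, smul_eq_mul] at htr
  rw [div_le_iff₀ (by positivity)]
  have hzz : z * (w * linOp sig z p w U a e w dw Hw)
      = -(z * (a * U).trace) + z * z * ((a * (U * U)).trace + 1 / w ^ 2 * (q ⬝ᵥ a *ᵥ q)) := by
    rw [hwL]; ring
  have htr2 : (a * g).trace - z * (a * U).trace = sig := by
    rw [← htr, hg, mul_sub, trace_sub]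
  linarith

/-- The operator applied to a product `w b`. -/
lemma linOp_w_mul (h : LinData sig z p w U a e H) {dw db : Fin n → ℝ}
    {Hw Hb : Matrix (Fin n) (Fin n) ℝ} (b : ℝ) (hd : w • dw = -(∑ k, p k • U k)) :
    linOp sig z p w U a e (w * b) (w • db + b • dw)
      (w • Hb + b • Hw + vecMulVec dw db + vecMulVec db dw)
      = b * linOp sig z p w U a e w dw Hw - z * w * (a * Hb).trace + sig / w * (p ⬝ᵥ db) := by
  have hw := h.w_pos
  have hqU : (∑ k, p k • U k : Fin n → ℝ) = U *ᵥ p := by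
    conv_rhs => rw [← h.U_symm]
    ext i
    simp only [Finset.sum_apply, Pi.smul_apply, smul_eq_mul, mulVec, dotProduct, transpose_apply]
    exact Finset.sum_congr rfl fun k _ => mul_comm _ _
  have hdw : dw = (-(1 / w)) • (U *ᵥ p) := by
    have := congrArg (fun v => (1 / w) • v) hd
    simp only [smul_smul, one_div_mul_cancel hw.ne', one_smul] at this
    rw [this, hqU]; module
  have e1 : linOp sig z p w U a e (w * b) (w • db + b • dw)
      (w • Hb + b • Hw + vecMulVec dw db + vecMulVec db dw)
      = linOp sig z p w U a e (b * w) (b • dw) (b • Hw)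
        + linOp sig z p w U a e 0 (w • db) (w • Hb + (vecMulVec dw db + vecMulVec db dw)) := by
    rw [← linOp_add]
    congr 1
    · ring
    · abel
    · abel
  rw [e1, linOp_smul]
  -- This is the reason for the factor `w`. From `w dw = -Up`, `z U a = g (a - e)` and `g p = w² p`,
  -- the cross term of the product cancels the first order terms in `a` and `e`, which have no a
  -- priori bound; the drift `σ/w · p` survives.
  have e2 : z * (dw ⬝ᵥ a *ᵥ db) = -w * (p ⬝ᵥ a *ᵥ db) + w * (p ⬝ᵥ e *ᵥ db) := by
    have h1 : z * ((U *ᵥ p) ⬝ᵥ a *ᵥ db) = w ^ 2 * (p ⬝ᵥ (a - e) *ᵥ db) := by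
      have h2 : (U *ᵥ p) ⬝ᵥ a *ᵥ db = p ⬝ᵥ (U * a) *ᵥ db := by
        rw [← mulVec_mulVec, dotProduct_mulVec p U, ← mulVec_transpose, h.U_symm]
      rw [h2, ← smul_eq_mul, ← dotProduct_smul, ← smul_mulVec, h.smul_U_mul_a, ← mulVec_mulVec,
        dotProduct_mulVec p, h.w_sq]
      have : p ᵥ* (1 - vecMulVec p p) = (1 - p ⬝ᵥ p) • p := by
        rw [vecMul_sub, vecMul_one, vecMul_vecMulVec]
        ext i; simp; ring
      rw [this, smul_dotProduct, smul_eq_mul]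
    rw [hdw, smul_dotProduct, smul_eq_mul]
    rw [sub_mulVec, dotProduct_sub] at h1
    have : z * (-(1 / w) * ((U *ᵥ p) ⬝ᵥ a *ᵥ db)) = -(1 / w) * (z * ((U *ᵥ p) ⬝ᵥ a *ᵥ db)) := by
      ring
    rw [this, h1]
    field_simp
    ring
  have e4 : ∀ v : Fin n → ℝ, linOp sig z p w U a e 0 v
      (w • Hb + (vecMulVec dw db + vecMulVec db dw)) = -z * (w * (a * Hb).trace
        + 2 * (dw ⬝ᵥ a *ᵥ db)) - 2 * (p ⬝ᵥ a *ᵥ v) + 2 * (p ⬝ᵥ e *ᵥ v) + sig / w ^ 2 * (p ⬝ᵥ v) := by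
    intro v
    rw [linOp]
    simp only [mul_add, trace_add, trace_mul_vecMulVec, mul_smul_comm, trace_smul, smul_eq_mul]
    rw [dotProduct_mulVec_symm h.a_symm dw db]
    ring
  rw [e4]
  simp only [mulVec_smul, dotProduct_smul, smul_eq_mul]
  have e3 : sig / w ^ 2 * (w * (p ⬝ᵥ db)) = sig / w * (p ⬝ᵥ db) := by field_simp
  rw [e3]
  linear_combination -2 * e2

/-- Lower bound for the operator applied to the barrier `w b`,
`b = K (yₙ - u + ε) + (|y|² - u² + ε²) / ε`. -/
lemma linOp_barrier_ge (h : LinData sig z p w U a e H) {dw : Fin n → ℝ}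
    {Hw : Matrix (Fin n) (Fin n) ℝ} {b K eps : ℝ} (hb : 0 ≤ b) (hK : 0 ≤ K)
    (m y : Fin n → ℝ) (hd : w • dw = -(∑ k, p k • U k))
    (hH : w • Hw = -(∑ k, (p k • H k + vecMulVec (U k) (U k))) - vecMulVec dw dw) :
    -(b * sig / (z * w)) + K * (1 - sig / w * (1 - m ⬝ᵥ p))
        - 2 * sig / (w * eps) * (z - y ⬝ᵥ p)
      ≤ linOp sig z p w U a e (w * b)
        (w • (K • (m - p) + (2 / eps) • (y - z • p)) + b • dw)
        (w • (-(K • U) + (2 / eps) • (1 - vecMulVec p p - z • U)) + b • Hw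
          + vecMulVec dw (K • (m - p) + (2 / eps) • (y - z • p))
          + vecMulVec (K • (m - p) + (2 / eps) • (y - z • p)) dw) := by
  rw [h.linOp_w_mul b hd]
  have hw := h.w_pos
  have hz := h.z_pos
  have h1 := mul_le_mul_of_nonneg_left (h.linOp_w_ge hd hH) hb
  have h2 := h.one_le
  have h3 := h.trace_eq
  have h4 : (a * (-(K • U) + (2 / eps) • (1 - vecMulVec p p - z • U))).trace
      = -(K * (a * U).trace) + 2 / eps * sig := by
    rw [mul_add, trace_add, mul_neg, trace_neg, mul_smul_comm, mul_smul_comm, trace_smul, trace_smul,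
      h3, smul_eq_mul, smul_eq_mul]
  have h5 : (a * (1 - vecMulVec p p)).trace - z * (a * U).trace = sig := by
    rw [← h3, mul_sub a _ (z • U), trace_sub, mul_smul_comm, trace_smul, smul_eq_mul]
  rw [h4]
  simp only [dotProduct_add, dotProduct_smul, dotProduct_sub, smul_eq_mul]
  have hpp : p ⬝ᵥ p = 1 - w ^ 2 := by rw [h.w_sq]; ring
  rw [hpp, dotProduct_comm m p, dotProduct_comm y p]
  -- The positive contribution of the `K` part comes from `w tr(a g) ≥ 1`, that is, from `∑ fᵢ ≥ 1`.
  have h6 : K * 1 ≤ K * (w * (a * (1 - vecMulVec p p)).trace) := mul_le_mul_of_nonneg_left h2 hK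
  have h7 : z * w * (-(K * (a * U).trace) + 2 / eps * sig)
      = -(K * (w * (a * (1 - vecMulVec p p)).trace)) + K * w * sig + 2 / eps * sig * z * w := by
    linear_combination K * w * h5
  rw [h7]
  have h8 : sig / w * (K * (p ⬝ᵥ m - (1 - w ^ 2)) + 2 / eps * (p ⬝ᵥ y - z * (1 - w ^ 2)))
      - K * w * sig - 2 / eps * sig * z * w
      = -(K * (sig / w * (1 - p ⬝ᵥ m))) - 2 * sig / (w * eps) * (z - p ⬝ᵥ y) := by
    field_simp
    ring
  have h9 : b * (-sig / (z * w)) = -(b * sig / (z * w)) := by ring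
  linarith

end LinData

lemma IsAdmissibleSolution.exists_linData {f : E n → ℝ} {Ω : Set (E n)} {sig eps : ℝ}
    {u : E n → ℝ} (hf : IsCurvatureFunction f) (hΩ : IsOpen Ω)
    (hu : IsAdmissibleSolution f Ω sig eps u) {x : E n} (hx : x ∈ Ω) :
    ∃ a e, LinData sig (u x) (grad u x).ofLp (wFun (grad u x)) (hess u x) a e
      (fun k => hess (pd k u) x) := by
  obtain ⟨a, e, h1, h2, h3, h4, h5, h6, h7⟩ := hu.exists_linearized hf hΩ hx
  have hp := hu.spacelike x (subset_closure hx)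
  exact ⟨a, e, hu.pos x hx, wFun_pos hp, wFun_sq hp,
    hess_isSymm (hu.contDiffAt_nat (subset_closure hx) 2), h1, h2, h3, h4, h5, h6, h7⟩

end DeSitter

end

/-! ### Touching balls and comparison with umbilic graphs. -/

noncomputable section

namespace DeSitter
open Matrix Filter Topology

variable {n : ℕ}

/-- The interior and exterior balls of radius `R` touching `∂Ω` at `z`, with inner normal `m`. -/
structure TouchingBalls (Ω : Set (E n)) (R : ℝ) (z m : E n) : Prop where
  unit : ‖m‖ = 1
  interior : Metric.ball (z + R • m) R ⊆ Ω
  exterior : ∀ x ∈ Ω, R ≤ dist x (z - R • m)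

lemma TouchingBalls.exterior_closure {Ω : Set (E n)} {R : ℝ} {z m : E n}
    (h : TouchingBalls Ω R z m) {x : E n} (hx : x ∈ closure Ω) : R ≤ dist x (z - R • m) := by
  have hc : IsClosed {x : E n | R ≤ dist x (z - R • m)} :=
    isClosed_le continuous_const (by fun_prop)
  exact closure_minimal h.exterior hc hx

lemma TouchingBalls.interior_frontier {Ω : Set (E n)} (hΩ : IsOpen Ω) {R : ℝ} {z m : E n}
    (h : TouchingBalls Ω R z m) {x : E n} (hx : x ∈ frontier Ω) : R ≤ dist x (z + R • m) := by
  by_contra hlt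
  push Not at hlt
  exact (hΩ.frontier_eq ▸ hx).2 (h.interior hlt)

lemma inner_grad (g : E n → ℝ) (x v : E n) : inner ℝ (grad g x) v = fderiv ℝ g x v := by
  rw [inner_eq_dotProduct, fderiv_apply_eq_sum]
  simp [dotProduct, grad, mul_comm]

lemma mem_or_frontier {Ω : Set (E n)} {x : E n} (hx : x ∈ closure Ω) :
    x ∈ Ω ∨ x ∈ frontier Ω := by
  by_cases h : x ∈ Ω
  · exact Or.inl h
  · refine Or.inr ⟨hx, fun h' => h (interior_subset h')⟩

lemma metMat_quadratic (p : E n) (v : Fin n → ℝ) :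
    v ⬝ᵥ metMat p *ᵥ v = v ⬝ᵥ v - (p.ofLp ⬝ᵥ v) ^ 2 := by
  rw [metMat, sub_mulVec, one_mulVec, dotProduct_sub, vecMulVec_mulVec, sq]
  simp [dotProduct_comm v p.ofLp]

lemma convMat_quadratic (r : Matrix (Fin n) (Fin n) ℝ) (p : E n) (z : ℝ) (v : Fin n → ℝ) :
    v ⬝ᵥ convMat r p z *ᵥ v = v ⬝ᵥ metMat p *ᵥ v - z * (v ⬝ᵥ r *ᵥ v) := by
  rw [convMat, sub_mulVec, dotProduct_sub, smul_mulVec, dotProduct_smul, smul_eq_mul]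

namespace IsAdmissibleSolution

variable {f : E n → ℝ} {Ω : Set (E n)} {sig eps : ℝ} {u : E n → ℝ}

lemma continuousOn (hu : IsAdmissibleSolution f Ω sig eps u) : ContinuousOn u (closure Ω) :=
  fun _ hx => (hu.contDiffAt hx).continuousAt.continuousWithinAt

/-- The minimum principle: `u ≥ ε`. -/
lemma eps_le (hf : IsCurvatureFunction f) (hΩ : IsOpen Ω) (hb : Bornology.IsBounded Ω)
    (hsig : 1 < sig) (hu : IsAdmissibleSolution f Ω sig eps u) {x : E n} (hx : x ∈ closure Ω) :
    eps ≤ u x := by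
  obtain ⟨x1, hx1, hmin⟩ := hb.isCompact_closure.exists_isMinOn ⟨x, hx⟩ hu.continuousOn
  rcases mem_or_frontier hx1 with h | h
  · exfalso
    have hloc : IsLocalMin u x1 := by
      filter_upwards [hΩ.mem_nhds h] with y hy using hmin (subset_closure hy)
    obtain ⟨hd, hH⟩ := (ContDiffAt.hasJet (hu.contDiffAt_nat hx1 2)).of_isLocalMin hloc
    have hg : grad u x1 = 0 := by
      ext i; exact congrFun hd i
    -- At an interior minimum `Du = 0` and `D²u ≥ 0`, so all curvatures are at most `1`,
    -- contradicting `σ > 1`.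
    have := hu.sig_le_of_le hf h one_pos (fun v => by
      rw [convMat_quadratic, hg]
      have h1 : wFun (0 : E n) = 1 := by simp [wFun]
      rw [h1]
      have h2 := hH.dotProduct_mulVec_nonneg v
      have h3 := mul_nonneg (hu.pos x1 h).le h2
      simp only [star_trivial] at h3
      linarith)
    linarith
  · rw [← hu.bdry x1 h]; exact hmin hx

section Touching

variable {x a : E n} {c ρ : ℝ}

/-- Contact with a hyperboloid centred at `(a, c)`: the first order condition is `x - a = (u - c)
Du`, which with the equation of the hyperboloid gives `ρ = |u - c| w`; the second order condition
compares `D²u` with the induced metric. -/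
lemma touching_data (hu : IsAdmissibleSolution f Ω sig eps u) (hx : x ∈ Ω)
    (hmin : IsLocalMin (fun y => ‖y - a‖ ^ 2 + ρ ^ 2 - (u y - c) ^ 2) x)
    (h0 : ‖x - a‖ ^ 2 + ρ ^ 2 - (u x - c) ^ 2 = 0) :
    ρ ^ 2 = ((c - u x) * wFun (grad u x)) ^ 2 ∧
      ∀ v : Fin n → ℝ, 0 ≤ v ⬝ᵥ metMat (grad u x) *ᵥ v + (c - u x) * (v ⬝ᵥ hess u x *ᵥ v) := by
  have hu2 := hu.contDiffAt_nat (subset_closure hx) 2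
  have hp := hu.spacelike x (subset_closure hx)
  have hj := ((hasJet_normSq_sub_sq a hu2).add ((ContDiffAt.hasJet hu2).const_mul (2 * c))).add
    (HasJet.const (ρ ^ 2 - c ^ 2) x)
  have e : (fun y => ‖y - a‖ ^ 2 - u y ^ 2 + 2 * c * u y + (ρ ^ 2 - c ^ 2))
      = fun y => ‖y - a‖ ^ 2 + ρ ^ 2 - (u y - c) ^ 2 := by
    funext y; ring
  rw [e] at hj
  obtain ⟨hd, hH⟩ := hj.of_isLocalMin hmin
  set p := grad u x with hpd
  have hxa : x - a = (-(c - u x)) • p := by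
    ext i
    have := congrFun hd i
    simp [← hpd] at this
    have h2 : pd i u x = p i := rfl
    rw [h2] at this
    simp
    linarith
  constructor
  · rw [mul_pow, wFun_sq hp, dotProduct_self_eq]
    rw [hxa, norm_smul, mul_pow] at h0
    simp only [Real.norm_eq_abs, sq_abs] at h0
    linarith
  · intro v
    have h2 := hH.dotProduct_mulVec_nonneg v
    simp only [star_trivial, add_zero, add_mulVec, smul_mulVec, dotProduct_add, dotProduct_smul,
      smul_eq_mul, convMat_quadratic] at h2
    linarith

/-- Touching from below by an umbilic graph bounds the curvature from above. -/
lemma sig_le_of_touching (hf : IsCurvatureFunction f) (hu : IsAdmissibleSolution f Ω sig eps u)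
    (hx : x ∈ Ω) (hρ : 0 < ρ)
    (hmin : IsLocalMin (fun y => ‖y - a‖ ^ 2 + ρ ^ 2 - (u y - c) ^ 2) x)
    (h0 : ‖x - a‖ ^ 2 + ρ ^ 2 - (u x - c) ^ 2 = 0) (hc : u x < c) : sig ≤ c / ρ := by
  obtain ⟨h1, h2⟩ := hu.touching_data hx hmin h0
  have hp := hu.spacelike x (subset_closure hx)
  have hw := wFun_pos hp
  have hux := hu.pos x hx
  have hs : 0 < c - u x := by linarith
  have hρw : ρ = (c - u x) * wFun (grad u x) := by
    rw [sq_eq_sq₀ hρ.le (by positivity)] at h1; exact h1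
  have hc0 : 0 < c := by linarith
  refine hu.sig_le_of_le hf hx (by positivity) fun v => ?_
  rw [convMat_quadratic]
  have h3 := h2 v
  have e : c / ρ * wFun (grad u x) = 1 + u x / (c - u x) := by
    rw [hρw]; field_simp; ring
  rw [e]
  have h4 : 0 ≤ u x / (c - u x) * (v ⬝ᵥ metMat (grad u x) *ᵥ v
      + (c - u x) * (v ⬝ᵥ hess u x *ᵥ v)) := by positivity
  have h5 : u x / (c - u x) * ((c - u x) * (v ⬝ᵥ hess u x *ᵥ v)) = u x * (v ⬝ᵥ hess u x *ᵥ v) := by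
    field_simp
  rw [mul_add, h5] at h4
  linarith

/-- Touching from above by an umbilic graph bounds the curvature from below. -/
lemma le_sig_of_touching (hf : IsCurvatureFunction f) (hu : IsAdmissibleSolution f Ω sig eps u)
    (hx : x ∈ Ω) (hρ : 0 < ρ)
    (hmin : IsLocalMin (fun y => ‖y - a‖ ^ 2 + ρ ^ 2 - (u y - c) ^ 2) x)
    (h0 : ‖x - a‖ ^ 2 + ρ ^ 2 - (u x - c) ^ 2 = 0) (hc : c < 0) : -c / ρ ≤ sig := by
  obtain ⟨h1, h2⟩ := hu.touching_data hx hmin h0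
  have hp := hu.spacelike x (subset_closure hx)
  have hw := wFun_pos hp
  have hux := hu.pos x hx
  have hs : 0 < u x - c := by linarith
  have hρw : ρ = (u x - c) * wFun (grad u x) := by
    have : ρ ^ 2 = ((u x - c) * wFun (grad u x)) ^ 2 := by rw [h1]; ring
    rw [sq_eq_sq₀ hρ.le (by positivity)] at this; exact this
  have hc0 : 0 < -c := by linarith
  refine hu.le_sig_of_le hf hx (by positivity) fun v => ?_
  rw [convMat_quadratic]
  have h3 := h2 v
  have e : -c / ρ * wFun (grad u x) = 1 - u x / (u x - c) := by
    rw [hρw]; field_simp; ring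
  rw [e]
  have h4 : 0 ≤ u x / (u x - c) * (v ⬝ᵥ metMat (grad u x) *ᵥ v
      + (c - u x) * (v ⬝ᵥ hess u x *ᵥ v)) := by positivity
  have h5 : u x / (u x - c) * ((c - u x) * (v ⬝ᵥ hess u x *ᵥ v)) = -(u x * (v ⬝ᵥ hess u x *ᵥ v)) := by
    field_simp; ring
  rw [mul_add, h5] at h4
  linarith

end Touching

/-- Comparison with the umbilic caps of curvature `s < σ` centred at `a`. -/
lemma cap_comparison (hf : IsCurvatureFunction f) (hΩ : IsOpen Ω) (hb : Bornology.IsBounded Ω)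
    (hu : IsAdmissibleSolution f Ω sig eps u) {s R : ℝ} (hs : 1 < s) (hs' : s < sig) (hR : 0 < R)
    {a : E n} (ha : ∀ y ∈ frontier Ω, R ≤ dist y a) {x : E n} (hx : x ∈ closure Ω) :
    s * eps + √(eps ^ 2 + (s ^ 2 - 1) * R ^ 2) ≤ s * u x + √(u x ^ 2 + (s ^ 2 - 1) * ‖x - a‖ ^ 2) := by
  have hs2 : 0 < s ^ 2 - 1 := by nlinarith
  -- As a function of `(y, u)` this has as level sets the dilates about `a` of a single cap of
  -- curvature `s`. Minimizing it over the graph finds the dilate that touches from below.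
  have hcont : ContinuousOn (fun y => s * u y + √(u y ^ 2 + (s ^ 2 - 1) * ‖y - a‖ ^ 2))
      (closure Ω) := by
    have := hu.continuousOn
    fun_prop
  obtain ⟨x1, hx1, hmin⟩ := hb.isCompact_closure.exists_isMinOn ⟨x, hx⟩ hcont
  refine le_trans ?_ (hmin hx)
  rcases mem_or_frontier hx1 with h | h
  swap
  · have h1 := hu.bdry x1 h
    have h2 := ha x1 h
    rw [dist_eq_norm] at h2
    simp only [h1]
    gcongr
  · exfalso
    have hux := hu.pos x1 h
    set l := s * u x1 + √(u x1 ^ 2 + (s ^ 2 - 1) * ‖x1 - a‖ ^ 2) with hl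
    have hsq : u x1 ≤ √(u x1 ^ 2 + (s ^ 2 - 1) * ‖x1 - a‖ ^ 2) :=
      Real.le_sqrt_of_sq_le (by nlinarith [mul_nonneg hs2.le (sq_nonneg ‖x1 - a‖)])
    have hl0 : 0 < l - s * u x1 := by linarith
    have hlpos : 0 < l := by nlinarith
    -- Radius of the touching hyperboloid, whose centre is at height `s ρ`; its curvature is
    -- therefore `s`.
    set ρ := l / (s ^ 2 - 1) with hρ
    have hρ0 : 0 < ρ := by positivity
    have hlρ : l = (s ^ 2 - 1) * ρ := by rw [hρ]; field_simp
    have hP : ∀ y, (s ^ 2 - 1) * (‖y - a‖ ^ 2 + ρ ^ 2 - (u y - s * ρ) ^ 2)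
        = u y ^ 2 + (s ^ 2 - 1) * ‖y - a‖ ^ 2 - (l - s * u y) ^ 2 := by
      intro y; rw [hlρ]; ring
    have h0 : ‖x1 - a‖ ^ 2 + ρ ^ 2 - (u x1 - s * ρ) ^ 2 = 0 := by
      have h1 := hP x1
      have h2 : l - s * u x1 = √(u x1 ^ 2 + (s ^ 2 - 1) * ‖x1 - a‖ ^ 2) := by rw [hl]; ring
      rw [h2, Real.sq_sqrt (by positivity), sub_self] at h1
      exact (mul_eq_zero.1 h1).resolve_left hs2.ne'
    have hloc : IsLocalMin (fun y => ‖y - a‖ ^ 2 + ρ ^ 2 - (u y - s * ρ) ^ 2) x1 := by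
      have hc : ∀ᶠ y in 𝓝 x1, 0 < l - s * u y := by
        have : ContinuousAt (fun y => l - s * u y) x1 := by
          have := (hu.contDiffAt hx1).continuousAt
          fun_prop
        exact this.eventually (lt_mem_nhds hl0)
      filter_upwards [hc, hΩ.mem_nhds h] with y hy1 hy2
      simp only [h0]
      have h1 : l ≤ s * u y + √(u y ^ 2 + (s ^ 2 - 1) * ‖y - a‖ ^ 2) := hmin (subset_closure hy2)
      have h2 : l - s * u y ≤ √(u y ^ 2 + (s ^ 2 - 1) * ‖y - a‖ ^ 2) := by linarith
      have h3 := (Real.le_sqrt hy1.le (by positivity)).1 h2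
      have h4 := hP y
      by_contra hneg
      push Not at hneg
      nlinarith
    have hlt : u x1 < s * ρ := by
      have : s * u x1 < (s ^ 2 - 1) * ρ := by linarith
      nlinarith
    have h5 := hu.sig_le_of_touching hf h hρ0 hloc h0 hlt
    rw [mul_div_cancel_right₀ _ hρ0.ne'] at h5
    linarith

/-- At an interior maximum of `u - |y - a|` the radial derivative of `u` would be `1`, against `|Du|
< 1`. The bound makes the dilation parameter positive in `exterior_comparison`. -/
lemma lt_norm_sub (hΩ : IsOpen Ω) (hb : Bornology.IsBounded Ω)
    (hu : IsAdmissibleSolution f Ω sig eps u) 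
    {a : E n} (ha : a ∉ Ω) (ha' : ∀ y ∈ frontier Ω, eps < dist y a) {x : E n} (hx : x ∈ closure Ω) :
    u x < ‖x - a‖ := by
  have hcont : ContinuousOn (fun y => u y - ‖y - a‖) (closure Ω) := by
    have := hu.continuousOn
    fun_prop
  obtain ⟨x1, hx1, hmax⟩ := hb.isCompact_closure.exists_isMaxOn ⟨x, hx⟩ hcont
  have hle : u x - ‖x - a‖ ≤ u x1 - ‖x1 - a‖ := hmax hx
  rcases mem_or_frontier hx1 with h | h
  swap
  · have h1 := hu.bdry x1 h
    have h2 := ha' x1 h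
    rw [dist_eq_norm] at h2
    linarith
  · exfalso
    set v := x1 - a with hv
    have hv0 : v ≠ 0 := fun h0 => ha (by rw [← sub_eq_zero.1 h0]; exact h)
    have hd : HasDerivAt (fun t : ℝ => u (x1 + t • v) - (1 + t) * ‖v‖)
        (fderiv ℝ u x1 v - ‖v‖) 0 := by
      have h1 := hasDerivAt_line (g := u) (x := x1) (v := v) (t := 0)
        (by simpa using (hu.contDiffAt_nat hx1 1).differentiableAt (by norm_num))
      have h2 := ((hasDerivAt_id (0 : ℝ)).const_add 1).mul_const ‖v‖
      simp only [zero_smul, add_zero] at h1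
      rw [one_mul] at h2
      exact h1.sub h2
    have hloc : IsLocalMax (fun t : ℝ => u (x1 + t • v) - (1 + t) * ‖v‖) 0 := by
      have hc : ContinuousAt (fun t : ℝ => x1 + t • v) 0 := by fun_prop
      have h1 : ∀ᶠ t in 𝓝 (0 : ℝ), x1 + t • v ∈ Ω :=
        hc.eventually (by simpa using hΩ.mem_nhds h)
      filter_upwards [h1, Ioo_mem_nhds (show (-1 : ℝ) < 0 by norm_num) one_pos] with t ht ht1
      have h2 : u (x1 + t • v) - ‖x1 + t • v - a‖ ≤ u x1 - ‖x1 - a‖ := hmax (subset_closure ht)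
      have h3 : x1 + t • v - a = (1 + t) • v := by rw [hv]; module
      rw [h3, norm_smul, Real.norm_of_nonneg (by linarith [ht1.1]), ← hv] at h2
      simpa using h2
    have h0 := hloc.hasDerivAt_eq_zero hd
    rw [← inner_grad] at h0
    have h1 := real_inner_le_norm (grad u x1) v
    have h2 := hu.spacelike x1 hx1
    have h3 := norm_pos_iff.2 hv0
    nlinarith

/-- Comparison with the exterior umbilic graphs of curvature `s > σ` centred at `a`. -/
lemma exterior_comparison (hf : IsCurvatureFunction f) (hΩ : IsOpen Ω) (hb : Bornology.IsBounded Ω)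
    (hu : IsAdmissibleSolution f Ω sig eps u) {s R : ℝ} (hs : 1 < s)
    (hs' : sig < s) (heR : eps < R) (hR : 0 < R)
    {a : E n} (haΩ : a ∉ Ω) (ha : ∀ y ∈ frontier Ω, R ≤ dist y a) {x : E n} (hx : x ∈ closure Ω) :
    -(s * eps) + √(eps ^ 2 + (s ^ 2 - 1) * R ^ 2)
      ≤ -(s * u x) + √(u x ^ 2 + (s ^ 2 - 1) * ‖x - a‖ ^ 2) := by
  have hs2 : 0 < s ^ 2 - 1 := by nlinarith
  have hcont : ContinuousOn (fun y => -(s * u y) + √(u y ^ 2 + (s ^ 2 - 1) * ‖y - a‖ ^ 2))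
      (closure Ω) := by
    have := hu.continuousOn
    fun_prop
  obtain ⟨x1, hx1, hmin⟩ := hb.isCompact_closure.exists_isMinOn ⟨x, hx⟩ hcont
  refine le_trans ?_ (hmin hx)
  rcases mem_or_frontier hx1 with h | h
  swap
  · have h1 := hu.bdry x1 h
    have h2 := ha x1 h
    rw [dist_eq_norm] at h2
    simp only [h1]
    gcongr
  · exfalso
    have hux := hu.pos x1 h
    have hlt := hu.lt_norm_sub hΩ hb haΩ (fun y hy => heR.trans_le (ha y hy)) hx1
    set l := -(s * u x1) + √(u x1 ^ 2 + (s ^ 2 - 1) * ‖x1 - a‖ ^ 2) with hl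
    have hlpos : 0 < l := by
      have : s * u x1 < √(u x1 ^ 2 + (s ^ 2 - 1) * ‖x1 - a‖ ^ 2) := by
        refine Real.lt_sqrt_of_sq_lt ?_
        have : u x1 ^ 2 < ‖x1 - a‖ ^ 2 := by gcongr
        nlinarith
      linarith
    set ρ := l / (s ^ 2 - 1) with hρ
    have hρ0 : 0 < ρ := by positivity
    have hlρ : l = (s ^ 2 - 1) * ρ := by rw [hρ]; field_simp
    have hP : ∀ y, (s ^ 2 - 1) * (‖y - a‖ ^ 2 + ρ ^ 2 - (u y - -(s * ρ)) ^ 2)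
        = u y ^ 2 + (s ^ 2 - 1) * ‖y - a‖ ^ 2 - (l + s * u y) ^ 2 := by
      intro y; rw [hlρ]; ring
    have h0 : ‖x1 - a‖ ^ 2 + ρ ^ 2 - (u x1 - -(s * ρ)) ^ 2 = 0 := by
      have h1 := hP x1
      have h2 : l + s * u x1 = √(u x1 ^ 2 + (s ^ 2 - 1) * ‖x1 - a‖ ^ 2) := by rw [hl]; ring
      rw [h2, Real.sq_sqrt (by positivity), sub_self] at h1
      exact (mul_eq_zero.1 h1).resolve_left hs2.ne'
    have hloc : IsLocalMin (fun y => ‖y - a‖ ^ 2 + ρ ^ 2 - (u y - -(s * ρ)) ^ 2) x1 := by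
      filter_upwards [hΩ.mem_nhds h] with y hy2
      simp only [h0]
      have h1 : l ≤ -(s * u y) + √(u y ^ 2 + (s ^ 2 - 1) * ‖y - a‖ ^ 2) := hmin (subset_closure hy2)
      have h2 : l + s * u y ≤ √(u y ^ 2 + (s ^ 2 - 1) * ‖y - a‖ ^ 2) := by linarith
      have hy0 : 0 ≤ l + s * u y := by have := hu.pos y hy2; positivity
      have h3 := (Real.le_sqrt hy0 (by positivity)).1 h2
      have h4 := hP y
      by_contra hneg
      push Not at hneg
      nlinarith
    have h5 := hu.le_sig_of_touching hf h hρ0 hloc h0 (by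
      have : 0 < s * ρ := by positivity
      linarith)
    rw [neg_neg, mul_div_cancel_right₀ _ hρ0.ne'] at h5
    linarith

end IsAdmissibleSolution

end DeSitter

end

/-! ### Boundary slopes and two-sided height bounds. -/

noncomputable section

namespace DeSitter
open Matrix Filter Topology

variable {n : ℕ}

/-- The radius `√(ε² + (σ² - 1) R²)` of the comparison caps. -/
def capRad (sig R eps : ℝ) : ℝ := √(eps ^ 2 + (sig ^ 2 - 1) * R ^ 2)

/-- The boundary slope of the interior cap. -/
def slopeLo (sig R eps : ℝ) : ℝ := R * (sig ^ 2 - 1) / (sig * capRad sig R eps + eps)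

/-- The boundary slope of the exterior comparison graph. -/
def slopeHi (sig R eps : ℝ) : ℝ := R * (sig ^ 2 - 1) / (sig * capRad sig R eps - eps)

/-- The limit slope `√(σ² - 1) / σ`. -/
def slope (sig : ℝ) : ℝ := √(sig ^ 2 - 1) / sig

lemma slope_sq {sig : ℝ} (hsig : 1 < sig) : slope sig ^ 2 = 1 - 1 / sig ^ 2 := by
  have : 0 ≤ sig ^ 2 - 1 := by nlinarith
  rw [slope, div_pow, Real.sq_sqrt this]
  field_simp

lemma slope_pos {sig : ℝ} (hsig : 1 < sig) : 0 < slope sig := by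
  have : 0 < sig ^ 2 - 1 := by nlinarith
  rw [slope]; positivity

lemma slope_lt_one {sig : ℝ} (hsig : 1 < sig) : slope sig < 1 := by
  have h := slope_sq hsig
  have h1 : 0 < 1 / sig ^ 2 := by positivity
  nlinarith [slope_pos hsig]

lemma capRad_zero {sig R : ℝ} (hR : 0 < R) : capRad sig R 0 = √(sig ^ 2 - 1) * R := by
  rw [capRad, zero_pow two_ne_zero, zero_add, Real.sqrt_mul' _ (by positivity), Real.sqrt_sq hR.le]

lemma continuous_capRad (sig R : ℝ) : Continuous (capRad sig R) := by
  unfold capRad; fun_prop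

lemma tendsto_slopeLo {sig R : ℝ} (hsig : 1 < sig) (hR : 0 < R) :
    Tendsto (slopeLo sig R) (𝓝 0) (𝓝 (slope sig)) := by
  have h0 : 0 < sig ^ 2 - 1 := by nlinarith
  have hs := Real.sqrt_pos.2 h0
  have hc := continuous_capRad sig R
  have : ContinuousAt (slopeLo sig R) 0 := by
    unfold slopeLo
    refine ContinuousAt.div (by fun_prop) (by fun_prop) ?_
    rw [capRad_zero hR]; positivity
  have h := this.tendsto
  convert h using 2
  rw [slopeLo, capRad_zero hR, slope]
  have := Real.sq_sqrt h0.le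
  rw [add_zero]
  field_simp
  linarith

lemma tendsto_slopeHi {sig R : ℝ} (hsig : 1 < sig) (hR : 0 < R) :
    Tendsto (slopeHi sig R) (𝓝 0) (𝓝 (slope sig)) := by
  have h0 : 0 < sig ^ 2 - 1 := by nlinarith
  have hs := Real.sqrt_pos.2 h0
  have hc := continuous_capRad sig R
  have : ContinuousAt (slopeHi sig R) 0 := by
    unfold slopeHi
    refine ContinuousAt.div (by fun_prop) (by fun_prop) ?_
    rw [capRad_zero hR, sub_zero]; positivity
  have h := this.tendsto
  convert h using 2
  rw [slopeHi, capRad_zero hR, slope, sub_zero]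
  have := Real.sq_sqrt h0.le
  field_simp
  linarith

lemma eventually_slope {sig R eta : ℝ} (hsig : 1 < sig) (hR : 0 < R) (heta : 0 < eta) :
    ∃ e1 : ℝ, 0 < e1 ∧ ∀ eps : ℝ, 0 < eps → eps ≤ e1 →
      |slopeLo sig R eps - slope sig| ≤ eta ∧ |slopeHi sig R eps - slope sig| ≤ eta := by
  have h1 := (tendsto_slopeLo hsig hR).eventually (Metric.closedBall_mem_nhds _ heta)
  have h2 := (tendsto_slopeHi hsig hR).eventually (Metric.closedBall_mem_nhds _ heta)
  obtain ⟨d, hd, h⟩ := Metric.eventually_nhds_iff.1 (h1.and h2)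
  refine ⟨d / 2, by positivity, fun eps h0 h3 => ?_⟩
  have := h (y := eps) (by rw [Real.dist_eq, sub_zero, abs_of_pos h0]; linarith)
  simpa [Real.dist_eq] using this

namespace IsAdmissibleSolution

variable {f : E n → ℝ} {Ω : Set (E n)} {sig eps : ℝ} {u : E n → ℝ}

/-- The cap over the interior ball, made explicit. Its centre is at height `M` above the plane `u =
ε`, with `M² = R² + ρ²`, so its boundary slope is `R/M`; the error term uses `M ≥ R`. -/
lemma height_ge (hf : IsCurvatureFunction f) (hΩ : IsOpen Ω) (hb : Bornology.IsBounded Ω)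
    (hsig : 1 < sig) (heps : 0 < eps) (hu : IsAdmissibleSolution f Ω sig eps u) {R : ℝ} (hR : 0 < R)
    {z m : E n} (ht : TouchingBalls Ω R z m) {x : E n} (hx : x ∈ closure Ω) :
    slopeLo sig R eps * inner ℝ (x - z) m - ‖x - z‖ ^ 2 / (2 * R) ≤ u x - eps := by
  have h0 : 0 < sig ^ 2 - 1 := by nlinarith
  set a := z + R • m with ha
  set D := ‖x - a‖ ^ 2 with hD
  have hDe : D = ‖x - z‖ ^ 2 - 2 * R * inner ℝ (x - z) m + R ^ 2 := by
    have : x - a = (x - z) - R • m := by rw [ha]; abel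
    rw [hD, this, norm_sub_sq_real, inner_smul_right, norm_smul, mul_pow, ht.unit]
    simp; ring
  set S := capRad sig R eps with hS
  have hS2 : S ^ 2 = eps ^ 2 + (sig ^ 2 - 1) * R ^ 2 := Real.sq_sqrt (by positivity)
  have hSpos : 0 < S := Real.sqrt_pos.2 (by positivity)
  have hu0 : 0 < u x := heps.trans_le (hu.eps_le hf hΩ hb hsig hx)
  -- The comparison needs a strict inequality `s < σ`; the case `s = σ` is the limit.
  have key : sig * eps + S ≤ sig * u x + √(u x ^ 2 + (sig ^ 2 - 1) * D) := by
    have h1 : ContinuousAt (fun s : ℝ => s * eps + √(eps ^ 2 + (s ^ 2 - 1) * R ^ 2)) sig := by fun_prop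
    have h2 : ContinuousAt (fun s : ℝ => s * u x + √(u x ^ 2 + (s ^ 2 - 1) * D)) sig := by fun_prop
    refine le_of_tendsto_of_tendsto (h1.tendsto.mono_left (nhdsWithin_le_nhds (s := Set.Iio sig)))
      (h2.tendsto.mono_left nhdsWithin_le_nhds) ?_
    filter_upwards [Ioo_mem_nhdsLT hsig] with s hs
    exact hu.cap_comparison hf hΩ hb hs.1 hs.2 hR (fun y hy => ht.interior_frontier hΩ hy) hx
  set M := (sig * S + eps) / (sig ^ 2 - 1) with hM
  have hM0 : 0 < M := by positivity
  have hlo : slopeLo sig R eps = R / M := by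
    rw [slopeLo, hM, ← hS]; field_simp
  set ρ := (sig * eps + S) / (sig ^ 2 - 1) with hρ
  have hMρ : M = sig * ρ - eps := by rw [hM, hρ]; field_simp; ring
  have hM2 : M ^ 2 = R ^ 2 + ρ ^ 2 := by
    have e1 : (sig ^ 2 - 1) * ρ = sig * eps + S := by rw [hρ]; field_simp
    have e2 : (sig ^ 2 - 1) * M = sig * S + eps := by rw [hM]; field_simp
    have e3 : (sig ^ 2 - 1) ^ 2 * M ^ 2 = (sig ^ 2 - 1) ^ 2 * (R ^ 2 + ρ ^ 2) := by
      calc (sig ^ 2 - 1) ^ 2 * M ^ 2 = (sig * S + eps) ^ 2 := by rw [← e2]; ring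
        _ = (sig ^ 2 - 1) * (S ^ 2 - eps ^ 2) + (sig * eps + S) ^ 2 := by ring
        _ = (sig ^ 2 - 1) ^ 2 * R ^ 2 + ((sig ^ 2 - 1) * ρ) ^ 2 := by rw [e1, hS2]; ring
        _ = _ := by ring
    exact mul_left_cancel₀ (by positivity) e3
  have hRM : R ≤ M := by
    refine (abs_le_of_sq_le_sq' ?_ hM0.le).2
    nlinarith [sq_nonneg ρ]
  have hmain : R ^ 2 - D ≤ 2 * M * (u x - eps) := by
    -- Squaring requires a nonnegative left side. Otherwise `u - ε` already exceeds `S/σ`, which is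
    -- more than the cap requires.
    by_cases hcase : 0 ≤ sig * eps + S - sig * u x
    · have h1 : sig * eps + S - sig * u x ≤ √(u x ^ 2 + (sig ^ 2 - 1) * D) := by linarith
      have h2 := (Real.le_sqrt hcase (by positivity)).1 h1
      have e1 : (sig ^ 2 - 1) * ρ = sig * eps + S := by rw [hρ]; field_simp
      rw [← e1] at h2
      have h3 : 0 ≤ (sig ^ 2 - 1) * (D + ρ ^ 2 - (u x - sig * ρ) ^ 2) := by linarith
      have h4 := nonneg_of_mul_nonneg_right h3 h0
      have e2 : u x - sig * ρ = (u x - eps) - M := by rw [hMρ]; ring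
      rw [e2] at h4
      nlinarith [sq_nonneg (u x - eps)]
    · push Not at hcase
      have h1 : S ≤ sig * (u x - eps) := by linarith
      have h2 : sig * S / (sig ^ 2 - 1) ≤ M := by
        rw [hM]; gcongr; linarith
      have h3 : (sig ^ 2 - 1) * R ^ 2 ≤ S ^ 2 := by rw [hS2]; nlinarith
      have h4 : 0 ≤ D := by positivity
      have h5 : 0 < u x - eps := by
        by_contra hneg
        push Not at hneg
        nlinarith
      have h6 : R ^ 2 ≤ S ^ 2 / (sig ^ 2 - 1) := by rw [le_div_iff₀ h0]; linarith
      have h7 : S ^ 2 / (sig ^ 2 - 1) ≤ M * (u x - eps) := by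
        calc S ^ 2 / (sig ^ 2 - 1) = S / (sig ^ 2 - 1) * S := by ring
          _ ≤ S / (sig ^ 2 - 1) * (sig * (u x - eps)) := by gcongr
          _ = sig * S / (sig ^ 2 - 1) * (u x - eps) := by ring
          _ ≤ M * (u x - eps) := by gcongr
      nlinarith
  rw [hlo]
  have h8 : (R ^ 2 - D) / (2 * M) ≤ u x - eps := by
    rw [div_le_iff₀ (by positivity)]; linarith
  refine le_trans ?_ h8
  rw [hDe]
  have h9 : (R ^ 2 - (‖x - z‖ ^ 2 - 2 * R * inner ℝ (x - z) m + R ^ 2)) / (2 * M)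
      = R / M * inner ℝ (x - z) m - ‖x - z‖ ^ 2 / (2 * M) := by field_simp; ring
  rw [h9]
  gcongr

/-- The counterpart with the hyperboloid about the centre of the exterior ball, letting `s` decrease
to `σ`. The condition `ε < R` puts the boundary values below the cone `|x - a|`; no case distinction
arises since `u ≥ ε`. -/
lemma height_le (hf : IsCurvatureFunction f) (hΩ : IsOpen Ω) (hb : Bornology.IsBounded Ω)
    (hsig : 1 < sig) (heps : 0 < eps) (hu : IsAdmissibleSolution f Ω sig eps u) {R : ℝ} (hR : 0 < R)
    (heR : eps < R) {z m : E n} (ht : TouchingBalls Ω R z m) {x : E n} (hx : x ∈ closure Ω) :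
    u x - eps ≤ slopeHi sig R eps * inner ℝ (x - z) m + ‖x - z‖ ^ 2 / (2 * R) := by
  have h0 : 0 < sig ^ 2 - 1 := by nlinarith
  set a := z - R • m with ha
  set D := ‖x - a‖ ^ 2 with hD
  have hDe : D = ‖x - z‖ ^ 2 + 2 * R * inner ℝ (x - z) m + R ^ 2 := by
    have : x - a = (x - z) + R • m := by rw [ha]; abel
    rw [hD, this, norm_add_sq_real, inner_smul_right, norm_smul, mul_pow, ht.unit]
    simp; ring
  set S := capRad sig R eps with hS
  have hS2 : S ^ 2 = eps ^ 2 + (sig ^ 2 - 1) * R ^ 2 := Real.sq_sqrt (by positivity)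
  have hSpos : 0 < S := Real.sqrt_pos.2 (by positivity)
  have hSe : eps ≤ S := by
    refine (abs_le_of_sq_le_sq' ?_ hSpos.le).2
    rw [hS2]; nlinarith [sq_nonneg R]
  have hu0 : 0 < u x := heps.trans_le (hu.eps_le hf hΩ hb hsig hx)
  have haΩ : a ∉ Ω := fun h => by
    have := ht.exterior a h
    rw [dist_self] at this
    linarith
  have key : -(sig * eps) + S ≤ -(sig * u x) + √(u x ^ 2 + (sig ^ 2 - 1) * D) := by
    have h1 : ContinuousAt (fun s : ℝ => -(s * eps) + √(eps ^ 2 + (s ^ 2 - 1) * R ^ 2)) sig := by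
      fun_prop
    have h2 : ContinuousAt (fun s : ℝ => -(s * u x) + √(u x ^ 2 + (s ^ 2 - 1) * D)) sig := by
      fun_prop
    refine le_of_tendsto_of_tendsto (h1.tendsto.mono_left (nhdsWithin_le_nhds (s := Set.Ioi sig)))
      (h2.tendsto.mono_left nhdsWithin_le_nhds) ?_
    filter_upwards [self_mem_nhdsWithin] with s hs
    have hs : sig < s := hs
    exact hu.exterior_comparison hf hΩ hb (hsig.trans hs) hs heR hR haΩ
      (fun y hy => ht.exterior_closure (frontier_subset_closure hy)) hx
  set M := (sig * S - eps) / (sig ^ 2 - 1) with hM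
  have hSS : 0 < sig * S - eps := by nlinarith
  have hM0 : 0 < M := by positivity
  have hhi : slopeHi sig R eps = R / M := by
    rw [slopeHi, hM, ← hS]; field_simp
  set ρ := (-(sig * eps) + S) / (sig ^ 2 - 1) with hρ
  have hMρ : M = sig * ρ + eps := by rw [hM, hρ]; field_simp; ring
  have e1 : (sig ^ 2 - 1) * ρ = -(sig * eps) + S := by rw [hρ]; field_simp
  have hM2 : M ^ 2 = R ^ 2 + ρ ^ 2 := by
    have e2 : (sig ^ 2 - 1) * M = sig * S - eps := by rw [hM]; field_simp
    have e3 : (sig ^ 2 - 1) ^ 2 * M ^ 2 = (sig ^ 2 - 1) ^ 2 * (R ^ 2 + ρ ^ 2) := by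
      calc (sig ^ 2 - 1) ^ 2 * M ^ 2 = (sig * S - eps) ^ 2 := by rw [← e2]; ring
        _ = (sig ^ 2 - 1) * (S ^ 2 - eps ^ 2) + (-(sig * eps) + S) ^ 2 := by ring
        _ = (sig ^ 2 - 1) ^ 2 * R ^ 2 + ((sig ^ 2 - 1) * ρ) ^ 2 := by rw [e1, hS2]; ring
        _ = _ := by ring
    exact mul_left_cancel₀ (by positivity) e3
  have hRM : R ≤ M := by
    refine (abs_le_of_sq_le_sq' ?_ hM0.le).2
    nlinarith [sq_nonneg ρ]
  have hmain : 2 * M * (u x - eps) ≤ D - R ^ 2 := by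
    have hge := hu.eps_le hf hΩ hb hsig hx
    have hcase : 0 ≤ -(sig * eps) + S + sig * u x := by nlinarith
    have h1 : -(sig * eps) + S + sig * u x ≤ √(u x ^ 2 + (sig ^ 2 - 1) * D) := by linarith
    have h2 := (Real.le_sqrt hcase (by positivity)).1 h1
    rw [← e1] at h2
    have h3 : 0 ≤ (sig ^ 2 - 1) * (D + ρ ^ 2 - (u x + sig * ρ) ^ 2) := by linarith
    have h4 := nonneg_of_mul_nonneg_right h3 h0
    have e2 : u x + sig * ρ = (u x - eps) + M := by rw [hMρ]; ring
    rw [e2] at h4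
    nlinarith [sq_nonneg (u x - eps)]
  rw [hhi]
  have h8 : u x - eps ≤ (D - R ^ 2) / (2 * M) := by
    rw [le_div_iff₀ (by positivity)]; linarith
  refine h8.trans ?_
  rw [hDe]
  have h9 : (‖x - z‖ ^ 2 + 2 * R * inner ℝ (x - z) m + R ^ 2 - R ^ 2) / (2 * M)
      = R / M * inner ℝ (x - z) m + ‖x - z‖ ^ 2 / (2 * M) := by field_simp; ring
  rw [h9]
  gcongr

end IsAdmissibleSolution

end DeSitter

end

noncomputable section

namespace DeSitter
open Filter Topology

variable {n : ℕ}

/-! ### Geometry of smooth domains -/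

/-- The derivative is locally Lipschitz, and the mean value inequality on segments gives the
quadratic remainder. With `r ≤ 1/2` any two points of the ball are at distance at most `1`, so later
the remainder can be absorbed in a linear bound. -/
lemma exists_taylor_bound {F : Type*} [NormedAddCommGroup F] [NormedSpace ℝ F] {g : E n → F}
    {z : E n} (hg : ContDiffAt ℝ 2 g z) :
    ∃ C : ℝ, 0 < C ∧ ∃ r : ℝ, 0 < r ∧ r ≤ 1 / 2 ∧ ∀ x ∈ Metric.ball z r,
      ‖fderiv ℝ g x‖ ≤ C ∧ ∀ y ∈ Metric.ball z r,
        ‖g y - g x - fderiv ℝ g x (y - x)‖ ≤ C * ‖y - x‖ ^ 2 := by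
  have h1 : ContDiffAt ℝ 1 (fderiv ℝ g) z := hg.fderiv_right (by norm_num)
  obtain ⟨K, t, ht, hK⟩ := h1.exists_lipschitzOnWith
  have hd : ∀ᶠ x in 𝓝 z, DifferentiableAt ℝ g x := by
    filter_upwards [hg.eventually (by simp)] with y hy using hy.differentiableAt (by norm_num)
  have hb : ∀ᶠ x in 𝓝 z, ‖fderiv ℝ g x‖ < ‖fderiv ℝ g z‖ + 1 :=
    h1.continuousAt.norm.eventually (gt_mem_nhds (by linarith))
  obtain ⟨r, hr, hball⟩ := Metric.eventually_nhds_iff_ball.1 ((hd.and hb).and ht)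
  refine ⟨max (‖fderiv ℝ g z‖ + 1) K, by positivity, min r (1 / 2), by positivity,
    min_le_right _ _, fun x hx => ?_⟩
  have hsub : Metric.ball z (min r (1 / 2)) ⊆ Metric.ball z r :=
    Metric.ball_subset_ball (min_le_left _ _)
  refine ⟨(hball x (hsub hx)).1.2.le.trans (le_max_left _ _), fun y hy => ?_⟩
  have hseg : ∀ w ∈ segment ℝ x y, w ∈ Metric.ball z r := fun w hw =>
    hsub ((convex_ball z _).segment_subset hx hy hw)
  have := (convex_segment x y).norm_image_sub_le_of_norm_hasFDerivWithin_le' (f := g)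
    (f' := fderiv ℝ g) (φ := fderiv ℝ g x) (C := K * ‖y - x‖)
    (fun w hw => (hball w (hseg w hw)).1.1.hasFDerivAt.hasFDerivWithinAt) (fun w hw => by
      have h2 := hK.dist_le_mul w (hball w (hseg w hw)).2 x (hball x (hsub hx)).2
      rw [dist_eq_norm, dist_eq_norm] at h2
      refine h2.trans ?_
      gcongr
      exact norm_sub_le_of_mem_segment hw) (left_mem_segment ℝ x y)
    (right_mem_segment ℝ x y)
  refine this.trans ?_
  rw [sq, mul_assoc]
  gcongr
  exact le_max_right _ _

lemma TouchingBalls.mono {Ω : Set (E n)} {R R' : ℝ} {z m : E n} (h : TouchingBalls Ω R z m)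
    (hRR : R' ≤ R) : TouchingBalls Ω R' z m := by
  refine ⟨h.unit, fun x hx => h.interior ?_, fun x hx => ?_⟩
  · rw [Metric.mem_ball] at hx ⊢
    have h1 : dist (z + R' • m) (z + R • m) = R - R' := by
      rw [dist_eq_norm, show z + R' • m - (z + R • m) = (-(R - R')) • m by module, norm_smul, h.unit,
        norm_neg, Real.norm_of_nonneg (by linarith), mul_one]
    linarith [dist_triangle x (z + R' • m) (z + R • m)]
  · have h1 : dist (z - R' • m) (z - R • m) = R - R' := by
      rw [dist_eq_norm, show z - R' • m - (z - R • m) = (R - R') • m by module, norm_smul, h.unit,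
        Real.norm_of_nonneg (by linarith), mul_one]
    linarith [dist_triangle x (z - R' • m) (z - R • m), h.exterior x hx]

lemma TouchingBalls.abs_inner_le {Ω : Set (E n)} (hΩ : IsOpen Ω) {R : ℝ} (hR : 0 < R) {z m x : E n}
    (h : TouchingBalls Ω R z m) (hx : x ∈ frontier Ω) :
    |inner ℝ (x - z) m| ≤ ‖x - z‖ ^ 2 / (2 * R) := by
  have h1 := h.interior_frontier hΩ hx
  have h2 := h.exterior_closure (frontier_subset_closure hx)
  rw [dist_eq_norm] at h1 h2
  have e1 : ‖x - (z + R • m)‖ ^ 2 = ‖x - z‖ ^ 2 - 2 * R * inner ℝ (x - z) m + R ^ 2 := by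
    rw [show x - (z + R • m) = (x - z) - R • m by abel, norm_sub_sq_real, inner_smul_right,
      norm_smul, mul_pow, h.unit]
    simp; ring
  have e2 : ‖x - (z - R • m)‖ ^ 2 = ‖x - z‖ ^ 2 + 2 * R * inner ℝ (x - z) m + R ^ 2 := by
    rw [show x - (z - R • m) = (x - z) + R • m by abel, norm_add_sq_real, inner_smul_right,
      norm_smul, mul_pow, h.unit]
    simp; ring
  have h3 : R ^ 2 ≤ ‖x - (z + R • m)‖ ^ 2 := by gcongr
  have h4 : R ^ 2 ≤ ‖x - (z - R • m)‖ ^ 2 := by gcongr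
  rw [abs_le, ← neg_div, div_le_iff₀ (by positivity), le_div_iff₀ (by positivity)]
  constructor <;> linarith

/-- Uniform control of `∂Ω` near `z` by a unit normal field `N`. -/
structure NormalField (Ω : Set (E n)) (R K r : ℝ) (z : E n) (N : E n → E n) : Prop where
  touching : ∀ z' ∈ frontier Ω, ‖z' - z‖ ≤ r → TouchingBalls Ω R z' (N z')
  cone : ∀ d ≤ r, ∀ x ∈ Ω, ∀ v, ‖x - z‖ ≤ d → ‖x + v - z‖ ≤ d →
    K * d * ‖v‖ ≤ inner ℝ v (N z) → x + v ∈ Ω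
  rotation : ∀ e, inner ℝ e (N z) = 0 → ‖e‖ ≤ 1 → ∃ xi, inner ℝ xi (N z) = 0 ∧ ‖xi‖ ≤ K ∧
    ∀ z' ∈ frontier Ω, ‖z' - z‖ ≤ r →
      |inner ℝ (e + inner ℝ (z' - z) xi • N z - inner ℝ (z' - z) (N z) • xi) (N z')|
        ≤ K * ‖z' - z‖ ^ 2

lemma NormalField.mono {Ω : Set (E n)} {R K r R' K' r' : ℝ} {z : E n} {N : E n → E n}
    (h : NormalField Ω R K r z N) (hR : R' ≤ R) (hK : K ≤ K') (hr : r' ≤ r) :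
    NormalField Ω R' K' r' z N := by
  refine ⟨fun z' hz' h1 => (h.touching z' hz' (h1.trans hr)).mono hR,
    fun d hd x hx v h1 h2 h3 => h.cone d (hd.trans hr) x hx v h1 h2 (le_trans ?_ h3), fun e he1 he2 => ?_⟩
  · have : 0 ≤ d := (norm_nonneg _).trans h1
    gcongr
  · obtain ⟨xi, h1, h2, h3⟩ := h.rotation e he1 he2
    exact ⟨xi, h1, h2.trans hK, fun z' hz' h4 => (h3 z' hz' (h4.trans hr)).trans (by gcongr)⟩

lemma defining_function_eq_zero {Ω U : Set (E n)} {psi : E n → ℝ} (hΩ : IsOpen Ω) (hU : IsOpen U)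
    (hψ : ContinuousOn psi U) (hΩU : Ω ∩ U = {y ∈ U | psi y < 0}) {z : E n} (hzU : z ∈ U)
    (hz : z ∈ frontier Ω) : psi z = 0 := by
  rw [hΩ.frontier_eq] at hz
  apply le_antisymm
  · by_contra hpos
    push Not at hpos
    have h1 : ∀ᶠ y in 𝓝 z, 0 < psi y :=
      (hψ.continuousAt (hU.mem_nhds hzU)).eventually (lt_mem_nhds hpos)
    obtain ⟨y, ⟨h2, h3⟩, h4⟩ := mem_closure_iff_nhds.1 hz.1 _ (h1.and (hU.mem_nhds hzU))
    have : y ∈ {y ∈ U | psi y < 0} := hΩU ▸ ⟨h4, h3⟩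
    linarith [this.2]
  · by_contra hneg
    push Not at hneg
    have : z ∈ Ω ∩ U := hΩU ▸ ⟨hzU, hneg⟩
    exact hz.2 this.1

/-- With `y = z' - z` and `T` the derivative of the normal at `z`, the constant field `e` fails to
be tangent at `z'` by `⟨Ty, e⟩` to first order. Put `t = T*e` and let `ξ` be the tangential part of
`-t`. The rotation in the plane of `m` and `ξ` cancels this defect up to multiples of `⟨y, m⟩`,
which is itself quadratic on the boundary. -/
lemma exists_rotation {S : Set (E n)} {N : E n → E n} {z : E n} {C2 R : ℝ} (hC2 : 0 < C2)
    (hm1 : ‖N z‖ = 1) (T : E n →L[ℝ] E n) (hTn : ‖T‖ ≤ C2)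
    (hqn : ∀ z' ∈ S, ‖N z' - N z - T (z' - z)‖ ≤ C2 * ‖z' - z‖ ^ 2)
    (hdn : ∀ z' ∈ S, ‖N z' - N z‖ ≤ 2 * C2 * ‖z' - z‖)
    (hym : ∀ z' ∈ S, |inner ℝ (z' - z) (N z)| ≤ ‖z' - z‖ ^ 2 / (2 * R))
    (e : E n) (he1 : inner ℝ e (N z) = 0) (he2 : ‖e‖ ≤ 1) :
    ∃ xi, inner ℝ xi (N z) = 0 ∧ ‖xi‖ ≤ 2 * C2 ∧ ∀ z' ∈ S,
      |inner ℝ (e + inner ℝ (z' - z) xi • N z - inner ℝ (z' - z) (N z) • xi) (N z')|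
        ≤ (C2 + C2 / (2 * R) + 8 * C2 ^ 2) * ‖z' - z‖ ^ 2 := by
  set m := N z with hm
  set t := ContinuousLinearMap.adjoint T e with ht
  have htn : ‖t‖ ≤ C2 := by
    calc ‖t‖ ≤ ‖ContinuousLinearMap.adjoint T‖ * ‖e‖ := ContinuousLinearMap.le_opNorm _ _
      _ ≤ C2 * 1 := by
        rw [LinearIsometryEquiv.norm_map]; gcongr
      _ = C2 := mul_one _
  have hmm : inner ℝ m m = (1 : ℝ) := by rw [real_inner_self_eq_norm_sq, hm1]; norm_num
  have htm : |inner ℝ t m| ≤ C2 := by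
    calc |inner ℝ t m| ≤ ‖t‖ * ‖m‖ := abs_real_inner_le_norm _ _
      _ ≤ C2 := by rw [hm1, mul_one]; exact htn
  set xi := (inner ℝ t m : ℝ) • m - t with hxi
  have hxim : inner ℝ xi m = 0 := by
    rw [hxi, inner_sub_left, inner_smul_left, hmm]; simp
  have hxin : ‖xi‖ ≤ 2 * C2 := by
    calc ‖xi‖ ≤ ‖(inner ℝ t m : ℝ) • m‖ + ‖t‖ := norm_sub_le _ _
      _ ≤ C2 + C2 := by
        gcongr
        rw [norm_smul, hm1, mul_one]; exact htm
      _ = 2 * C2 := by ring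
  refine ⟨xi, hxim, hxin, fun z' hz' => ?_⟩
  specialize hqn z' hz'
  specialize hdn z' hz'
  specialize hym z' hz'
  set y := z' - z with hy
  set q := N z' - m - T y with hq
  have hyt : inner ℝ y t = inner ℝ (T y) e := by
    rw [ht, ContinuousLinearMap.adjoint_inner_right]
  have hyxi : inner ℝ y xi = inner ℝ t m * inner ℝ y m - inner ℝ (T y) e := by
    rw [hxi, inner_sub_right, inner_smul_right, hyt]
  -- An exact identity in which `⟨Ty, e⟩` has disappeared; each of the four remaining terms is
  -- quadratic in `y`.
  have hexp : inner ℝ (e + (inner ℝ y xi : ℝ) • m - (inner ℝ y m : ℝ) • xi) (N z')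
      = inner ℝ e q + inner ℝ t m * inner ℝ y m + inner ℝ y xi * inner ℝ m (N z' - m)
        - inner ℝ y m * inner ℝ xi (N z' - m) := by
    have e1 : N z' = m + T y + q := by rw [hq]; abel
    have e2 : inner ℝ e (N z') = inner ℝ (T y) e + inner ℝ e q := by
      rw [e1, inner_add_right, inner_add_right, he1, zero_add, real_inner_comm]
    rw [inner_sub_left, inner_add_left, inner_smul_left, inner_smul_left, e2, inner_sub_right m,
      inner_sub_right xi, hmm, hxim]
    simp only [conj_trivial]
    rw [hyxi]
    ring
  rw [hexp]
  have b1 : |inner ℝ e q| ≤ C2 * ‖y‖ ^ 2 := by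
    calc |inner ℝ e q| ≤ ‖e‖ * ‖q‖ := abs_real_inner_le_norm _ _
      _ ≤ 1 * (C2 * ‖y‖ ^ 2) := by gcongr
      _ = _ := one_mul _
  have b2 : |inner ℝ t m * inner ℝ y m| ≤ C2 / (2 * R) * ‖y‖ ^ 2 := by
    rw [abs_mul]
    calc |inner ℝ t m| * |inner ℝ y m| ≤ C2 * (‖y‖ ^ 2 / (2 * R)) := by gcongr
      _ = _ := by ring
  have b3 : |inner ℝ y xi * inner ℝ m (N z' - m)| ≤ 4 * C2 ^ 2 * ‖y‖ ^ 2 := by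
    rw [abs_mul]
    have a1 : |inner ℝ y xi| ≤ ‖y‖ * (2 * C2) := (abs_real_inner_le_norm _ _).trans (by gcongr)
    have a2 : |inner ℝ m (N z' - m)| ≤ 1 * (2 * C2 * ‖y‖) := by
      refine (abs_real_inner_le_norm _ _).trans ?_
      rw [hm1]; gcongr
    calc |inner ℝ y xi| * |inner ℝ m (N z' - m)| ≤ (‖y‖ * (2 * C2)) * (1 * (2 * C2 * ‖y‖)) := by
          gcongr
      _ = _ := by ring
  have b4 : |inner ℝ y m * inner ℝ xi (N z' - m)| ≤ 4 * C2 ^ 2 * ‖y‖ ^ 2 := by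
    rw [abs_mul]
    have a1 : |inner ℝ y m| ≤ ‖y‖ * 1 := by
      refine (abs_real_inner_le_norm _ _).trans ?_
      rw [hm1]
    have a2 : |inner ℝ xi (N z' - m)| ≤ 2 * C2 * (2 * C2 * ‖y‖) :=
      (abs_real_inner_le_norm _ _).trans (by gcongr)
    calc |inner ℝ y m| * |inner ℝ xi (N z' - m)| ≤ (‖y‖ * 1) * (2 * C2 * (2 * C2 * ‖y‖)) := by
          gcongr
      _ = _ := by ring
  have b1' := abs_le.1 b1
  have b2' := abs_le.1 b2
  have b3' := abs_le.1 b3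
  have b4' := abs_le.1 b4
  refine abs_le.2 ⟨?_, ?_⟩ <;> linarith [b1'.1, b1'.2, b2'.1, b2'.2, b3'.1, b3'.2, b4'.1, b4'.2]

-- The normal is `-∇ψ/|∇ψ|` for a local defining function `ψ`. All properties follow from the Taylor
-- bounds for `ψ` and for this field, uniformly for centres near `z0`.
set_option maxHeartbeats 800000 in
lemma exists_local_normalField {Ω : Set (E n)} (h : IsBoundedSmoothDomain Ω) {z0 : E n}
    (hz0 : z0 ∈ frontier Ω) : ∃ R K r : ℝ, 0 < R ∧ 0 < K ∧ 0 < r ∧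
      ∀ z ∈ Metric.ball z0 r, z ∈ frontier Ω → ∃ N, NormalField Ω R K r z N := by
  obtain ⟨U, hU, hz0U, psi, hψ, hdψ, hΩU⟩ := h.smooth z0 hz0
  have hψ' (m : ℕ) : ContDiffAt ℝ m psi z0 :=
    (hψ.contDiffAt (hU.mem_nhds hz0U)).of_le (by exact_mod_cast le_top)
  have hψ3 : ContDiffAt ℝ 3 psi z0 := hψ' 3
  have hG : ContDiffAt ℝ 2 (grad psi) z0 := by
    unfold grad
    rw [contDiffAt_euclidean]
    intro i
    exact contDiffAt_pd i (m := 2) (hψ3.of_le (by norm_num))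
  have hG0 : grad psi z0 ≠ 0 := by
    intro h0
    apply hdψ
    ext v
    rw [← inner_grad, h0, inner_zero_left]; rfl
  set N : E n → E n := fun x => (-(‖grad psi x‖)⁻¹) • grad psi x with hN
  have hN2 : ContDiffAt ℝ 2 N z0 :=
    ((hG.norm ℝ hG0).inv (norm_ne_zero_iff.2 hG0)).neg.smul hG
  obtain ⟨C1, hC1, r1, hr1, hr1', hT1⟩ := exists_taylor_bound (hψ3.of_le (by norm_num) : ContDiffAt ℝ 2 psi z0)
  obtain ⟨C2, hC2, r2, hr2, hr2', hT2⟩ := exists_taylor_bound hN2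
  set c := ‖grad psi z0‖ / 2 with hc
  have hc0 : 0 < c := by have := norm_pos_iff.2 hG0; positivity
  have hGc : ∀ᶠ x in 𝓝 z0, c < ‖grad psi x‖ :=
    hG.continuousAt.norm.eventually (lt_mem_nhds (by rw [hc]; linarith))
  obtain ⟨r3, hr3, hball3⟩ := Metric.eventually_nhds_iff_ball.1 (hGc.and (hU.mem_nhds hz0U))
  set ρ := min r1 (min r2 r3) with hρ
  have hρ0 : 0 < ρ := by positivity
  have hB1 : ∀ x ∈ Metric.ball z0 ρ, x ∈ Metric.ball z0 r1 := fun x hx =>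
    Metric.ball_subset_ball (min_le_left _ _) hx
  have hB2 : ∀ x ∈ Metric.ball z0 ρ, x ∈ Metric.ball z0 r2 := fun x hx =>
    Metric.ball_subset_ball ((min_le_right _ _).trans (min_le_left _ _)) hx
  have hB3 : ∀ x ∈ Metric.ball z0 ρ, x ∈ Metric.ball z0 r3 := fun x hx =>
    Metric.ball_subset_ball ((min_le_right _ _).trans (min_le_right _ _)) hx
  have hunit : ∀ x ∈ Metric.ball z0 ρ, ‖N x‖ = 1 := by
    intro x hx
    have := hc0.trans (hball3 x (hB3 x hx)).1
    rw [hN]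
    simp only [norm_smul, norm_neg, norm_inv, norm_norm]
    exact inv_mul_cancel₀ this.ne'
  have hGN : ∀ x ∈ Metric.ball z0 ρ, grad psi x = (-‖grad psi x‖) • N x := by
    intro x hx
    have := hc0.trans (hball3 x (hB3 x hx)).1
    rw [hN]
    simp only [smul_smul]
    rw [neg_mul_neg, mul_inv_cancel₀ this.ne', one_smul]
  -- Taylor expansion of the defining function in terms of the normal
  have hTψ : ∀ x ∈ Metric.ball z0 ρ, ∀ y ∈ Metric.ball z0 ρ,
      |psi y - psi x + ‖grad psi x‖ * inner ℝ (N x) (y - x)| ≤ C1 * ‖y - x‖ ^ 2 := by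
    intro x hx y hy
    have h1 := (hT1 x (hB1 x hx)).2 y (hB1 y hy)
    have h2 : inner ℝ (grad psi x) (y - x) = -‖grad psi x‖ * inner ℝ (N x) (y - x) := by
      conv_lhs => rw [hGN x hx]
      rw [real_inner_smul_left]
    rw [← inner_grad, h2, Real.norm_eq_abs] at h1
    rwa [neg_mul, sub_neg_eq_add] at h1
  have hLN : ∀ x ∈ Metric.ball z0 ρ, ∀ y ∈ Metric.ball z0 ρ, ‖N y - N x‖ ≤ 2 * C2 * ‖y - x‖ := by
    intro x hx y hy
    have h1 := (hT2 x (hB2 x hx)).2 y (hB2 y hy)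
    have h2 := (fderiv ℝ N x).le_of_opNorm_le (hT2 x (hB2 x hx)).1 (y - x)
    have h3 : ‖y - x‖ ≤ 1 := by
      have a1 := hB2 x hx; have a2 := hB2 y hy
      rw [Metric.mem_ball] at a1 a2
      rw [← dist_eq_norm]
      linarith [dist_triangle_right y x z0]
    have h4 : ‖N y - N x‖ ≤ ‖N y - N x - fderiv ℝ N x (y - x)‖ + ‖fderiv ℝ N x (y - x)‖ :=
      norm_le_norm_sub_add _ _
    have h5 : C2 * ‖y - x‖ ^ 2 ≤ C2 * ‖y - x‖ := by
      gcongr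
      nlinarith [norm_nonneg (y - x)]
    linarith
  have hmemΩ : ∀ x ∈ Metric.ball z0 ρ, (x ∈ Ω ↔ psi x < 0) := by
    intro x hx
    have hxU : x ∈ U := (hball3 x (hB3 x hx)).2
    constructor
    · intro hxΩ
      have : x ∈ {y ∈ U | psi y < 0} := hΩU ▸ ⟨hxΩ, hxU⟩
      exact this.2
    · intro hneg
      have : x ∈ Ω ∩ U := hΩU ▸ ⟨hxU, hneg⟩
      exact this.1
  have hzero : ∀ x ∈ Metric.ball z0 ρ, x ∈ frontier Ω → psi x = 0 := fun x hx hxf =>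
    defining_function_eq_zero h.isOpen hU hψ.continuousOn hΩU (hball3 x (hB3 x hx)).2 hxf
  -- In a tangent ball of radius `R` one has `|x - z'|² < 2R |⟨N, x - z'⟩|`, so `2 C1 R ≤ c` lets
  -- the linear term of `ψ` beat the Taylor remainder; `ρ/8` keeps the balls inside the region of
  -- the expansions.
  set R := min (ρ / 8) (c / (2 * C1)) with hRdef
  have hR0 : 0 < R := by positivity
  have hRρ : R ≤ ρ / 8 := min_le_left _ _
  have hRC : 2 * C1 * R ≤ c := by
    have : R ≤ c / (2 * C1) := min_le_right _ _
    rw [le_div_iff₀ (by positivity)] at this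
    linarith
  -- `2 C2` covers the variation of the normal and the size of `ξ`, `2 C1 / c` the Taylor remainder
  -- in the cone property, and the bracket is the constant of `exists_rotation`.
  set K := 2 * C2 + 2 * C1 / c + (C2 + C2 / (2 * R) + 8 * C2 ^ 2) with hK
  have hK0 : 0 < K := by positivity
  refine ⟨R, K, ρ / 4, hR0, hK0, by positivity, fun z hz hzf => ⟨N, ?_⟩⟩
  have hnear : ∀ x, ‖x - z‖ < 3 * ρ / 4 → x ∈ Metric.ball z0 ρ := by
    intro x hx
    rw [← dist_eq_norm] at hx
    rw [Metric.mem_ball] at hz ⊢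
    linarith [dist_triangle x z z0]
  have hzB : z ∈ Metric.ball z0 ρ := hnear z (by simp; positivity)
  have htouch : ∀ z' ∈ frontier Ω, ‖z' - z‖ ≤ ρ / 4 → TouchingBalls Ω R z' (N z') := by
    intro z' hz'f hz'
    have hz'B : z' ∈ Metric.ball z0 ρ := hnear z' (by linarith)
    have hm := hunit z' hz'B
    have hgc := (hball3 z' (hB3 z' hz'B)).1
    have hclose : ∀ x (s : ℝ), |s| = R → dist x (z' + s • N z') < R → x ∈ Metric.ball z0 ρ := by
      intro x s hs hx
      refine hnear x ?_
      have h1 : dist (z' + s • N z') z' = R := by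
        rw [dist_eq_norm, add_sub_cancel_left, norm_smul, hm, Real.norm_eq_abs, hs, mul_one]
      have h2 := dist_triangle x (z' + s • N z') z'
      have h3 := dist_triangle x z' z
      rw [dist_eq_norm z' z] at h3
      rw [← dist_eq_norm]
      linarith
    have hsq : ∀ x (s : ℝ), |s| = R → dist x (z' + s • N z') < R →
        ‖x - z'‖ ^ 2 < 2 * s * inner ℝ (N z') (x - z') := by
      intro x s hs hx
      rw [dist_eq_norm] at hx
      have h1 : ‖x - (z' + s • N z')‖ ^ 2 < R ^ 2 := by gcongr
      rw [show x - (z' + s • N z') = (x - z') - s • N z' by abel, norm_sub_sq_real, inner_smul_right,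
        norm_smul, mul_pow, hm, Real.norm_eq_abs, hs, real_inner_comm] at h1
      linarith
    refine ⟨hm, fun x hx => ?_, fun x hx => ?_⟩
    · have hxB := hclose x R (abs_of_pos hR0) hx
      have h1 := hsq x R (abs_of_pos hR0) hx
      rw [hmemΩ x hxB]
      have h2 := (abs_le.1 (hTψ z' hz'B x hxB)).2
      rw [hzero z' hz'B hz'f] at h2
      have h3 : 0 < inner ℝ (N z') (x - z') := by
        by_contra hneg
        push Not at hneg
        nlinarith [sq_nonneg ‖x - z'‖]
      have h4 : C1 * ‖x - z'‖ ^ 2 < C1 * (2 * R * inner ℝ (N z') (x - z')) := by gcongr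
      have h5 : 2 * C1 * R * inner ℝ (N z') (x - z') ≤ ‖grad psi z'‖ * inner ℝ (N z') (x - z') := by
        gcongr
        linarith
      linarith
    · by_contra hlt
      push Not at hlt
      have hx' : dist x (z' + (-R) • N z') < R := by
        rwa [neg_smul, ← sub_eq_add_neg]
      have habs : |(-R)| = R := by rw [abs_neg, abs_of_pos hR0]
      have hxB := hclose x (-R) habs hx'
      have h1 := hsq x (-R) habs hx'
      have h0 := (hmemΩ x hxB).1 hx
      have h2 := (abs_le.1 (hTψ z' hz'B x hxB)).1
      rw [hzero z' hz'B hz'f] at h2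
      have h3 : 0 < -inner ℝ (N z') (x - z') := by
        by_contra hneg
        push Not at hneg
        nlinarith [sq_nonneg ‖x - z'‖]
      have h4 : C1 * ‖x - z'‖ ^ 2 < C1 * (2 * R * (-inner ℝ (N z') (x - z'))) := by
        gcongr; linarith
      have h5 : 2 * C1 * R * (-inner ℝ (N z') (x - z')) ≤ ‖grad psi z'‖ * (-inner ℝ (N z') (x - z')) := by
        gcongr
        linarith
      linarith
  refine ⟨htouch, ?_, ?_⟩
  · intro d hd x hx v h1 h2 h3
    have hd0 : 0 ≤ d := (norm_nonneg _).trans h1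
    have hxB := hnear x (by linarith)
    have hyB := hnear (x + v) (by linarith)
    rw [hmemΩ _ hyB]
    have h0 := (hmemΩ x hxB).1 hx
    have hgc := (hball3 x (hB3 x hxB)).1
    have h4 := (abs_le.1 (hTψ x hxB (x + v) hyB)).2
    rw [add_sub_cancel_left] at h4
    have h5 : inner ℝ v (N z) - 2 * C2 * d * ‖v‖ ≤ inner ℝ (N x) v := by
      have a1 := abs_real_inner_le_norm (N x - N z) v
      have a2 := hLN z hzB x hxB
      rw [inner_sub_left, real_inner_comm v (N z)] at a1
      have a3 : ‖N x - N z‖ * ‖v‖ ≤ 2 * C2 * d * ‖v‖ := by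
        gcongr
        exact a2.trans (by gcongr)
      have := (abs_le.1 a1).1
      linarith
    have hv : ‖v‖ ≤ 2 * d := by
      have : v = (x + v - z) - (x - z) := by abel
      calc ‖v‖ = ‖(x + v - z) - (x - z)‖ := by rw [← this]
        _ ≤ ‖x + v - z‖ + ‖x - z‖ := norm_sub_le _ _
        _ ≤ 2 * d := by linarith
    have h6 : 2 * C1 / c * d * ‖v‖ ≤ inner ℝ (N x) v := by
      have : (2 * C2 + 2 * C1 / c) * d * ‖v‖ ≤ K * d * ‖v‖ := by
        gcongr
        rw [hK]
        have : 0 ≤ C2 + C2 / (2 * R) + 8 * C2 ^ 2 := by positivity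
        linarith
      have e : (2 * C2 + 2 * C1 / c) * d * ‖v‖ = 2 * C2 * d * ‖v‖ + 2 * C1 / c * d * ‖v‖ := by ring
      linarith
    have h7 : C1 * ‖v‖ ^ 2 ≤ ‖grad psi x‖ * inner ℝ (N x) v := by
      calc C1 * ‖v‖ ^ 2 = C1 * ‖v‖ * ‖v‖ := by ring
        _ ≤ C1 * (2 * d) * ‖v‖ := by gcongr
        _ = c * (2 * C1 / c * d * ‖v‖) := by field_simp
        _ ≤ ‖grad psi x‖ * inner ℝ (N x) v := by gcongr
    linarith
  · intro e he1 he2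
    obtain ⟨xi, h1, h2, h3⟩ := exists_rotation (S := {z' ∈ frontier Ω | ‖z' - z‖ ≤ ρ / 4})
      hC2 (hunit z hzB) (fderiv ℝ N z) (hT2 z (hB2 z hzB)).1
      (fun z' hz' => (hT2 z (hB2 z hzB)).2 z' (hB2 z' (hnear z' (by linarith [hz'.2]))))
      (fun z' hz' => hLN z hzB z' (hnear z' (by linarith [hz'.2])))
      (fun z' hz' => (htouch z hzf (by rw [sub_self, norm_zero]; positivity)).abs_inner_le
        h.isOpen hR0 hz'.1) e he1 he2
    have hp1 : 0 ≤ 2 * C1 / c + (C2 + C2 / (2 * R) + 8 * C2 ^ 2) := by positivity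
    have hp2 : 0 ≤ 2 * C2 + 2 * C1 / c := by positivity
    refine ⟨xi, h1, by rw [hK]; linarith, fun z' hz'f hz' => (h3 z' ⟨hz'f, hz'⟩).trans ?_⟩
    gcongr
    rw [hK]; linarith

/-- Uniform normal fields along the boundary of a bounded smooth domain. -/
theorem exists_normalField {Ω : Set (E n)} (h : IsBoundedSmoothDomain Ω) :
    ∃ R K r : ℝ, 0 < R ∧ 0 < K ∧ 0 < r ∧ ∀ z ∈ frontier Ω, ∃ N, NormalField Ω R K r z N := by
  have hcomp : IsCompact (frontier Ω) :=
    h.bounded.isCompact_closure.of_isClosed_subset isClosed_frontier frontier_subset_closure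
  suffices H : ∃ R K r : ℝ, 0 < R ∧ 0 < K ∧ 0 < r ∧
      ∀ z ∈ frontier Ω, z ∈ frontier Ω → ∃ N, NormalField Ω R K r z N by
    obtain ⟨R, K, r, h1, h2, h3, h4⟩ := H
    exact ⟨R, K, r, h1, h2, h3, fun z hz => h4 z hz hz⟩
  -- By `NormalField.mono` the local constants survive finite unions after taking minima and maxima.
  refine hcomp.induction_on (p := fun S => ∃ R K r : ℝ, 0 < R ∧ 0 < K ∧ 0 < r ∧
      ∀ z ∈ S, z ∈ frontier Ω → ∃ N, NormalField Ω R K r z N) ?_ ?_ ?_ ?_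
  · exact ⟨1, 1, 1, one_pos, one_pos, one_pos, fun z hz => hz.elim⟩
  · rintro s t hst ⟨R, K, r, h1, h2, h3, h4⟩
    exact ⟨R, K, r, h1, h2, h3, fun z hz => h4 z (hst hz)⟩
  · rintro s t ⟨R, K, r, h1, h2, h3, h4⟩ ⟨R', K', r', h1', h2', h3', h4'⟩
    refine ⟨min R R', max K K', min r r', lt_min h1 h1', lt_max_of_lt_left h2, lt_min h3 h3', ?_⟩
    rintro z (hz | hz) hzf
    · obtain ⟨N, hN⟩ := h4 z hz hzf
      exact ⟨N, hN.mono (min_le_left _ _) (le_max_left _ _) (min_le_left _ _)⟩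
    · obtain ⟨N, hN⟩ := h4' z hz hzf
      exact ⟨N, hN.mono (min_le_right _ _) (le_max_right _ _) (min_le_right _ _)⟩
  · intro z0 hz0
    obtain ⟨R, K, r, h1, h2, h3, h4⟩ := exists_local_normalField h hz0
    exact ⟨Metric.ball z0 r, mem_nhdsWithin_of_mem_nhds (Metric.ball_mem_nhds z0 h3),
      R, K, r, h1, h2, h3, h4⟩

end DeSitter

end

noncomputable section

namespace DeSitter
open Matrix Filter Topology

variable {n : ℕ}

/-! ### The gradient near the boundary -/

lemma exists_first_exit {Ω : Set (E n)} (hΩ : IsOpen Ω) {x v : E n} (hx : x ∈ Ω) {T : ℝ}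
    (hT : 0 ≤ T) (hxT : x + T • v ∉ Ω) :
    ∃ t1, 0 < t1 ∧ t1 ≤ T ∧ x + t1 • v ∈ frontier Ω ∧ ∀ t, 0 ≤ t → t < t1 → x + t • v ∈ Ω := by
  have hc : Continuous fun t : ℝ => x + t • v := by fun_prop
  set S : Set ℝ := Set.Icc 0 T ∩ (fun t : ℝ => x + t • v) ⁻¹' Ωᶜ with hS
  have hSc : IsCompact S := isCompact_Icc.inter_right (hΩ.isClosed_compl.preimage hc)
  have hSn : S.Nonempty := ⟨T, ⟨hT, le_rfl⟩, hxT⟩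
  obtain ⟨t1, ⟨⟨h0, h1⟩, h2⟩, hmin⟩ := hSc.exists_isLeast hSn
  have hbefore : ∀ t, 0 ≤ t → t < t1 → x + t • v ∈ Ω := by
    intro t ht htt
    by_contra hno
    exact absurd (hmin ⟨⟨ht, htt.le.trans h1⟩, hno⟩) (not_le.2 htt)
  have hpos : 0 < t1 := by
    rcases h0.lt_or_eq with h | h
    · exact h
    · exfalso; apply h2; simpa [← h] using hx
  refine ⟨t1, hpos, h1, ?_, hbefore⟩
  rw [hΩ.frontier_eq]
  refine ⟨?_, h2⟩
  have hlim : Tendsto (fun t : ℝ => x + t • v) (𝓝[<] t1) (𝓝 (x + t1 • v)) :=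
    hc.continuousAt.tendsto.mono_left nhdsWithin_le_nhds
  refine mem_closure_of_tendsto hlim ?_
  filter_upwards [Ioo_mem_nhdsLT hpos] with t ht using hbefore t ht.1.le ht.2

lemma slopeHi_nonneg {sig R eps : ℝ} (hsig : 1 < sig) (hR : 0 ≤ R) (heps : 0 < eps) :
    0 ≤ slopeHi sig R eps := by
  have h0 : 0 < sig ^ 2 - 1 := by nlinarith
  have h1 : eps ≤ capRad sig R eps := by
    rw [capRad]; apply Real.le_sqrt_of_sq_le
    nlinarith [mul_nonneg h0.le (sq_nonneg R)]
  have h2 : 0 < sig * capRad sig R eps - eps := by nlinarith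
  rw [slopeHi]; positivity

namespace IsAdmissibleSolution

variable {f : E n → ℝ} {Ω : Set (E n)} {sig eps : ℝ} {u : E n → ℝ}

/-- Convexity of `|x|² - u²` gives `u D²u(v,v) ≤ |v|²`, and `u ≥ ε` replaces `u` by `ε` when the
left side is positive. -/
lemma hess_quadratic_le (hf : IsCurvatureFunction f) (hΩ : IsOpen Ω) (hb : Bornology.IsBounded Ω)
    (hsig : 1 < sig) (heps : 0 < eps) (hu : IsAdmissibleSolution f Ω sig eps u) {x : E n}
    (hx : x ∈ Ω) (v : E n) : v.ofLp ⬝ᵥ hess u x *ᵥ v.ofLp ≤ ‖v‖ ^ 2 / eps := by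
  have h1 := (hu.convMat_posDef hx).posSemidef.dotProduct_mulVec_nonneg v.ofLp
  rw [star_trivial, convMat_quadratic, metMat_quadratic, dotProduct_self_eq] at h1
  have h2 := hu.eps_le hf hΩ hb hsig (subset_closure hx)
  rw [le_div_iff₀ heps]
  rcases le_or_gt (v.ofLp ⬝ᵥ hess u x *ᵥ v.ofLp) 0 with h | h
  · have : v.ofLp ⬝ᵥ hess u x *ᵥ v.ofLp * eps ≤ 0 := mul_nonpos_of_nonpos_of_nonneg h heps.le
    exact this.trans (by positivity)
  · nlinarith [sq_nonneg ((grad u x).ofLp ⬝ᵥ v.ofLp)]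

/-- Semiconcavity of `u` along segments. -/
lemma le_quadratic (hf : IsCurvatureFunction f) (hΩ : IsOpen Ω) (hb : Bornology.IsBounded Ω)
    (hsig : 1 < sig) (heps : 0 < eps) (hu : IsAdmissibleSolution f Ω sig eps u) {x v : E n}
    (hxv : x + v ∈ closure Ω)
    (hseg : ∀ t : ℝ, 0 ≤ t → t < 1 → x + t • v ∈ Ω) :
    u (x + v) ≤ u x + inner ℝ (grad u x) v + ‖v‖ ^ 2 / (2 * eps) := by
  have hcl : ∀ t ∈ Set.Icc (0 : ℝ) 1, x + t • v ∈ closure Ω := by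
    rintro t ⟨h0, h1⟩
    rcases h1.lt_or_eq with h | h
    · exact subset_closure (hseg t h0 h)
    · rwa [h, one_smul]
  set D := inner ℝ (grad u x) v with hD
  set k : ℝ → ℝ := fun t => D + t * (‖v‖ ^ 2 / eps) - fderiv ℝ u (x + t • v) v with hk
  have hkd : ∀ t ∈ Set.Icc (0 : ℝ) 1, HasDerivAt k
      (‖v‖ ^ 2 / eps - v.ofLp ⬝ᵥ hess u (x + t • v) *ᵥ v.ofLp) t := by
    intro t ht
    have h1 := hasDerivAt_fderiv_line (hu.contDiffAt_nat (hcl t ht) 2)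
    have h2 : HasDerivAt (fun t : ℝ => D + t * (‖v‖ ^ 2 / eps)) (‖v‖ ^ 2 / eps) t := by
      simpa using ((hasDerivAt_id t).mul_const (‖v‖ ^ 2 / eps)).const_add D
    exact h2.sub h1
  have hk0 : ∀ t ∈ Set.Icc (0 : ℝ) 1, 0 ≤ k t := by
    have hmono : MonotoneOn k (Set.Icc 0 1) := by
      refine monotoneOn_of_deriv_nonneg (convex_Icc 0 1)
        (fun t ht => (hkd t ht).continuousAt.continuousWithinAt)
        (fun t ht => (hkd t (interior_subset ht)).differentiableAt.differentiableWithinAt)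
        fun t ht => ?_
      rw [(hkd t (interior_subset ht)).deriv]
      rw [interior_Icc] at ht
      linarith [hu.hess_quadratic_le hf hΩ hb hsig heps (hseg t ht.1.le ht.2) v]
    intro t ht
    have h0 : k 0 = 0 := by simp [hk, hD, inner_grad]
    rw [← h0]
    exact hmono ⟨le_rfl, zero_le_one⟩ ht ht.1
  set g : ℝ → ℝ := fun t => t * D + t ^ 2 * (‖v‖ ^ 2 / (2 * eps)) - u (x + t • v) with hg
  have hgd : ∀ t ∈ Set.Icc (0 : ℝ) 1, HasDerivAt g (k t) t := by
    intro t ht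
    have h1 := hasDerivAt_line ((hu.contDiffAt_nat (hcl t ht) 2).differentiableAt (by norm_num))
    have h2 : HasDerivAt (fun t : ℝ => t * D + t ^ 2 * (‖v‖ ^ 2 / (2 * eps)))
        (D + t * (‖v‖ ^ 2 / eps)) t := by
      have h3 := ((hasDerivAt_id t).mul_const D).add
        (((hasDerivAt_id t).pow 2).mul_const (‖v‖ ^ 2 / (2 * eps)))
      refine h3.congr_deriv ?_
      simp only [id, Nat.cast_ofNat, show 2 - 1 = 1 from rfl, pow_one]
      field_simp
    exact h2.sub h1
  have hmono : MonotoneOn g (Set.Icc 0 1) := by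
    refine monotoneOn_of_deriv_nonneg (convex_Icc 0 1)
      (fun t ht => (hgd t ht).continuousAt.continuousWithinAt)
      (fun t ht => (hgd t (interior_subset ht)).differentiableAt.differentiableWithinAt)
      fun t ht => ?_
    rw [(hgd t (interior_subset ht)).deriv]
    exact hk0 t (interior_subset ht)
  have := hmono ⟨le_rfl, zero_le_one⟩ ⟨zero_le_one, le_rfl⟩ zero_le_one
  simp only [hg, zero_mul, zero_smul, add_zero, one_mul, one_smul, one_pow] at this
  norm_num at this
  linarith

/-- The boundary gradient points in the normal direction. -/
lemma grad_boundary (hf : IsCurvatureFunction f) (hΩ : IsOpen Ω) (hb : Bornology.IsBounded Ω)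
    (hsig : 1 < sig) (heps : 0 < eps) (hu : IsAdmissibleSolution f Ω sig eps u) {R : ℝ} (hR : 0 < R)
    (heR : eps < R) {z m : E n} (hz : z ∈ frontier Ω) (ht : TouchingBalls Ω R z m) :
    (∀ e, inner ℝ e m = 0 → inner ℝ (grad u z) e = 0) ∧
      slopeLo sig R eps ≤ inner ℝ (grad u z) m ∧ inner ℝ (grad u z) m ≤ slopeHi sig R eps := by
  have hzc := frontier_subset_closure hz
  have hmm : inner ℝ m m = (1 : ℝ) := by rw [real_inner_self_eq_norm_sq, ht.unit]; norm_num
  have hin : ∀ v : E n, 0 < inner ℝ v m → ∀ᶠ t : ℝ in 𝓝[>] 0, z + t • v ∈ closure Ω := by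
    intro v hv
    have h1 : ∀ᶠ t : ℝ in 𝓝[>] 0, t * ‖v‖ ^ 2 < 2 * R * inner ℝ v m := by
      have : Tendsto (fun t : ℝ => t * ‖v‖ ^ 2) (𝓝[>] 0) (𝓝 (0 * ‖v‖ ^ 2)) :=
        ((continuous_id.mul continuous_const).tendsto 0).mono_left nhdsWithin_le_nhds
      exact this.eventually (gt_mem_nhds (by rw [zero_mul]; positivity))
    filter_upwards [h1, self_mem_nhdsWithin] with t ht1 ht0
    have ht0 : 0 < t := ht0
    refine subset_closure (ht.interior ?_)
    rw [Metric.mem_ball, dist_eq_norm]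
    refine lt_of_pow_lt_pow_left₀ 2 hR.le ?_
    rw [show z + t • v - (z + R • m) = t • v - R • m by abel, norm_sub_sq_real,
      real_inner_smul_left, inner_smul_right, norm_smul, norm_smul, ht.unit, mul_pow, mul_pow,
      Real.norm_eq_abs, Real.norm_eq_abs, sq_abs, sq_abs]
    nlinarith
  have hline : ∀ v : E n, HasDerivAt (fun t : ℝ => u (z + t • v)) (inner ℝ (grad u z) v) 0 := by
    intro v
    have h1 : DifferentiableAt ℝ u (z + (0 : ℝ) • v) := by
      rw [zero_smul, add_zero]
      exact (hu.contDiffAt_nat hzc 2).differentiableAt (by norm_num)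
    have := hasDerivAt_line h1
    rwa [zero_smul, add_zero, ← inner_grad] at this
  have hquad : ∀ c : ℝ, HasDerivAt (fun t : ℝ => t ^ 2 * c) 0 0 := by
    intro c
    simpa using ((hasDerivAt_id (0 : ℝ)).pow 2).mul_const c
  have hmul : ∀ c : ℝ, HasDerivAt (fun t : ℝ => t * c) c 0 := by
    intro c
    simpa using (hasDerivAt_id (0 : ℝ)).mul_const c
  have hlo : ∀ v : E n, 0 < inner ℝ v m → slopeLo sig R eps * inner ℝ v m ≤ inner ℝ (grad u z) v := by
    intro v hv
    have h1 := ((hline v).sub (hmul (slopeLo sig R eps * inner ℝ v m))).add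
      (hquad (‖v‖ ^ 2 / (2 * R)))
    have := deriv_nonneg_of_eventually_le h1 (by
      filter_upwards [hin v hv] with t ht1
      have h2 := hu.height_ge hf hΩ hb hsig heps hR ht ht1
      rw [add_sub_cancel_left, real_inner_smul_left, norm_smul, mul_pow, Real.norm_eq_abs, sq_abs] at h2
      simp only [Pi.add_apply, Pi.sub_apply, zero_smul, add_zero, hu.bdry z hz]
      have e : t ^ 2 * ‖v‖ ^ 2 / (2 * R) = t ^ 2 * (‖v‖ ^ 2 / (2 * R)) := by ring
      rw [e] at h2
      linarith)
    linarith
  have hhi : ∀ v : E n, 0 < inner ℝ v m → inner ℝ (grad u z) v ≤ slopeHi sig R eps * inner ℝ v m := by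
    intro v hv
    have h1 := ((hmul (slopeHi sig R eps * inner ℝ v m)).sub (hline v)).add
      (hquad (‖v‖ ^ 2 / (2 * R)))
    have := deriv_nonneg_of_eventually_le h1 (by
      filter_upwards [hin v hv] with t ht1
      have h2 := hu.height_le hf hΩ hb hsig heps hR heR ht ht1
      rw [add_sub_cancel_left, real_inner_smul_left, norm_smul, mul_pow, Real.norm_eq_abs, sq_abs] at h2
      simp only [Pi.add_apply, Pi.sub_apply, zero_smul, add_zero, hu.bdry z hz]
      have e : t ^ 2 * ‖v‖ ^ 2 / (2 * R) = t ^ 2 * (‖v‖ ^ 2 / (2 * R)) := by ring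
      rw [e] at h2
      linarith)
    linarith
  have hl := hlo m (by rw [hmm]; exact one_pos)
  have hh := hhi m (by rw [hmm]; exact one_pos)
  rw [hmm, mul_one] at hl hh
  -- The height bounds hold only in inward directions, so the tangential `e` is tilted to `e + s m`
  -- with `s` small enough to contradict a positive derivative; applying this to `-e` gives
  -- equality.
  have key : ∀ e, inner ℝ e m = 0 → inner ℝ (grad u z) e ≤ 0 := by
    intro e he
    by_contra hpos
    push Not at hpos
    set D := slopeHi sig R eps - inner ℝ (grad u z) m with hD
    have hD0 : 0 ≤ D := by rw [hD]; linarith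
    obtain ⟨s, hs0, hs⟩ : ∃ s : ℝ, 0 < s ∧ s * D < inner ℝ (grad u z) e := by
      refine ⟨inner ℝ (grad u z) e / (D + 1), by positivity, ?_⟩
      rw [div_mul_eq_mul_div, div_lt_iff₀ (by positivity)]
      nlinarith
    have := hhi (e + s • m) (by rw [inner_add_left, real_inner_smul_left, he, hmm]; linarith)
    rw [inner_add_left, real_inner_smul_left, he, hmm, inner_add_right, inner_smul_right] at this
    rw [hD] at hs
    linarith
  refine ⟨fun e he => le_antisymm (key e he) ?_, hl, hh⟩
  have := key (-e) (by rw [inner_neg_left, he, neg_zero])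
  rw [inner_neg_right] at this
  linarith

end IsAdmissibleSolution

set_option maxHeartbeats 1000000 in
/-- Near a boundary point, at the scale `ε`, the gradient is close to its limit value `β n`. -/
lemma grad_near_interior {f : E n → ℝ} (hf : IsCurvatureFunction f) {Ω : Set (E n)} (hΩ : IsOpen Ω)
    (hb : Bornology.IsBounded Ω) {sig : ℝ} (hsig : 1 < sig) {R K r0 τ : ℝ} (hR : 0 < R) (hK : 0 < K)
    (hr0 : 0 < r0) (hτ : 0 < τ) (hτ1 : τ ≤ 1) :
    ∃ e1 : ℝ, 0 < e1 ∧ ∀ eps, 0 < eps → eps ≤ e1 → ∀ u, IsAdmissibleSolution f Ω sig eps u →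
      ∀ z ∈ frontier Ω, ∀ N, NormalField Ω R K r0 z N → ∀ x ∈ Ω, ‖x - z‖ ≤ τ * eps →
        |inner ℝ (grad u x) (N z) - slope sig| ≤ 3 * τ ∧
        ∀ e, inner ℝ e (N z) = 0 → ‖e‖ ≤ 1 → |inner ℝ (grad u x) e| ≤ 5 * τ := by
  obtain ⟨e1, he1, hslope⟩ := eventually_slope hsig hR (show 0 < τ ^ 2 / 8 by positivity)
  refine ⟨min e1 (min (τ / (8 * K)) (min (r0 / 4) (min (R / 2) (τ ^ 2 * R / 10)))), by positivity,
    fun eps heps hle u hu z hz N hN x hx hxz => ?_⟩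
  simp only [le_min_iff] at hle
  obtain ⟨hle1, hleK, hler, hleR, hleτ⟩ := hle
  have heR : eps < R := by linarith
  obtain ⟨hlo, hhi⟩ := hslope eps heps hle1
  set β := slope sig with hβ
  set lo := slopeLo sig R eps
  set hi := slopeHi sig R eps
  set p := grad u x with hp
  set m := N z with hm
  have htz := hN.touching z hz (by rw [sub_self, norm_zero]; exact hr0.le)
  have hm1 : ‖m‖ = 1 := htz.unit
  have hmm : inner ℝ m m = (1 : ℝ) := by rw [real_inner_self_eq_norm_sq, hm1]; norm_num
  have hp1 : ‖p‖ < 1 := hu.spacelike x (subset_closure hx)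
  have hKe : 8 * K * eps ≤ τ := by
    rw [le_div_iff₀ (by positivity)] at hleK; linarith
  have hRe : 10 * eps / R ≤ τ ^ 2 := by
    rw [div_le_iff₀ hR]; linarith
  have hxe : ‖x - z‖ ≤ eps := hxz.trans (by nlinarith)
  have habs : ∀ y : E n, |inner ℝ y m| ≤ ‖y‖ := fun y => by
    simpa [hm1] using abs_real_inner_le_norm y m
  -- Semiconcavity bounds `⟨Du, v⟩` below by a difference quotient with step `τε`. Height errors and
  -- the semiconcavity term are both of order `τ²ε`, leaving an error of order `τ`. The condition
  -- `⟨v, m⟩ ≥ τ` keeps the segment in `Ω` by the cone property.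
  have lower : ∀ v : E n, ‖v‖ ≤ 2 → τ ≤ inner ℝ v m → -(3 * τ) ≤ inner ℝ p v - β * inner ℝ v m := by
    intro v hv hvm
    have hnorm : ∀ t : ℝ, 0 ≤ t → t ≤ 1 → ‖x + t • (τ * eps) • v - z‖ ≤ 3 * eps := by
      intro t h0 h1
      calc ‖x + t • (τ * eps) • v - z‖ = ‖(x - z) + (t * (τ * eps)) • v‖ := by
            rw [smul_smul]; congr 1; abel
        _ ≤ ‖x - z‖ + ‖(t * (τ * eps)) • v‖ := norm_add_le _ _
        _ ≤ eps + 1 * (1 * eps) * 2 := by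
            rw [norm_smul, Real.norm_of_nonneg (by positivity)]; gcongr
        _ = 3 * eps := by ring
    have hmem : ∀ t : ℝ, 0 ≤ t → t ≤ 1 → x + t • (τ * eps) • v ∈ Ω := by
      intro t h0 h1
      refine hN.cone (4 * eps) (by linarith) x hx _ (by linarith) ((hnorm t h0 h1).trans (by linarith)) ?_
      rw [smul_smul, real_inner_smul_left, norm_smul, Real.norm_of_nonneg (by positivity)]
      calc K * (4 * eps) * (t * (τ * eps) * ‖v‖) ≤ K * (4 * eps) * (t * (τ * eps) * 2) := by gcongr
        _ = t * (τ * eps) * (8 * K * eps) := by ring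
        _ ≤ t * (τ * eps) * inner ℝ v m := by gcongr; linarith
    have hmem1 := hmem 1 zero_le_one le_rfl
    have hnorm1 := hnorm 1 zero_le_one le_rfl
    rw [one_smul] at hmem1 hnorm1
    have h1 := hu.le_quadratic hf hΩ hb hsig heps (subset_closure hmem1)
      (fun t h0 h1 => hmem t h0 h1.le)
    have h2 := hu.height_ge hf hΩ hb hsig heps hR htz (subset_closure hmem1)
    have h3 := hu.height_le hf hΩ hb hsig heps hR heR htz (subset_closure hx)
    have e1 : inner ℝ (x + (τ * eps) • v - z) m = inner ℝ (x - z) m + τ * eps * inner ℝ v m := by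
      rw [show x + (τ * eps) • v - z = (x - z) + (τ * eps) • v by abel, inner_add_left,
        real_inner_smul_left]
    set a := inner ℝ (x - z) m with ha
    set b := inner ℝ (x + (τ * eps) • v - z) m with hb'
    have hA : |a| ≤ eps := (habs _).trans hxe
    have hB : |b| ≤ 3 * eps := (habs _).trans hnorm1
    rw [inner_smul_right, norm_smul, Real.norm_of_nonneg (show 0 ≤ τ * eps by positivity)] at h1
    have h4 : (τ * eps * ‖v‖) ^ 2 / (2 * eps) ≤ 2 * τ ^ 2 * eps := by
      rw [div_le_iff₀ (by positivity)]
      calc (τ * eps * ‖v‖) ^ 2 ≤ (τ * eps * 2) ^ 2 := by gcongr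
        _ = _ := by ring
    have h5 : ‖x + (τ * eps) • v - z‖ ^ 2 / (2 * R) ≤ 9 * eps ^ 2 / (2 * R) := by
      gcongr
      calc ‖x + (τ * eps) • v - z‖ ^ 2 ≤ (3 * eps) ^ 2 := by gcongr
        _ = _ := by ring
    have h6 : ‖x - z‖ ^ 2 / (2 * R) ≤ eps ^ 2 / (2 * R) := by gcongr
    have h7 : 9 * eps ^ 2 / (2 * R) + eps ^ 2 / (2 * R) = eps * (10 * eps / R) / 2 := by
      field_simp; ring
    have h8 : eps * (10 * eps / R) ≤ eps * τ ^ 2 := by gcongr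
    have h9 : |(lo - β) * b| ≤ τ ^ 2 / 8 * (3 * eps) := by rw [abs_mul]; gcongr
    have h10 : |(hi - β) * a| ≤ τ ^ 2 / 8 * eps := by rw [abs_mul]; gcongr
    have h9' := (abs_le.1 h9).1
    have h10' := (abs_le.1 h10).2
    have h11 : β * b = β * a + β * (τ * eps * inner ℝ v m) := by rw [e1]; ring
    have h12 : 0 ≤ (τ * eps) * (inner ℝ p v - β * inner ℝ v m + 3 * τ) := by nlinarith
    have := nonneg_of_mul_nonneg_right h12 (by positivity)
    linarith
  have hn := lower m (by rw [hm1]; norm_num) (by rw [hmm]; exact hτ1)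
  rw [hmm, mul_one] at hn
  refine ⟨abs_le.2 ⟨by linarith, ?_⟩, fun e he he1' => ?_⟩
  · -- the upper bound, by following the inner normal backwards to the boundary
    have hT : x + (2 * τ * eps) • (-m) ∉ Ω := by
      intro hmem
      have h1 := htz.exterior _ hmem
      rw [dist_eq_norm] at h1
      have h2 : ‖x + (2 * τ * eps) • (-m) - (z - R • m)‖ ≤ τ * eps + (R - 2 * τ * eps) := by
        calc ‖x + (2 * τ * eps) • (-m) - (z - R • m)‖ = ‖(x - z) + (R - 2 * τ * eps) • m‖ := by
              congr 1; module
          _ ≤ ‖x - z‖ + ‖(R - 2 * τ * eps) • m‖ := norm_add_le _ _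
          _ ≤ _ := by
              rw [norm_smul, hm1, mul_one, Real.norm_of_nonneg (by nlinarith)]
              gcongr
      nlinarith [mul_pos hτ heps]
    obtain ⟨t, ht0, htT, htf, htin⟩ := exists_first_exit hΩ hx (by positivity) hT
    set z1 := x + t • (-m) with hz1
    have hxz1 : x - z1 = t • m := by rw [hz1]; module
    have htn := hN.touching z1 htf (by
      calc ‖z1 - z‖ = ‖(x - z) - t • m‖ := by rw [← hxz1]; congr 1; abel
        _ ≤ ‖x - z‖ + ‖t • m‖ := norm_sub_le _ _
        _ ≤ eps + 2 * 1 * eps := by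
            rw [norm_smul, hm1, mul_one, Real.norm_of_nonneg ht0.le]
            gcongr
            exact htT.trans (by gcongr)
        _ ≤ r0 := by linarith)
    have h1 := hu.le_quadratic hf hΩ hb hsig heps (v := t • (-m)) (frontier_subset_closure htf)
      (fun s h0 h1 => by
        rw [smul_smul]
        exact htin _ (by positivity) (by nlinarith))
    have h2 := hu.height_le hf hΩ hb hsig heps hR heR htn (subset_closure hx)
    rw [← hz1, hu.bdry z1 htf, inner_smul_right, inner_neg_right, norm_smul, norm_neg, hm1, mul_one,
      Real.norm_of_nonneg ht0.le] at h1
    rw [hxz1, real_inner_smul_left, norm_smul, hm1, mul_one, Real.norm_of_nonneg ht0.le] at h2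
    have h3 : inner ℝ m (N z1) ≤ 1 := by
      have := real_inner_le_norm m (N z1)
      rwa [hm1, htn.unit, mul_one] at this
    have hβ0 := slope_pos hsig
    have hβ1 := slope_lt_one hsig
    have hhi' := abs_le.1 hhi
    have hlo' := abs_le.1 hlo
    have hhi0 : 0 ≤ hi := slopeHi_nonneg hsig hR.le heps
    have h4 : hi * (t * inner ℝ m (N z1)) ≤ hi * (t * 1) := by gcongr
    have h5 : t * inner ℝ p m ≤ t * (hi + t / (2 * R) + t / (2 * eps)) := by
      have e1 : t * (hi + t / (2 * R) + t / (2 * eps)) = hi * (t * 1) + t ^ 2 / (2 * R)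
        + t ^ 2 / (2 * eps) := by ring
      rw [e1]; linarith
    have h6 := le_of_mul_le_mul_left h5 ht0
    have h7 : t / (2 * eps) ≤ τ := by rw [div_le_iff₀ (by positivity)]; linarith
    have h8 : t / (2 * R) ≤ τ / 2 := by
      rw [div_le_iff₀ (by positivity)]; nlinarith
    have h9 : τ ^ 2 ≤ τ := by nlinarith
    linarith
  -- Tilting `e` by `τ m` makes `lower` applicable and costs another multiple of `τ`; both signs of
  -- `e` are then used.
  · have hside : ∀ e, inner ℝ e m = 0 → ‖e‖ ≤ 1 → -(5 * τ) ≤ inner ℝ p e := by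
      intro e he he1
      have h1 := lower (e + τ • m) (by
          calc ‖e + τ • m‖ ≤ ‖e‖ + ‖τ • m‖ := norm_add_le _ _
            _ ≤ 1 + 1 := by rw [norm_smul, hm1, mul_one, Real.norm_of_nonneg hτ.le]; gcongr
            _ = 2 := by norm_num) (by rw [inner_add_left, real_inner_smul_left, he, hmm]; linarith)
      rw [inner_add_left, real_inner_smul_left, he, hmm, inner_add_right, inner_smul_right] at h1
      have h2 := (abs_le.1 ((abs_real_inner_le_norm p m).trans (by rw [hm1, mul_one]))).2
      have hβ0 := slope_pos hsig
      nlinarith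
    have h1 := hside e he he1'
    have h2 := hside (-e) (by rw [inner_neg_left, he, neg_zero]) (by rwa [norm_neg])
    rw [inner_neg_right] at h2
    exact abs_le.2 ⟨h1, by linarith⟩

/-- The estimates for `w` that hold when the gradient is close to `β n`. -/
lemma exists_wFun_bounds {sig : ℝ} (hsig : 1 < sig) : ∃ η c : ℝ, 0 < η ∧ 0 < c ∧ c ≤ 1 ∧
    ∀ s q : ℝ, |s - slope sig| ≤ η → |q| ≤ η →
      1 / (2 * sig) ≤ √(1 - (s ^ 2 + q)) ∧ sig * (1 - s) ≤ (1 - c) * √(1 - (s ^ 2 + q)) := by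
  set β := slope sig with hβ
  have hβ0 := slope_pos hsig
  have hβ2 := slope_sq hsig
  have hw : √(1 - (β ^ 2 + 0)) = 1 / sig := by
    rw [hβ2, show 1 - (1 - 1 / sig ^ 2 + 0) = (1 / sig) ^ 2 by ring, Real.sqrt_sq (by positivity)]
  -- At the limit `s = β`, `w = 1/σ`, the identity `(1-β)(1+β) = 1/σ²` gives `σ(1-β) = w/(1+β)`.
  -- Replacing `β` by `β/2` makes the inequality strict, hence stable nearby.
  set c := 1 - 1 / (1 + β / 2) with hc
  have hc0 : 0 < c := by
    rw [hc, sub_pos, div_lt_one (by positivity)]; linarith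
  have hc1 : c ≤ 1 := by
    rw [hc]; have : 0 < 1 / (1 + β / 2) := by positivity
    linarith
  have hF : ContinuousAt (fun y : ℝ × ℝ => √(1 - (y.1 ^ 2 + y.2))) (β, 0) := by fun_prop
  have hG : ContinuousAt (fun y : ℝ × ℝ => (1 - c) * √(1 - (y.1 ^ 2 + y.2)) - sig * (1 - y.1)) (β, 0) := by
    fun_prop
  have h1 : ∀ᶠ y : ℝ × ℝ in 𝓝 (β, 0), 1 / (2 * sig) < √(1 - (y.1 ^ 2 + y.2)) := by
    refine hF.eventually (lt_mem_nhds ?_)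
    show 1 / (2 * sig) < √(1 - (β ^ 2 + 0))
    rw [hw]
    apply one_div_lt_one_div_of_lt <;> linarith
  have h2 : ∀ᶠ y : ℝ × ℝ in 𝓝 (β, 0), 0 < (1 - c) * √(1 - (y.1 ^ 2 + y.2)) - sig * (1 - y.1) := by
    refine hG.eventually (lt_mem_nhds ?_)
    show 0 < (1 - c) * √(1 - (β ^ 2 + 0)) - sig * (1 - β)
    rw [hw, hc, sub_sub_cancel]
    have e1 : sig * (1 - β) = 1 / (1 + β) * (1 / sig) := by
      have : (1 - β) * (1 + β) = 1 / sig ^ 2 := by linarith [hβ2]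
      field_simp
      field_simp at this
      rw [eq_div_iff (by positivity)]
      linarith
    rw [e1, ← sub_mul]
    refine mul_pos (sub_pos.2 ?_) (by positivity)
    apply one_div_lt_one_div_of_lt <;> linarith
  obtain ⟨d, hd, h⟩ := Metric.eventually_nhds_iff.1 (h1.and h2)
  refine ⟨d / 2, c, by positivity, hc0, hc1, fun s q hs hq => ?_⟩
  have := h (y := (s, q)) (by
    rw [Prod.dist_eq, Real.dist_eq, Real.dist_eq, sub_zero]
    exact max_lt (by linarith) (by linarith))
  exact ⟨this.1.le, by linarith [this.2]⟩

/-- Near a boundary point, at the scale `ε`, the equation is uniformly spacelike and the barrier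
inequality is strict. -/
theorem exists_grad_near {f : E n → ℝ} (hf : IsCurvatureFunction f) {Ω : Set (E n)} (hΩ : IsOpen Ω)
    (hb : Bornology.IsBounded Ω) {sig : ℝ} (hsig : 1 < sig) {R K r0 : ℝ} (hR : 0 < R) (hK : 0 < K)
    (hr0 : 0 < r0) :
    ∃ τ c e1 : ℝ, 0 < τ ∧ 0 < c ∧ c ≤ 1 ∧ 0 < e1 ∧ ∀ eps, 0 < eps → eps ≤ e1 → ∀ u,
      IsAdmissibleSolution f Ω sig eps u →
      ∀ z ∈ frontier Ω, ∀ N, NormalField Ω R K r0 z N → ∀ x ∈ closure Ω, ‖x - z‖ < τ * eps →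
        1 / (2 * sig) ≤ wFun (grad u x) ∧
        sig * (1 - inner ℝ (grad u x) (N z)) ≤ (1 - c) * wFun (grad u x) := by
  obtain ⟨η, c, hη, hc, hc1, H⟩ := exists_wFun_bounds hsig
  set τ := min 1 (η / 5) with hτ
  have hτ0 : 0 < τ := by positivity
  have hτη : 5 * τ ≤ η := by
    have : τ ≤ η / 5 := min_le_right _ _
    linarith
  obtain ⟨e1, he1, hgrad⟩ := grad_near_interior hf hΩ hb hsig hR hK hr0 hτ0 (min_le_left _ _)
  refine ⟨τ, c, e1, hτ0, hc, hc1, he1, fun eps heps hle u hu z hz N hN x hx hxz => ?_⟩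
  have hint : ∀ y ∈ Ω, ‖y - z‖ < τ * eps → 1 / (2 * sig) ≤ wFun (grad u y) ∧
      sig * (1 - inner ℝ (grad u y) (N z)) ≤ (1 - c) * wFun (grad u y) := by
    intro y hy hyz
    obtain ⟨h1, h2⟩ := hgrad eps heps hle u hu z hz N hN y hy hyz.le
    set p := grad u y with hp
    set m := N z with hm
    have hm1 : ‖m‖ = 1 := (hN.touching z hz (by rw [sub_self, norm_zero]; exact hr0.le)).unit
    have hmm : inner ℝ m m = (1 : ℝ) := by rw [real_inner_self_eq_norm_sq, hm1]; norm_num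
    have hp1 : ‖p‖ < 1 := hu.spacelike y (subset_closure hy)
    set e := p - (inner ℝ p m : ℝ) • m with he
    have hem : inner ℝ e m = 0 := by
      rw [he, inner_sub_left, real_inner_smul_left, hmm]; ring
    have hee : ‖e‖ ^ 2 = ‖p‖ ^ 2 - inner ℝ p m ^ 2 := by
      rw [he, norm_sub_sq_real, inner_smul_right, norm_smul, hm1, mul_one, Real.norm_eq_abs, sq_abs]
      ring
    have hpe : inner ℝ p e = ‖e‖ ^ 2 := by
      rw [hee, he, inner_sub_right, inner_smul_right, real_inner_self_eq_norm_sq]; ring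
    have he1 : ‖e‖ ≤ 1 := by
      have : ‖e‖ ^ 2 ≤ 1 := by rw [hee]; nlinarith [sq_nonneg (inner ℝ p m), norm_nonneg p]
      nlinarith [norm_nonneg e]
    have h3 := h2 e hem he1
    have h4 := H (inner ℝ p m) (‖e‖ ^ 2) (h1.trans (by linarith)) (by rw [← hpe]; linarith)
    rwa [hee, add_sub_cancel] at h4
  -- The inequalities are closed conditions and `Du` is continuous up to the boundary, so they pass
  -- from `Ω` to its closure.
  have hne : (𝓝[Ω] x).NeBot := mem_closure_iff_nhdsWithin_neBot.1 hx
  have hgc : ContinuousAt (grad u) x := by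
    have hu2 := hu.contDiffAt_nat hx 2
    have : ContDiffAt ℝ 1 (grad u) x := by
      unfold grad
      rw [contDiffAt_euclidean]
      exact fun i => contDiffAt_pd i (m := 1) (hu2.of_le (by norm_num))
    exact this.continuousAt
  have hwc : ContinuousAt (fun y => wFun (grad u y)) x := by
    unfold wFun; fun_prop
  have hev : ∀ᶠ y in 𝓝[Ω] x, 1 / (2 * sig) ≤ wFun (grad u y) ∧
      sig * (1 - inner ℝ (grad u y) (N z)) ≤ (1 - c) * wFun (grad u y) := by
    have h1 : ∀ᶠ y in 𝓝[Ω] x, ‖y - z‖ < τ * eps := by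
      have : ContinuousAt (fun y : E n => ‖y - z‖) x := by fun_prop
      exact (this.eventually (gt_mem_nhds hxz)).filter_mono nhdsWithin_le_nhds
    filter_upwards [h1, self_mem_nhdsWithin] with y h2 h3 using hint y h3 h2
  have hwt : Tendsto (fun y => wFun (grad u y)) (𝓝[Ω] x) (𝓝 (wFun (grad u x))) :=
    hwc.tendsto.mono_left nhdsWithin_le_nhds
  have hgt : Tendsto (fun y => sig * (1 - inner ℝ (grad u y) (N z))) (𝓝[Ω] x)
      (𝓝 (sig * (1 - inner ℝ (grad u x) (N z)))) := by
    have : ContinuousAt (fun y => sig * (1 - inner ℝ (grad u y) (N z))) x := by fun_prop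
    exact this.tendsto.mono_left nhdsWithin_le_nhds
  exact ⟨ge_of_tendsto hwt (hev.mono fun y hy => hy.1),
    le_of_tendsto_of_tendsto hgt (hwt.const_mul (1 - c)) (hev.mono fun y hy => hy.2)⟩

end DeSitter

end

noncomputable section

namespace DeSitter
open Matrix Filter Topology

variable {n : ℕ}

/-! ### Jets of the comparison functions -/

lemma hasJet_inner_sub (z x a : E n) :
    HasJet (fun y : E n => inner ℝ (y - z) a) x (inner ℝ (x - z) a) a.ofLp 0 := by
  have h := HasJet.sum Finset.univ fun k => (hasJet_coord_sub z x k).const_mul (a k)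
  have e : ∀ y : E n, ∑ k, a k * (y k - z k) = inner ℝ (y - z) a := fun y => by
    rw [inner_eq_dotProduct]
    exact Finset.sum_congr rfl fun k _ => by simp [mul_comm]
  simp only [e, smul_zero, Finset.sum_const_zero] at h
  convert h using 1
  ext i
  simp [Finset.sum_apply, Pi.single_apply]

lemma HasJet.hasDerivAt_line {φ : E n → ℝ} {x : E n} {c : ℝ} {d : Fin n → ℝ}
    {H : Matrix (Fin n) (Fin n) ℝ} (h : HasJet φ x c d H) (v : E n) :
    HasDerivAt (fun t : ℝ => φ (x + t • v)) (d ⬝ᵥ v.ofLp) 0 := by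
  have h1 := DeSitter.hasDerivAt_line (g := φ) (x := x) (v := v) (t := 0)
    (by rw [zero_smul, add_zero]; exact h.smooth.differentiableAt (by norm_num))
  rw [zero_smul, add_zero, fderiv_apply_eq_sum] at h1
  convert h1 using 1
  simp only [dotProduct]
  exact Finset.sum_congr rfl fun i _ => by rw [← h.grad i, mul_comm]

/-- The infinitesimal rotation mixing the directions `m` and `ξ`, translated by `e`. -/
def rotField (e m xi z y : E n) : E n :=
  e + (inner ℝ (y - z) xi : ℝ) • m - (inner ℝ (y - z) m : ℝ) • xi

/-- The barrier for the mixed second derivatives. -/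
def barrier (K eps : ℝ) (z m : E n) (u : E n → ℝ) (y : E n) : ℝ :=
  K * (inner ℝ (y - z) m - u y + eps) + 1 / eps * (‖y - z‖ ^ 2 - u y ^ 2 + eps ^ 2)

namespace IsAdmissibleSolution

variable {f : E n → ℝ} {Ω : Set (E n)} {sig eps : ℝ} {u : E n → ℝ}

lemma hasJet (hu : IsAdmissibleSolution f Ω sig eps u) {x : E n} (hx : x ∈ closure Ω) :
    HasJet u x (u x) (grad u x).ofLp (hess u x) :=
  ContDiffAt.hasJet (hu.contDiffAt_nat hx 2)

lemma hasJet_pd (hu : IsAdmissibleSolution f Ω sig eps u) {x : E n} (hx : x ∈ closure Ω)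
    (k : Fin n) : HasJet (pd k u) x (grad u x k) (hess u x k) (hess (pd k u) x) :=
  ContDiffAt.hasJet (contDiffAt_pd k (m := 2) (hu.contDiffAt_nat hx 3))

lemma exists_hasJet_wFun (hu : IsAdmissibleSolution f Ω sig eps u) {x : E n} (hx : x ∈ closure Ω) :
    ∃ dw Hw, HasJet (fun y => wFun (grad u y)) x (wFun (grad u x)) dw Hw ∧
      wFun (grad u x) • dw = -(∑ k, grad u x k • hess u x k) ∧
      wFun (grad u x) • Hw = -(∑ k, (grad u x k • hess (pd k u) x
        + vecMulVec (hess u x k) (hess u x k))) - vecMulVec dw dw := by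
  have h := (HasJet.const 1 x).sub
    (HasJet.sum Finset.univ fun k => (hu.hasJet_pd hx k).mul (hu.hasJet_pd hx k))
  have e : ∀ y : E n, √(1 - ∑ k, pd k u y * pd k u y) = wFun (grad u y) := fun y => by
    rw [wFun, EuclideanSpace.real_norm_sq_eq]
    congr 2
    exact Finset.sum_congr rfl fun k _ => by rw [grad, sq]
  have e' : √(1 - ∑ k, grad u x k * grad u x k) = wFun (grad u x) := e x
  have hw := wFun_pos (hu.spacelike x hx)
  obtain ⟨dw, Hw, h1, h2, h3⟩ := h.sqrt (Real.sqrt_pos.1 (by rw [e']; exact hw))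
  rw [e'] at h1 h2 h3
  simp only [e] at h1
  refine ⟨dw, Hw, h1, ?_, ?_⟩
  · have : (2 : ℝ) • (wFun (grad u x) • dw) = (2 : ℝ) • -(∑ k, grad u x k • hess u x k) := by
      rw [smul_smul, ← h2, zero_sub, smul_neg, ← Finset.sum_add_distrib.symm.trans rfl]
      simp only [← two_smul ℝ (_ : Fin n → ℝ), Finset.smul_sum, Finset.sum_add_distrib]
    exact smul_right_injective _ (two_ne_zero' ℝ) this
  · have : (2 : ℝ) • (wFun (grad u x) • Hw) = (2 : ℝ) • (-(∑ k, (grad u x k • hess (pd k u) x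
        + vecMulVec (hess u x k) (hess u x k))) - vecMulVec dw dw) := by
      rw [smul_smul, smul_sub, eq_sub_iff_add_eq, ← h3, zero_sub, smul_neg, Finset.smul_sum]
      congr 1
      exact Finset.sum_congr rfl fun k _ => by module
    exact smul_right_injective _ (two_ne_zero' ℝ) this

/-- The coefficients of the field are affine with skew derivative `m ξᵀ - ξ mᵀ`; the jet is recorded
in the shape consumed by `linOp_antisymm`. -/
lemma hasJet_rotation (hu : IsAdmissibleSolution f Ω sig eps u) {x : E n} (hx : x ∈ closure Ω)
    (e m xi z : E n) :
    HasJet (fun y => inner ℝ (rotField e m xi z y) (grad u y)) x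
      (∑ k, rotField e m xi z x k * grad u x k)
      (∑ k, (rotField e m xi z x k • hess u x k
        + grad u x k • (vecMulVec m.ofLp xi.ofLp - vecMulVec xi.ofLp m.ofLp) k))
      (∑ k, (rotField e m xi z x k • hess (pd k u) x
        + grad u x k • (0 : Matrix (Fin n) (Fin n) ℝ)
        + vecMulVec ((vecMulVec m.ofLp xi.ofLp - vecMulVec xi.ofLp m.ofLp) k) (hess u x k)
        + vecMulVec (hess u x k) ((vecMulVec m.ofLp xi.ofLp - vecMulVec xi.ofLp m.ofLp) k))) := by
  have hc : ∀ k, HasJet (fun y => rotField e m xi z y k) x (rotField e m xi z x k)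
      ((vecMulVec m.ofLp xi.ofLp - vecMulVec xi.ofLp m.ofLp) k) 0 := by
    intro k
    have h := ((HasJet.const (e k) x).add ((hasJet_inner_sub z x xi).const_mul (m k))).sub
      ((hasJet_inner_sub z x m).const_mul (xi k))
    have e1 : ∀ y : E n, e k + m k * inner ℝ (y - z) xi - xi k * inner ℝ (y - z) m
        = rotField e m xi z y k := fun y => by simp [rotField, mul_comm]
    simp only [e1] at h
    convert h using 1
    · ext i; simp [vecMulVec_apply]
    · simp
  have h := HasJet.sum Finset.univ fun k => (hc k).mul (hu.hasJet_pd hx k)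
  have e2 : ∀ y : E n, ∑ k, rotField e m xi z y k * pd k u y
      = inner ℝ (rotField e m xi z y) (grad u y) := fun y => by
    rw [inner_eq_dotProduct]; rfl
  simp only [e2] at h
  exact h

lemma hasJet_dilation (hu : IsAdmissibleSolution f Ω sig eps u) {x : E n} (hx : x ∈ closure Ω)
    (z : E n) :
    HasJet (fun y => u y - inner ℝ (y - z) (grad u y)) x (u x - ∑ k, (x - z) k * grad u x k)
      ((grad u x).ofLp - ∑ k, ((x - z) k • hess u x k
        + grad u x k • (1 : Matrix (Fin n) (Fin n) ℝ) k))
      (hess u x - ∑ k, ((x - z) k • hess (pd k u) x + grad u x k • (0 : Matrix (Fin n) (Fin n) ℝ)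
        + vecMulVec ((1 : Matrix (Fin n) (Fin n) ℝ) k) (hess u x k)
        + vecMulVec (hess u x k) ((1 : Matrix (Fin n) (Fin n) ℝ) k))) := by
  have hc : ∀ k, HasJet (fun y : E n => (y - z) k) x ((x - z) k)
      ((1 : Matrix (Fin n) (Fin n) ℝ) k) 0 := by
    intro k
    have := hasJet_coord_sub z x k
    rwa [show (Pi.single k 1 : Fin n → ℝ) = (1 : Matrix (Fin n) (Fin n) ℝ) k from by
      ext i; simp [Matrix.one_apply, Pi.single_apply, eq_comm]] at this
  have h := (hu.hasJet hx).sub (HasJet.sum Finset.univ fun k => (hc k).mul (hu.hasJet_pd hx k))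
  have e2 : ∀ y : E n, ∑ k, (y - z) k * pd k u y = inner ℝ (y - z) (grad u y) := fun y => by
    rw [inner_eq_dotProduct]; rfl
  simp only [e2] at h
  exact h

lemma hasJet_barrier (hu : IsAdmissibleSolution f Ω sig eps u) {x : E n} (hx : x ∈ closure Ω)
    (K : ℝ) (z m : E n) :
    HasJet (barrier K eps z m u) x (barrier K eps z m u x)
      (K • (m.ofLp - (grad u x).ofLp) + (2 / eps) • ((x - z).ofLp - u x • (grad u x).ofLp))
      (-(K • hess u x) + (2 / eps) • (1 - vecMulVec (grad u x).ofLp (grad u x).ofLp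
        - u x • hess u x)) := by
  have h1 := (((hasJet_inner_sub z x m).sub (hu.hasJet hx)).add (HasJet.const eps x)).const_mul K
  have h2 := ((hasJet_normSq_sub_sq z (hu.contDiffAt_nat hx 2)).add
    (HasJet.const (eps ^ 2) x)).const_mul (1 / eps)
  have h := h1.add h2
  convert h using 1
  · rfl
  · rfl
  · rw [add_zero, add_zero, smul_smul, one_div_mul_eq_div]
  · rw [add_zero, add_zero, smul_smul, one_div_mul_eq_div, zero_sub, smul_neg]
    rfl

end IsAdmissibleSolution

end DeSitter

end

noncomputable section

namespace DeSitter
open Matrix Filter Topology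

variable {n : ℕ}

/-! ### The mixed second derivatives at the boundary -/

lemma LinData.linOp_nonpos {sig z w : ℝ} {p : Fin n → ℝ} {U a e : Matrix (Fin n) (Fin n) ℝ}
    {D : Fin n → Matrix (Fin n) (Fin n) ℝ} (h : LinData sig z p w U a e D)
    {H : Matrix (Fin n) (Fin n) ℝ} (hH : H.PosSemidef) : linOp sig z p w U a e 0 0 H ≤ 0 := by
  have := mul_nonneg h.z_pos.le (trace_mul_nonneg_of_posSemidef h.a_psd hH)
  simp only [linOp, mulVec_zero, dotProduct_zero, zero_mul, mul_zero]
  linarith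

lemma norm_rotField_le {e m xi z y : E n} {K : ℝ} (he : ‖e‖ ≤ 1) (hm : ‖m‖ = 1) (hxi : ‖xi‖ ≤ K) :
    ‖rotField e m xi z y‖ ≤ 1 + 2 * K * ‖y - z‖ := by
  have h1 : ‖(inner ℝ (y - z) xi : ℝ) • m‖ ≤ ‖y - z‖ * K := by
    rw [norm_smul, hm, mul_one]
    exact (norm_inner_le_norm _ _).trans (by gcongr)
  have h2 : ‖(inner ℝ (y - z) m : ℝ) • xi‖ ≤ ‖y - z‖ * 1 * K := by
    rw [norm_smul]
    gcongr
    exact (norm_inner_le_norm _ _).trans (by rw [hm])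
  calc ‖rotField e m xi z y‖ ≤ ‖e + (inner ℝ (y - z) xi : ℝ) • m‖ + ‖(inner ℝ (y - z) m : ℝ) • xi‖ :=
        norm_sub_le _ _
    _ ≤ ‖e‖ + ‖(inner ℝ (y - z) xi : ℝ) • m‖ + ‖(inner ℝ (y - z) m : ℝ) • xi‖ := by
        gcongr; exact norm_add_le _ _
    _ ≤ 1 + ‖y - z‖ * K + ‖y - z‖ * 1 * K := by gcongr
    _ = _ := by ring

namespace IsAdmissibleSolution

variable {f : E n → ℝ} {Ω : Set (E n)} {sig eps : ℝ} {u : E n → ℝ}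

/-- Comparison of a function with the dilation field, which is a positive solution of the linearized
equation: if `a w b + s T` is nonnegative on the boundary of `D`, then it is nonnegative in `D`. -/
lemma rotation_comparison (hf : IsCurvatureFunction f) (hΩ : IsOpen Ω) (hb : Bornology.IsBounded Ω)
    (hu : IsAdmissibleSolution f Ω sig eps u) {z m e xi : E n} {K ρ A s : ℝ} (hA : 0 < A)
    (hK : 0 ≤ K)
    (hbar : ∀ x ∈ closure Ω, ‖x - z‖ ≤ ρ → 0 ≤ barrier K eps z m u x)
    (hdil : ∀ x ∈ closure Ω, ‖x - z‖ ≤ ρ → 0 < u x - inner ℝ (x - z) (grad u x))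
    (hop : ∀ x ∈ Ω, ‖x - z‖ ≤ ρ →
      0 < -(barrier K eps z m u x * sig / (u x * wFun (grad u x)))
        + K * (1 - sig / wFun (grad u x) * (1 - inner ℝ (grad u x) m))
        - 2 * sig / (wFun (grad u x) * eps) * (u x - inner ℝ (x - z) (grad u x)))
    (hfr : ∀ x ∈ frontier Ω, ‖x - z‖ ≤ ρ →
      0 ≤ A * (wFun (grad u x) * barrier K eps z m u x)
        + s * inner ℝ (rotField e m xi z x) (grad u x))
    (hsp : ∀ x ∈ Ω, ‖x - z‖ = ρ →
      0 ≤ A * (wFun (grad u x) * barrier K eps z m u x)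
        + s * inner ℝ (rotField e m xi z x) (grad u x)) :
    ∀ x ∈ closure Ω, ‖x - z‖ ≤ ρ →
      0 ≤ A * (wFun (grad u x) * barrier K eps z m u x)
        + s * inner ℝ (rotField e m xi z x) (grad u x) := by
  set G : E n → ℝ := fun x => A * (wFun (grad u x) * barrier K eps z m u x)
        + s * inner ℝ (rotField e m xi z x) (grad u x) with hG
  set S : E n → ℝ := fun x => u x - inner ℝ (x - z) (grad u x) with hS
  set D : Set (E n) := closure Ω ∩ {x | ‖x - z‖ ≤ ρ} with hD
  have hDc : IsCompact D := hb.isCompact_closure.inter_right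
    (isClosed_le (by fun_prop) continuous_const)
  have hGjet : ∀ x ∈ closure Ω, ContinuousAt G x := by
    intro x hx
    obtain ⟨dw, Hw, h1, -, -⟩ := hu.exists_hasJet_wFun hx
    exact (((h1.mul (hu.hasJet_barrier hx K z m)).const_mul A).add
      ((hu.hasJet_rotation hx e m xi z).const_mul s)).smooth.continuousAt
  have hSjet : ∀ x ∈ closure Ω, ContinuousAt S x := fun x hx =>
    (hu.hasJet_dilation hx z).smooth.continuousAt
  intro x hx hxρ
  by_contra hneg
  push Not at hneg
  -- Dividing by the positive solution `S` removes the zeroth order term: at a negative minimum `q`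
  -- of the quotient, `G - q S` vanishes to first order with nonnegative Hessian.
  have hcont : ContinuousOn (fun x => G x / S x) D := fun y hy =>
    ((hGjet y hy.1).div (hSjet y hy.1) (hdil y hy.1 hy.2).ne').continuousWithinAt
  obtain ⟨x1, hx1, hmin⟩ := hDc.exists_isMinOn ⟨x, hx, hxρ⟩ hcont
  set q := G x1 / S x1 with hq
  have hq0 : q < 0 := lt_of_le_of_lt (hmin ⟨hx, hxρ⟩) (div_neg_of_neg_of_pos hneg (hdil x hx hxρ))
  have hS1 := hdil x1 hx1.1 hx1.2
  have hGq : G x1 = q * S x1 := by rw [hq, div_mul_cancel₀]; exact hS1.ne'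
  have hG1 : G x1 < 0 := by rw [hGq]; exact mul_neg_of_neg_of_pos hq0 hS1
  have hx1Ω : x1 ∈ Ω := by
    rcases mem_or_frontier hx1.1 with h | h
    · exact h
    · exact absurd (hfr x1 h hx1.2) (not_le.2 hG1)
  have hx1ρ : ‖x1 - z‖ < ρ := lt_of_le_of_ne hx1.2 fun h =>
    absurd (hsp x1 hx1Ω h) (not_le.2 hG1)
  have hloc : IsLocalMin (fun y => G y - q * S y) x1 := by
    have h1 : ∀ᶠ y in 𝓝 x1, ‖y - z‖ < ρ := by
      have : ContinuousAt (fun y : E n => ‖y - z‖) x1 := by fun_prop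
      exact this.eventually (gt_mem_nhds hx1ρ)
    filter_upwards [hΩ.mem_nhds hx1Ω, h1] with y hy hyρ
    have h2 : q ≤ G y / S y := hmin ⟨subset_closure hy, hyρ.le⟩
    rw [le_div_iff₀ (hdil y (subset_closure hy) hyρ.le)] at h2
    simp only [hGq, sub_self]
    linarith
  obtain ⟨a, e', hL⟩ := hu.exists_linData hf hΩ hx1Ω
  obtain ⟨dw, Hw, h1, h2, h3⟩ := hu.exists_hasJet_wFun hx1.1
  have hj1 := h1.mul (hu.hasJet_barrier hx1.1 K z m)
  have hj2 := hu.hasJet_rotation hx1.1 e m xi z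
  have hj3 := hu.hasJet_dilation hx1.1 z
  have hj := ((hj1.const_mul A).add (hj2.const_mul s)).sub (hj3.const_mul q)
  obtain ⟨hd0, hpsd⟩ := hj.of_isLocalMin hloc
  have hc0 := hj.val
  rw [show A * (wFun (grad u x1) * barrier K eps z m u x1)
        + s * inner ℝ (rotField e m xi z x1) (grad u x1)
        - q * (u x1 - inner ℝ (x1 - z) (grad u x1)) = 0 from by
      have := hGq; simp only [hG, hS] at this; linarith] at hc0
  -- The operator is nonpositive on this jet. The rotation and dilation parts contribute zero, while
  -- the barrier part is strictly positive.
  have hle := hL.linOp_nonpos hpsd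
  rw [← hd0] at hle
  nth_rewrite 1 [hc0] at hle
  rw [linOp_sub, linOp_add, linOp_smul, linOp_smul, linOp_smul] at hle
  have hr := hL.linOp_antisymm (rotField e m xi z x1).ofLp
    (M := vecMulVec m.ofLp xi.ofLp - vecMulVec xi.ofLp m.ofLp)
    (by rw [transpose_sub, transpose_vecMulVec, transpose_vecMulVec, neg_sub])
  have hdl := hL.linOp_dilation (x1 - z).ofLp
  have hba := hL.linOp_barrier_ge (eps := eps) (hbar x1 hx1.1 hx1.2) hK m.ofLp (x1 - z).ofLp h2 h3
  have hpos := hop x1 hx1Ω hx1.2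
  rw [inner_eq_dotProduct, inner_eq_dotProduct, dotProduct_comm (grad u x1).ofLp] at hpos
  have hpos' := lt_of_lt_of_le hpos hba
  have e1 := mul_pos hA hpos'
  erw [hr, hdl] at hle
  linarith

end IsAdmissibleSolution

end DeSitter

end

/-! ### The barrier at scale `ε` and the mixed derivative bound. -/

noncomputable section

namespace DeSitter
open Matrix Filter Topology

variable {n : ℕ}

lemma TouchingBalls.le_inner {Ω : Set (E n)} {R : ℝ} (hR : 0 < R) {z m x : E n}
    (h : TouchingBalls Ω R z m) (hx : x ∈ closure Ω) :
    -(‖x - z‖ ^ 2 / (2 * R)) ≤ inner ℝ (x - z) m := by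
  have h2 := h.exterior_closure hx
  rw [dist_eq_norm] at h2
  have e2 : ‖x - (z - R • m)‖ ^ 2 = ‖x - z‖ ^ 2 + 2 * R * inner ℝ (x - z) m + R ^ 2 := by
    rw [show x - (z - R • m) = (x - z) + R • m by abel, norm_add_sq_real, inner_smul_right,
      norm_smul, mul_pow, h.unit]
    simp; ring
  have h4 : R ^ 2 ≤ ‖x - (z - R • m)‖ ^ 2 := by gcongr
  rw [← neg_div, div_le_iff₀ (by positivity)]
  linarith

/-- Here `δ = u - ε`, `Y = |x - z|` and `yn` is the normal coordinate. The quadratic part in `u`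
costs at most `3δ`, and inserting the height bound for `δ` leaves the coefficient `K - (K+3) hi` of
`yn`. It is nonnegative for large `K` because the slope stays below `1`; the remaining multiples of
`Y²/R` are absorbed in half of `Y²/ε`. -/
lemma barrier_algebra {K eps R Y yn δ hi β' : ℝ} (heps : 0 < eps) (hR : 0 < R) (hK : 0 < K)
    (hKR : eps * (2 * K + 5) ≤ R) (hδ0 : 0 ≤ δ) (hδ1 : δ ≤ eps) (hhi : 0 ≤ hi) (hhi' : hi ≤ β')
    (hβ' : β' ≤ 1) (hKβ : 5 ≤ K * (1 - β')) (hyn : -(Y ^ 2 / (2 * R)) ≤ yn)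
    (hδ : δ ≤ hi * yn + Y ^ 2 / (2 * R)) :
    Y ^ 2 / (2 * eps) ≤ K * (yn - δ) + 1 / eps * (Y ^ 2 - δ * (δ + 2 * eps)) := by
  have hκ0 : 0 ≤ K - (K + 3) * hi := by
    have : K * (1 - β') ≤ K * (1 - hi) := by gcongr
    nlinarith
  have hκ1 : K - (K + 3) * hi ≤ K := by nlinarith
  have h1 : -(K * (Y ^ 2 / (2 * R))) ≤ (K - (K + 3) * hi) * yn := by
    have hq : 0 ≤ Y ^ 2 / (2 * R) := by positivity
    nlinarith
  have h2 : (K + 3) * δ ≤ (K + 3) * (hi * yn + Y ^ 2 / (2 * R)) := by gcongr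
  have h3 : 1 / eps * (δ * (δ + 2 * eps)) ≤ 3 * δ := by
    rw [one_div, inv_mul_le_iff₀ heps]; nlinarith
  have h4 : (2 * K + 3) * (Y ^ 2 / (2 * R)) ≤ Y ^ 2 / (2 * eps) := by
    rw [← mul_div_assoc, div_le_div_iff₀ (by positivity) (by positivity)]
    nlinarith [mul_nonneg (sq_nonneg Y) (sub_nonneg.2 hKR), mul_nonneg (sq_nonneg Y) heps.le]
  have h5 : 1 / eps * (Y ^ 2 - δ * (δ + 2 * eps)) = 2 * (Y ^ 2 / (2 * eps)) - 1 / eps * (δ * (δ + 2 * eps)) := by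
    field_simp
  rw [h5]
  linarith

/-- The gain is at least `K c`. The zeroth order loss is at most `K c/2 + 2σ²` by smallness of `r`,
and the dilation term at most `12σ²`; so `K c > 28σ²` is enough, and `46σ²` leaves room. -/
lemma barrier_operator_pos {sig c K r eps b z w S g : ℝ} (hsig : 1 < sig) (hc : 0 < c)
    (heps : 0 < eps) (hr : 0 < r) (hr1 : r ≤ 1) (hrc : 4 * sig ^ 2 * r ≤ c)
    (hK : 46 * sig ^ 2 ≤ K * c) (hb : b ≤ K * (r * eps) + r ^ 2 * eps) (hz : eps ≤ z)
    (hw : 1 / (2 * sig) ≤ w) (hg : sig * (1 - g) ≤ (1 - c) * w) (hS0 : 0 ≤ S) (hS : S ≤ 3 * eps) :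
    0 < -(b * sig / (z * w)) + K * (1 - sig / w * (1 - g)) - 2 * sig / (w * eps) * S := by
  have hs0 : 0 < sig := by linarith
  have hw0 : 0 < w := lt_of_lt_of_le (by positivity) hw
  have hK0 : 0 < K := by
    by_contra h; push Not at h
    nlinarith [mul_nonneg_of_nonpos_of_nonpos h (neg_nonpos.2 hc.le), sq_nonneg sig]
  have hwi : 1 / w ≤ 2 * sig := by
    rw [div_le_iff₀ hw0]; rw [div_le_iff₀ (by positivity)] at hw; linarith
  have h1 : b * sig / (z * w) ≤ (K * r + r ^ 2) * (2 * sig ^ 2) := by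
    calc b * sig / (z * w) = b * sig / z * (1 / w) := by field_simp
      _ ≤ (K * (r * eps) + r ^ 2 * eps) * sig / eps * (2 * sig) := by gcongr
      _ = _ := by field_simp
  have h2 : c ≤ 1 - sig / w * (1 - g) := by
    have : sig / w * (1 - g) ≤ 1 - c := by
      rw [div_mul_eq_mul_div, div_le_iff₀ hw0]; exact hg
    linarith
  have h3 : K * c ≤ K * (1 - sig / w * (1 - g)) := by gcongr
  have h4 : 2 * sig / (w * eps) * S ≤ 12 * sig ^ 2 := by
    calc 2 * sig / (w * eps) * S = 2 * sig * (1 / w) * (S / eps) := by field_simp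
      _ ≤ 2 * sig * (2 * sig) * (3 * eps / eps) := by gcongr
      _ = _ := by field_simp; ring
  have h5 : K * (4 * sig ^ 2 * r) ≤ K * c := by gcongr
  have h6 : r ^ 2 * (2 * sig ^ 2) ≤ 1 * (2 * sig ^ 2) := by
    gcongr; nlinarith
  have h7 : 0 < sig ^ 2 := by positivity
  nlinarith

/-- The comparison function vanishes at `z`, so its inner normal derivative there is nonnegative.
Since `Du` is parallel to `m` and `ξ` is orthogonal to `m`, the derivative of the rotating
coefficients drops out and `D²u(e, m)` remains, against at most `2K + 2` from `w b`. -/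
lemma IsAdmissibleSolution.mixed_le_of_comparison {f : E n → ℝ} {Ω : Set (E n)} {sig eps : ℝ}
    {u : E n → ℝ} (hu : IsAdmissibleSolution f Ω sig eps u) {z m e xi : E n} {R A K ρ s : ℝ}
    (hz : z ∈ frontier Ω) (heps : 0 < eps) (hR : 0 < R) (ht : TouchingBalls Ω R z m)
    (hgz : ∀ e, inner ℝ e m = 0 → inner ℝ (grad u z) e = 0)
    (he1' : inner ℝ e m = 0) (hxim : inner ℝ xi m = 0) (hA : 0 ≤ A) (hK : 0 ≤ K) (hρ : 0 < ρ)
    (hcmp : ∀ x ∈ closure Ω, ‖x - z‖ ≤ ρ →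
      0 ≤ A * (wFun (grad u x) * barrier K eps z m u x)
        + s * inner ℝ (rotField e m xi z x) (grad u x)) :
    0 ≤ A * (2 * K + 2) + s * (e.ofLp ⬝ᵥ hess u z *ᵥ m.ofLp) := by
  have hzc := frontier_subset_closure hz
  have hm1 := ht.unit
  obtain ⟨dw, Hw, h1, -, -⟩ := hu.exists_hasJet_wFun hzc
  have hj := ((h1.mul (hu.hasJet_barrier hzc K z m)).const_mul (A)).add
    ((hu.hasJet_rotation hzc e m xi z).const_mul s)
  have hbz : barrier K eps z m u z = 0 := by
    rw [barrier, hu.bdry z hz]; simp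
  have hrz : rotField e m xi z z = e := by rw [rotField]; simp
  have hd := deriv_nonneg_of_eventually_le (hj.hasDerivAt_line m) (by
    have e1 : ∀ᶠ t : ℝ in 𝓝[>] 0, t < min (ρ) (2 * R) :=
      nhdsWithin_le_nhds (gt_mem_nhds (by positivity))
    filter_upwards [e1, self_mem_nhdsWithin] with t ht1 ht0
    have ht0 : 0 < t := ht0
    rw [lt_min_iff] at ht1
    have e2 : inner ℝ e (grad u z) = 0 := by rw [real_inner_comm]; exact hgz e he1'
    simp only [zero_smul, add_zero, hbz, mul_zero, hrz, e2]
    refine hcmp _ (subset_closure (ht.interior ?_)) ?_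
    · rw [Metric.mem_ball, dist_eq_norm, show z + t • m - (z + R • m) = (t - R) • m by module,
        norm_smul, hm1, mul_one, Real.norm_eq_abs, abs_lt]
      constructor <;> linarith
    · rw [add_sub_cancel_left, norm_smul, hm1, mul_one, Real.norm_of_nonneg ht0.le]
      exact ht1.1.le)
  set p := grad u z with hp
  have hmm : m.ofLp ⬝ᵥ m.ofLp = 1 := by rw [dotProduct_self_eq, hm1]; norm_num
  have hpxi : p.ofLp ⬝ᵥ xi.ofLp = 0 := by rw [← inner_eq_dotProduct]; exact hgz xi hxim
  have hmxi : xi.ofLp ⬝ᵥ m.ofLp = 0 := by rw [← inner_eq_dotProduct]; exact hxim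
  have hpm : |p.ofLp ⬝ᵥ m.ofLp| ≤ 1 := by
    rw [← inner_eq_dotProduct]
    have := abs_real_inner_le_norm p m
    rw [hm1, mul_one] at this
    exact this.trans (hu.spacelike z hzc).le
  have e3 : (∑ k, (rotField e m xi z z k • hess u z k
      + p k • (vecMulVec m.ofLp xi.ofLp - vecMulVec xi.ofLp m.ofLp) k)) ⬝ᵥ m.ofLp
      = e.ofLp ⬝ᵥ hess u z *ᵥ m.ofLp := by
    rw [hrz]
    simp only [sum_dotProduct, add_dotProduct, smul_dotProduct, smul_eq_mul, Finset.sum_add_distrib]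
    have e4 : ∀ k, (vecMulVec m.ofLp xi.ofLp - vecMulVec xi.ofLp m.ofLp) k ⬝ᵥ m.ofLp = -xi k := by
      intro k
      have : (vecMulVec m.ofLp xi.ofLp - vecMulVec xi.ofLp m.ofLp) k
          = m k • xi.ofLp - xi k • m.ofLp := by
        ext i; simp [vecMulVec_apply]
      rw [this, sub_dotProduct, smul_dotProduct, smul_dotProduct, hmm, hmxi]
      simp
    simp only [e4]
    have e5 : ∑ k, p k * -xi k = -(p.ofLp ⬝ᵥ xi.ofLp) := by
      simp [dotProduct]
    rw [e5, hpxi, neg_zero, add_zero]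
    rfl
  rw [add_dotProduct, smul_dotProduct, smul_dotProduct, e3, hbz, zero_smul, add_zero,
    smul_dotProduct, sub_self, WithLp.ofLp_zero, zero_sub, add_dotProduct, smul_dotProduct,
    smul_dotProduct, neg_dotProduct, smul_dotProduct, sub_dotProduct, hmm, hu.bdry z hz] at hd
  simp only [smul_eq_mul] at hd
  have hw1 : wFun p ≤ 1 := by
    exact Real.sqrt_le_one.2 (by nlinarith [sq_nonneg ‖p‖])
  have hw0 : 0 ≤ wFun p := Real.sqrt_nonneg _
  have e6 : 2 / eps * -(eps * (p.ofLp ⬝ᵥ m.ofLp)) = -(2 * (p.ofLp ⬝ᵥ m.ofLp)) := by field_simp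
  rw [e6] at hd
  have hpm' := abs_le.1 hpm
  have e7 : wFun p * (K * (1 - p.ofLp ⬝ᵥ m.ofLp) + -(2 * (p.ofLp ⬝ᵥ m.ofLp))) ≤ 1 * (2 * K + 2) := by
    have : K * (1 - p.ofLp ⬝ᵥ m.ofLp) + -(2 * (p.ofLp ⬝ᵥ m.ofLp)) ≤ 2 * K + 2 := by nlinarith
    calc _ ≤ wFun p * (2 * K + 2) := by gcongr
      _ ≤ _ := by gcongr
  have e8 : A * (wFun p * (K * (1 - p.ofLp ⬝ᵥ m.ofLp) + -(2 * (p.ofLp ⬝ᵥ m.ofLp))))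
      ≤ A * (1 * (2 * K + 2)) := by gcongr
  rw [one_mul] at e8
  linarith

set_option maxHeartbeats 4000000 in
/-- The estimate of the mixed second derivatives. -/
theorem exists_mixed_bound {f : E n → ℝ} (hf : IsCurvatureFunction f) {Ω : Set (E n)}
    (hΩ : IsOpen Ω) (hb : Bornology.IsBounded Ω) {sig : ℝ} (hsig : 1 < sig) {R K0 r0 : ℝ}
    (hR : 0 < R) (hK0 : 0 < K0) (hr0 : 0 < r0) :
    ∃ C e1 : ℝ, 0 < e1 ∧ ∀ eps, 0 < eps → eps ≤ e1 → ∀ u, IsAdmissibleSolution f Ω sig eps u →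
      ∀ z ∈ frontier Ω, ∀ N, NormalField Ω R K0 r0 z N → ∀ e : E n, inner ℝ e (N z) = 0 → ‖e‖ ≤ 1 →
        eps * |e.ofLp ⬝ᵥ hess u z *ᵥ (N z).ofLp| ≤ C := by
  obtain ⟨τ, c, e1, hτ, hc, hc1, he1, hgrad⟩ := exists_grad_near hf hΩ hb hsig hR hK0 hr0
  have hβ0 := slope_pos hsig
  have hβ1 := slope_lt_one hsig
  set β := slope sig with hβ
  have hs0 : 0 < sig := by linarith
  obtain ⟨e2, he2, hslope⟩ := eventually_slope hsig hR (show 0 < (1 - β) / 2 by linarith)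
  -- The three bounds serve in turn the gradient estimate, the lower bound `ε/2` for the dilation
  -- solution, and the positivity of the operator on the barrier.
  set r := min (τ / 2) (min (1 / 2) (c / (4 * sig ^ 2))) with hr
  have hr0' : 0 < r := by positivity
  have hrτ : r ≤ τ / 2 := min_le_left _ _
  have hr1 : r ≤ 1 / 2 := (min_le_right _ _).trans (min_le_left _ _)
  have hrc : 4 * sig ^ 2 * r ≤ c := by
    have : r ≤ c / (4 * sig ^ 2) := (min_le_right _ _).trans (min_le_right _ _)
    rw [le_div_iff₀ (by positivity)] at this; linarith
  have h1β : 0 < 1 - β := by linarith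
  set K := 46 * sig ^ 2 / c + 10 / (1 - β) with hK
  have hKpos : 0 < K := by positivity
  have hKc : 46 * sig ^ 2 ≤ K * c := by
    have : 46 * sig ^ 2 / c ≤ K := by rw [hK]; have : 0 < 10 / (1 - β) := by positivity
                                      linarith
    rwa [div_le_iff₀ hc] at this
  have hKβ : 5 ≤ K * (1 - (1 + β) / 2) := by
    have : 10 / (1 - β) ≤ K := by rw [hK]; have : 0 < 46 * sig ^ 2 / c := by positivity
                                  linarith
    rw [div_le_iff₀ h1β] at this
    linarith
  -- The first term dominates the quadratic bound for the rotation derivative on `∂Ω`, the second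
  -- its bound by `2` on the sphere `|x - z| = rε`, where the barrier is of order `r² ε`.
  set C' := 4 * sig * K0 + 8 * sig / r ^ 2 with hC'
  have hC'0 : 0 < C' := by positivity
  refine ⟨C' * (2 * K + 2), min e1 (min e2 (min (R / (2 * K + 5)) (min r0 (min 1 (1 / (2 * K0)))))),
    by positivity, fun eps heps hle u hu z hz N hN e he1' he2' => ?_⟩
  simp only [le_min_iff] at hle
  obtain ⟨hle1, hle2, hleR, hler, hle1', hleK⟩ := hle
  have hKR : eps * (2 * K + 5) ≤ R := by rwa [le_div_iff₀ (by positivity)] at hleR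
  have heR : eps < R := by nlinarith
  have heK : 2 * K0 * eps ≤ 1 := by rw [le_div_iff₀ (by positivity)] at hleK; linarith
  obtain ⟨-, hhi⟩ := hslope eps heps hle2
  have hhi1 : slopeHi sig R eps ≤ (1 + β) / 2 := by linarith [(abs_le.1 hhi).2]
  have hhi0 := slopeHi_nonneg hsig hR.le heps
  set hi := slopeHi sig R eps with hhidef
  have ht := hN.touching z hz (by rw [sub_self, norm_zero]; exact hr0.le)
  obtain ⟨xi, hxim, hxin, hrot⟩ := hN.rotation e he1' he2'
  set m := N z with hm
  have hm1 : ‖m‖ = 1 := ht.unit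
  -- bounds at the scale `ε`
  have hρ : r * eps ≤ eps / 2 := by nlinarith
  have hheight : ∀ x ∈ closure Ω, ‖x - z‖ ≤ r * eps → 0 ≤ u x - eps ∧ u x - eps ≤ eps ∧
      u x - eps ≤ hi * inner ℝ (x - z) m + ‖x - z‖ ^ 2 / (2 * R) := by
    intro x hx hxρ
    have h1 := hu.height_le hf hΩ hb hsig heps hR heR ht hx
    have h2 := hu.eps_le hf hΩ hb hsig hx
    have h3 : inner ℝ (x - z) m ≤ ‖x - z‖ := by
      simpa [hm1] using real_inner_le_norm (x - z) m
    have h4 : hi * inner ℝ (x - z) m ≤ ‖x - z‖ := by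
      calc hi * inner ℝ (x - z) m ≤ hi * ‖x - z‖ := by gcongr
        _ ≤ 1 * ‖x - z‖ := by gcongr; linarith
        _ = _ := one_mul _
    have h5 : ‖x - z‖ ^ 2 / (2 * R) ≤ eps / 2 := by
      rw [div_le_iff₀ (by positivity)]
      nlinarith [norm_nonneg (x - z)]
    exact ⟨by linarith, by linarith, h1⟩
  have hbarge : ∀ x ∈ closure Ω, ‖x - z‖ ≤ r * eps → ‖x - z‖ ^ 2 / (2 * eps) ≤ barrier K eps z m u x := by
    intro x hx hxρ
    obtain ⟨h1, h2, h3⟩ := hheight x hx hxρ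
    have := barrier_algebra heps hR hKpos hKR h1 h2 hhi0 hhi1 (by linarith) hKβ
      (ht.le_inner hR hx) h3
    rw [barrier]
    convert this using 1
    ring
  have hbar0 : ∀ x ∈ closure Ω, ‖x - z‖ ≤ r * eps → 0 ≤ barrier K eps z m u x := fun x hx hxρ =>
    le_trans (by positivity) (hbarge x hx hxρ)
  have hpx : ∀ x ∈ closure Ω, |inner ℝ (x - z) (grad u x)| ≤ ‖x - z‖ := fun x hx =>
    (abs_real_inner_le_norm _ _).trans
      (mul_le_of_le_one_right (norm_nonneg _) (hu.spacelike x hx).le)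
  have hSlo : ∀ x ∈ closure Ω, ‖x - z‖ ≤ r * eps → eps / 2 ≤ u x - inner ℝ (x - z) (grad u x) := by
    intro x hx hxρ
    linarith [(hheight x hx hxρ).1, (abs_le.1 (hpx x hx)).2]
  have hShi : ∀ x ∈ closure Ω, ‖x - z‖ ≤ r * eps → u x - inner ℝ (x - z) (grad u x) ≤ 3 * eps := by
    intro x hx hxρ
    linarith [(hheight x hx hxρ).2.1, (abs_le.1 (hpx x hx)).1]
  have hg : ∀ x ∈ closure Ω, ‖x - z‖ ≤ r * eps → _ := fun x hx hxρ =>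
    hgrad eps heps hle1 u hu z hz N hN x hx (hxρ.trans_lt (by nlinarith))
  have hop : ∀ x ∈ Ω, ‖x - z‖ ≤ r * eps →
      0 < -(barrier K eps z m u x * sig / (u x * wFun (grad u x)))
        + K * (1 - sig / wFun (grad u x) * (1 - inner ℝ (grad u x) m))
        - 2 * sig / (wFun (grad u x) * eps) * (u x - inner ℝ (x - z) (grad u x)) := by
    intro x hx hxρ
    have hxc := subset_closure hx
    obtain ⟨hw, hg2⟩ := hg x hxc hxρ
    obtain ⟨h1, -, -⟩ := hheight x hxc hxρ
    refine barrier_operator_pos hsig hc heps hr0' (by linarith) hrc hKc ?_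
      (by linarith) hw hg2 (le_trans (by positivity) (hSlo x hxc hxρ)) (hShi x hxc hxρ)
    rw [barrier]
    have h3 : inner ℝ (x - z) m ≤ r * eps := by
      have := real_inner_le_norm (x - z) m
      rw [hm1, mul_one] at this
      exact this.trans hxρ
    have h4 : K * (inner ℝ (x - z) m - u x + eps) ≤ K * (r * eps) := by gcongr; linarith
    have h5 : 1 / eps * (‖x - z‖ ^ 2 - u x ^ 2 + eps ^ 2) ≤ 1 / eps * (r * eps) ^ 2 := by
      gcongr
      have : ‖x - z‖ ^ 2 ≤ (r * eps) ^ 2 := by gcongr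
      nlinarith
    have h6 : 1 / eps * (r * eps) ^ 2 = r ^ 2 * eps := by field_simp
    linarith
  have hwb : ∀ x ∈ closure Ω, ‖x - z‖ ≤ r * eps →
      C' * ‖x - z‖ ^ 2 / (4 * sig * eps ^ 2) ≤ C' / eps * (wFun (grad u x) * barrier K eps z m u x) := by
    intro x hx hxρ
    calc C' * ‖x - z‖ ^ 2 / (4 * sig * eps ^ 2)
        = C' / eps * (1 / (2 * sig) * (‖x - z‖ ^ 2 / (2 * eps))) := by field_simp; ring
      _ ≤ C' / eps * (wFun (grad u x) * barrier K eps z m u x) := by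
          have := (hg x hx hxρ).1
          have h2 := hbarge x hx hxρ
          have h3 : 0 ≤ wFun (grad u x) := Real.sqrt_nonneg _
          gcongr
  have hfr : ∀ x ∈ frontier Ω, ‖x - z‖ ≤ r * eps →
      |inner ℝ (rotField e m xi z x) (grad u x)|
        ≤ C' / eps * (wFun (grad u x) * barrier K eps z m u x) := by
    intro x hx hxρ
    have hxc := frontier_subset_closure hx
    have hxr : ‖x - z‖ ≤ r0 := by linarith
    have htx := hN.touching x hx hxr
    refine le_trans ?_ (hwb x hxc hxρ)
    -- On `∂Ω` the gradient is normal, so only the normal component of the rotation field counts,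
    -- and that is quadratically small.
    obtain ⟨h1, -, -⟩ := hu.grad_boundary hf hΩ hb hsig heps hR heR hx htx
    set v := rotField e m xi z x with hv
    have hNN : inner ℝ (N x) (N x) = (1 : ℝ) := by rw [real_inner_self_eq_norm_sq, htx.unit]; norm_num
    have h2 := h1 (v - (inner ℝ v (N x) : ℝ) • N x) (by
      rw [inner_sub_left, real_inner_smul_left, hNN]; ring)
    rw [inner_sub_right, inner_smul_right] at h2
    have h3 : inner ℝ v (grad u x) = inner ℝ v (N x) * inner ℝ (grad u x) (N x) := by
      rw [real_inner_comm]; linarith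
    have h4 : |inner ℝ (grad u x) (N x)| ≤ 1 := by
      have := abs_real_inner_le_norm (grad u x) (N x)
      rw [htx.unit, mul_one] at this
      exact this.trans (hu.spacelike x hxc).le
    rw [h3, abs_mul]
    calc |inner ℝ v (N x)| * |inner ℝ (grad u x) (N x)| ≤ (K0 * ‖x - z‖ ^ 2) * 1 := by
          gcongr
          exact hrot x hx hxr
      _ ≤ C' * ‖x - z‖ ^ 2 / (4 * sig * eps ^ 2) := by
          rw [le_div_iff₀ (by positivity)]
          have e1 : eps ^ 2 ≤ 1 := by nlinarith
          have e2 : 4 * sig * K0 ≤ C' := by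
            rw [hC']; have : 0 < 8 * sig / r ^ 2 := by positivity
            linarith
          calc K0 * ‖x - z‖ ^ 2 * 1 * (4 * sig * eps ^ 2)
              = (4 * sig * K0) * ‖x - z‖ ^ 2 * eps ^ 2 := by ring
            _ ≤ C' * ‖x - z‖ ^ 2 * 1 := by gcongr
            _ = _ := mul_one _
  have hsp : ∀ x ∈ Ω, ‖x - z‖ = r * eps →
      |inner ℝ (rotField e m xi z x) (grad u x)|
        ≤ C' / eps * (wFun (grad u x) * barrier K eps z m u x) := by
    intro x hx hxρ
    have hxc := subset_closure hx
    refine le_trans ?_ (hwb x hxc hxρ.le)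
    calc |inner ℝ (rotField e m xi z x) (grad u x)| ≤ ‖rotField e m xi z x‖ * ‖grad u x‖ :=
          abs_real_inner_le_norm _ _
      _ ≤ (1 + 2 * K0 * ‖x - z‖) * 1 := by
          gcongr
          · exact norm_rotField_le he2' hm1 hxin
          · exact (hu.spacelike x hxc).le
      _ ≤ 2 := by
          rw [hxρ]; nlinarith
      _ ≤ C' * ‖x - z‖ ^ 2 / (4 * sig * eps ^ 2) := by
          rw [le_div_iff₀ (by positivity), hxρ]
          have e2 : 8 * sig ≤ C' * r ^ 2 := by
            have : 8 * sig / r ^ 2 ≤ C' := by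
              rw [hC']; have : 0 < 4 * sig * K0 := by positivity
              linarith
            rwa [div_le_iff₀ (by positivity)] at this
          have : 8 * sig * eps ^ 2 ≤ C' * r ^ 2 * eps ^ 2 := by gcongr
          linarith
  have hzc := frontier_subset_closure hz
  obtain ⟨hgz, -, -⟩ := hu.grad_boundary hf hΩ hb hsig heps hR heR hz ht
  -- comparison and the normal derivative at `z`
  have key : ∀ s : ℝ, |s| = 1 → 0 ≤ C' / eps * (2 * K + 2) + s * (e.ofLp ⬝ᵥ hess u z *ᵥ m.ofLp) := by
    intro s hs
    have habs : ∀ T B : ℝ, |T| ≤ B → 0 ≤ B + s * T := by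
      intro T B hT
      have : |s * T| ≤ B := by rwa [abs_mul, hs, one_mul]
      linarith [(abs_le.1 this).1]
    exact hu.mixed_le_of_comparison hz heps hR ht (fun e he => hgz e he) he1' hxim
      (by positivity) hKpos.le (show 0 < r * eps by positivity)
      (hu.rotation_comparison hf hΩ hb (show 0 < C' / eps by positivity) hKpos.le
        hbar0 (fun x hx hxρ => lt_of_lt_of_le (by positivity) (hSlo x hx hxρ)) hop
        (fun x hx hxρ => habs _ _ (hfr x hx hxρ)) (fun x hx hxρ => habs _ _ (hsp x hx hxρ)))
  have k1 := key 1 (by norm_num)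
  have k2 := key (-1) (by norm_num)
  have k3 : |e.ofLp ⬝ᵥ hess u z *ᵥ m.ofLp| ≤ C' / eps * (2 * K + 2) :=
    abs_le.2 ⟨by linarith, by linarith⟩
  calc eps * |e.ofLp ⬝ᵥ hess u z *ᵥ m.ofLp| ≤ eps * (C' / eps * (2 * K + 2)) := by gcongr
    _ = C' * (2 * K + 2) := by field_simp

end DeSitter

end

noncomputable section

namespace DeSitter
open Matrix Filter Topology

variable {n : ℕ}

/-! ### Pure second derivatives at the boundary -/

lemma nonneg_of_isLocalMin_of_hasDerivAt {g g1 : ℝ → ℝ} {g2 : ℝ} (hg : ContDiffAt ℝ 2 g 0)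
    (h1 : ∀ᶠ t in 𝓝 0, HasDerivAt g (g1 t) t) (h2 : HasDerivAt g1 g2 0) (hmin : IsLocalMin g 0) :
    0 ≤ g2 := by
  have h := deriv2_nonneg_of_isLocalMin hg hmin
  have e : deriv g =ᶠ[𝓝 0] g1 := h1.mono fun t ht => ht.deriv
  rwa [e.deriv_eq, h2.deriv] at h

/-- Continuity in operator norm gives a bound uniform in `v`. It transfers inequalities between a
boundary point and nearby interior points, where the equation and the convexity hold. -/
lemma quadratic_near {X : Type*} [TopologicalSpace X] {M : X → Matrix (Fin n) (Fin n) ℝ} {z : X}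
    (hM : ContinuousAt M z) {δ : ℝ} (hδ : 0 < δ) :
    ∀ᶠ x in 𝓝 z, ∀ v : Fin n → ℝ, v ⬝ᵥ M z *ᵥ v - δ * (v ⬝ᵥ v) ≤ v ⬝ᵥ M x *ᵥ v := by
  set L : Matrix (Fin n) (Fin n) ℝ →ₗ[ℝ] (E n →L[ℝ] E n) :=
    (Matrix.toEuclideanCLM (n := Fin n) (𝕜 := ℝ)).toAlgEquiv.toLinearMap with hL
  have hLc : Continuous L := L.continuous_of_finiteDimensional
  have h1 : ContinuousAt (fun x => ‖L (M x) - L (M z)‖) z :=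
    ((hLc.continuousAt.comp hM).sub continuousAt_const).norm
  have h2 : ∀ᶠ x in 𝓝 z, ‖L (M x) - L (M z)‖ < δ := h1.eventually (gt_mem_nhds (by simpa using hδ))
  filter_upwards [h2] with x hx v
  have h3 := abs_real_inner_le_norm (WithLp.toLp 2 v : E n) ((L (M x) - L (M z)) (WithLp.toLp 2 v))
  have h4 := (L (M x) - L (M z)).le_of_opNorm_le hx.le (WithLp.toLp 2 v)
  have h5 : v ⬝ᵥ v = ‖(WithLp.toLp 2 v : E n)‖ ^ 2 := dotProduct_self_eq (WithLp.toLp 2 v)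
  have h6 : ∀ A : Matrix (Fin n) (Fin n) ℝ, inner ℝ (WithLp.toLp 2 v : E n) (L A (WithLp.toLp 2 v))
      = v ⬝ᵥ A *ᵥ v := fun A => by
    rw [inner_eq_dotProduct]; rfl
  rw [_root_.sub_apply, inner_sub_right, h6, h6] at h3
  rw [_root_.sub_apply] at h4
  have h7 : ‖(WithLp.toLp 2 v : E n)‖ * ‖L (M x) (WithLp.toLp 2 v) - L (M z) (WithLp.toLp 2 v)‖
      ≤ ‖(WithLp.toLp 2 v : E n)‖ * (δ * ‖(WithLp.toLp 2 v : E n)‖) := by gcongr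
  have h8 := (abs_le.1 (h3.trans h7)).1
  rw [h5]
  linarith

namespace IsAdmissibleSolution

variable {f : E n → ℝ} {Ω : Set (E n)} {sig eps : ℝ} {u : E n → ℝ}

lemma continuousAt_grad (hu : IsAdmissibleSolution f Ω sig eps u) {x : E n} (hx : x ∈ closure Ω) :
    ContinuousAt (grad u) x := by
  have : ContDiffAt ℝ 1 (grad u) x := by
    unfold grad
    rw [contDiffAt_euclidean]
    exact fun i => contDiffAt_pd i (m := 1) ((hu.contDiffAt_nat hx 2).of_le (by norm_num))
  exact this.continuousAt

lemma continuousAt_hess (hu : IsAdmissibleSolution f Ω sig eps u) {x : E n} (hx : x ∈ closure Ω) :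
    ContinuousAt (hess u) x :=
  continuousAt_pi.2 fun i => continuousAt_pi.2 fun j =>
    (contDiffAt_pd j (m := 1) (contDiffAt_pd i (m := 2) (hu.contDiffAt_nat hx 3))).continuousAt

lemma continuousAt_curvMat (hu : IsAdmissibleSolution f Ω sig eps u) {x : E n}
    (hx : x ∈ closure Ω) : ContinuousAt (fun y => curvMat (hess u y) (grad u y) (u y)) x := by
  have hg := hu.continuousAt_grad hx
  have hh := hu.continuousAt_hess hx
  have huc := (hu.contDiffAt hx).continuousAt
  have hw0 := wFun_pos (hu.spacelike x hx)
  have hw : ContinuousAt (fun y => wFun (grad u y)) x := by unfold wFun; fun_prop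
  have hgam : ContinuousAt (fun y => gammaMat (grad u y)) x := by
    refine continuousAt_pi.2 fun i => continuousAt_pi.2 fun j => ?_
    have hc : ∀ k, ContinuousAt (fun y => grad u y k) x := fun k =>
      (EuclideanSpace.proj k : E n →L[ℝ] ℝ).continuous.continuousAt.comp hg
    exact continuousAt_const.add (((hc i).mul (hc j)).div (hw.mul (continuousAt_const.add hw))
      (by positivity))
  unfold curvMat
  exact (continuousAt_const.div hw hw0.ne').smul
    (continuousAt_const.sub (huc.smul ((hgam.mul hh).mul hgam)))

lemma hess_quadratic_le_closure (hf : IsCurvatureFunction f) (hΩ : IsOpen Ω)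
    (hb : Bornology.IsBounded Ω) (hsig : 1 < sig) (heps : 0 < eps)
    (hu : IsAdmissibleSolution f Ω sig eps u) {x : E n} (hx : x ∈ closure Ω) (v : E n) :
    v.ofLp ⬝ᵥ hess u x *ᵥ v.ofLp ≤ ‖v‖ ^ 2 / eps := by
  refine le_of_forall_pos_le_add fun δ hδ => ?_
  have hδ' : 0 < δ / (‖v‖ ^ 2 + 1) := by positivity
  have h1 := quadratic_near (hu.continuousAt_hess hx) hδ'
  obtain ⟨y, hy, hyΩ⟩ := mem_closure_iff_nhds.1 hx _ h1
  have h2 := hy v.ofLp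
  have h3 := hu.hess_quadratic_le hf hΩ hb hsig heps hyΩ v
  have h4 : δ / (‖v‖ ^ 2 + 1) * (v.ofLp ⬝ᵥ v.ofLp) ≤ δ := by
    rw [dotProduct_self_eq, div_mul_eq_mul_div, div_le_iff₀ (by positivity)]
    nlinarith
  linarith

/-- The tangential second derivatives on the boundary. -/
lemma abs_hess_tangential_le (hf : IsCurvatureFunction f) (hΩ : IsOpen Ω)
    (hb : Bornology.IsBounded Ω) (hsig : 1 < sig) (heps : 0 < eps)
    (hu : IsAdmissibleSolution f Ω sig eps u) {R : ℝ} (hR : 0 < R) (heR : eps < R)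
    (hhi : slopeHi sig R eps ≤ 1) {z m : E n} (hz : z ∈ frontier Ω) (ht : TouchingBalls Ω R z m)
    {e : E n} (he : inner ℝ e m = 0) :
    |e.ofLp ⬝ᵥ hess u z *ᵥ e.ofLp| ≤ 5 / R * ‖e‖ ^ 2 := by
  have hzc := frontier_subset_closure hz
  set q := ‖e‖ ^ 2 / R with hq
  have hq0 : 0 ≤ q := by positivity
  set p := grad u z with hp
  have hm1 := ht.unit
  have hpm : |inner ℝ p m| ≤ 1 := by
    have := abs_real_inner_le_norm p m
    rw [hm1, mul_one] at this
    exact this.trans (hu.spacelike z hzc).le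
  -- The normal displacement `t²|e|²/R` is twice the leading deviation of the interior sphere from
  -- its tangent plane, so the curve stays in the closure of `Ω` for small `t` of either sign.
  set c : ℝ → E n := fun t => z + t • e + (t ^ 2 * q) • m with hc
  have hc0 : c 0 = z := by simp [hc]
  have hcz : ∀ t, c t - z = t • e + (t ^ 2 * q) • m := fun t => by simp only [hc]; abel
  have hcin : ∀ t, inner ℝ (c t - z) m = t ^ 2 * q := fun t => by
    rw [hcz, inner_add_left, real_inner_smul_left, real_inner_smul_left, he,
      real_inner_self_eq_norm_sq, hm1]; ring
  have hcn : ∀ t, ‖c t - z‖ ^ 2 = t ^ 2 * ‖e‖ ^ 2 + t ^ 4 * q ^ 2 := fun t => by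
    rw [hcz, norm_add_sq_real, real_inner_smul_left, inner_smul_right, he, norm_smul, norm_smul,
      hm1, mul_pow, mul_pow, Real.norm_eq_abs, Real.norm_eq_abs, sq_abs, sq_abs]
    ring
  have hqR : q * R = ‖e‖ ^ 2 := by rw [hq]; field_simp
  have hcl : ∀ᶠ t : ℝ in 𝓝 0, c t ∈ closure Ω := by
    have h1 : ∀ᶠ t : ℝ in 𝓝 0, t ^ 2 * q < R := by
      have : Continuous fun t : ℝ => t ^ 2 * q := by fun_prop
      exact this.continuousAt.eventually (gt_mem_nhds (by simpa using hR))
    filter_upwards [h1] with t ht1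
    by_cases h0 : t • e = 0
    · have : t ^ 2 * ‖e‖ ^ 2 = 0 := by
        have := congrArg (fun v => ‖v‖ ^ 2) h0
        simpa [norm_smul, mul_pow] using this
      have h2 : t ^ 2 * q = 0 := by rw [hq, ← mul_div_assoc, this, zero_div]
      have : c t = z := by simp only [hc, h0, h2, zero_smul, add_zero]
      rw [this]; exact hzc
    · refine subset_closure (ht.interior ?_)
      have hpos : 0 < t ^ 2 * ‖e‖ ^ 2 := by
        have := norm_pos_iff.2 h0
        have h2 : t ^ 2 * ‖e‖ ^ 2 = ‖t • e‖ ^ 2 := by simp [norm_smul, mul_pow]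
        rw [h2]; positivity
      rw [Metric.mem_ball, dist_eq_norm]
      refine lt_of_pow_lt_pow_left₀ 2 hR.le ?_
      rw [show c t - (z + R • m) = (c t - z) - R • m by abel, norm_sub_sq_real, inner_smul_right,
        norm_smul, hm1, mul_one, hcin, hcn, Real.norm_of_nonneg hR.le]
      have h3 : 0 < t ^ 2 * q := by rw [hq, ← mul_div_assoc]; positivity
      nlinarith
  have hcd : ∀ t, HasDerivAt c (e + (2 * t * q) • m) t := by
    intro t
    have h1 : HasDerivAt (fun t : ℝ => z + t • e) e t := by
      simpa using ((hasDerivAt_id t).smul_const e).const_add z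
    have h2 : HasDerivAt (fun t : ℝ => t ^ 2 * q) (2 * t * q) t := by
      simpa using ((hasDerivAt_id t).pow 2).mul_const q
    exact h1.add (h2.smul_const m)
  have hcs : ContDiff ℝ 2 c := by fun_prop
  have hu2 : ContDiffAt ℝ 2 u z := hu.contDiffAt_nat hzc 2
  set g : ℝ → ℝ := fun t => u (c t) with hg
  have hgs : ContDiffAt ℝ 2 g 0 := by
    have h1 : ContDiffAt ℝ 2 u (c 0) := by rw [hc0]; exact hu2
    exact h1.comp 0 hcs.contDiffAt
  set g1 : ℝ → ℝ := fun t => ∑ k, (e k + 2 * t * q * m k) * pd k u (c t) with hg1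
  have hgd : ∀ᶠ t in 𝓝 0, HasDerivAt g (g1 t) t := by
    have h1 : ∀ᶠ t in 𝓝 0, DifferentiableAt ℝ u (c t) := by
      have h2 : ∀ᶠ y in 𝓝 (c 0), DifferentiableAt ℝ u y := by
        rw [hc0]
        filter_upwards [hu2.eventually (by simp)] with y hy using hy.differentiableAt (by norm_num)
      exact hcs.continuous.continuousAt.eventually h2
    filter_upwards [h1] with t ht1
    have h2 := ht1.hasFDerivAt.comp_hasDerivAt t (hcd t)
    rw [fderiv_apply_eq_sum] at h2
    exact h2
  set g2 : ℝ := e.ofLp ⬝ᵥ hess u z *ᵥ e.ofLp + 2 * q * inner ℝ p m with hg2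
  have hgd2 : HasDerivAt g1 g2 0 := by
    have h1 : ∀ k, HasDerivAt (fun t : ℝ => (e k + 2 * t * q * m k) * pd k u (c t))
        (2 * q * m k * pd k u z + e k * (hess u z *ᵥ e.ofLp) k) 0 := by
      intro k
      have h2 : HasDerivAt (fun t : ℝ => e k + 2 * t * q * m k) (2 * q * m k) 0 := by
        have := ((((hasDerivAt_id (0 : ℝ)).const_mul 2).mul_const q).mul_const (m k)).const_add (e k)
        simpa using this
      have h3 : HasDerivAt (fun t : ℝ => pd k u (c t)) ((hess u z *ᵥ e.ofLp) k) 0 := by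
        have hd : DifferentiableAt ℝ (pd k u) (c 0) := by
          rw [hc0]
          exact (contDiffAt_pd k (m := 1) (hu2.of_le (by norm_num))).differentiableAt (by norm_num)
        have h4 := hd.hasFDerivAt.comp_hasDerivAt 0 (hcd 0)
        rw [fderiv_apply_eq_sum, hc0] at h4
        refine h4.congr_deriv ?_
        simp only [mulVec, dotProduct, mul_zero, zero_mul, zero_smul, add_zero]
        exact Finset.sum_congr rfl fun i _ => mul_comm _ _
      refine (h2.mul h3).congr_deriv ?_
      simp [hc0]
    refine (HasDerivAt.fun_sum fun k _ => h1 k).congr_deriv ?_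
    rw [Finset.sum_add_distrib, hg2, inner_eq_dotProduct, add_comm]
    congr 1
    rw [dotProduct, Finset.mul_sum]
    exact Finset.sum_congr rfl fun k _ => by rw [hp, grad]; ring
  have hg0 : g 0 = eps := by rw [hg]; simp only [hc0]; exact hu.bdry z hz
  -- Along the curve `u` is at least its value `ε` at `t = 0`, and `hup` below uses the upper height
  -- bound in the same way; both second derivatives then have a sign.
  have hlow : 0 ≤ g2 := by
    refine nonneg_of_isLocalMin_of_hasDerivAt hgs hgd hgd2 ?_
    filter_upwards [hcl] with t htc
    rw [hg0]
    exact hu.eps_le hf hΩ hb hsig htc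
  set hi := slopeHi sig R eps with hhi'
  set b : ℝ := hi * q + ‖e‖ ^ 2 / (2 * R) with hbdef
  set k : ℝ → ℝ := fun t => t ^ 2 * b + t ^ 4 * (q ^ 2 / (2 * R)) with hk
  have hk1 : ∀ t, HasDerivAt k (2 * t * b + 4 * t ^ 3 * (q ^ 2 / (2 * R))) t := by
    intro t
    have h1 : HasDerivAt (fun t : ℝ => t ^ 2 * b) (2 * t * b) t := by
      simpa using ((hasDerivAt_id t).pow 2).mul_const b
    have h2 : HasDerivAt (fun t : ℝ => t ^ 4 * (q ^ 2 / (2 * R))) (4 * t ^ 3 * (q ^ 2 / (2 * R))) t := by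
      simpa using ((hasDerivAt_id t).pow 4).mul_const (q ^ 2 / (2 * R))
    exact h1.add h2
  have hk2 : HasDerivAt (fun t : ℝ => 2 * t * b + 4 * t ^ 3 * (q ^ 2 / (2 * R))) (2 * b) 0 := by
    have h1 : HasDerivAt (fun t : ℝ => 2 * t * b) (2 * b) 0 := by
      simpa using ((hasDerivAt_id (0 : ℝ)).const_mul 2).mul_const b
    have h2 : HasDerivAt (fun t : ℝ => 4 * t ^ 3 * (q ^ 2 / (2 * R))) 0 0 := by
      simpa using (((hasDerivAt_id (0 : ℝ)).pow 3).const_mul 4).mul_const (q ^ 2 / (2 * R))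
    exact (h1.add h2).congr_deriv (by ring)
  have hup : 0 ≤ 2 * b - g2 := by
    refine nonneg_of_isLocalMin_of_hasDerivAt (g := fun t => k t - g t)
      (g1 := fun t => 2 * t * b + 4 * t ^ 3 * (q ^ 2 / (2 * R)) - g1 t) ?_ ?_ (hk2.sub hgd2) ?_
    · exact ContDiffAt.sub (by fun_prop) hgs
    · filter_upwards [hgd] with t h1 using (hk1 t).sub h1
    · filter_upwards [hcl] with t htc
      have h1 := hu.height_le hf hΩ hb hsig heps hR heR ht htc
      rw [hcin, hcn] at h1
      have h2 : hi * (t ^ 2 * q) + (t ^ 2 * ‖e‖ ^ 2 + t ^ 4 * q ^ 2) / (2 * R) = k t := by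
        simp only [hk, hbdef]; ring
      have h3 : k 0 = 0 := by simp [hk]
      rw [h2] at h1
      rw [hg0, h3]
      have : g t = u (c t) := rfl
      linarith
  have hb' : 2 * b = 2 * hi * q + q := by rw [hbdef, hq]; field_simp
  have e5 : 5 / R * ‖e‖ ^ 2 = 5 * q := by rw [hq]; ring
  have hpm' := abs_le.1 hpm
  rw [e5, abs_le]
  constructor
  · nlinarith
  · nlinarith

end IsAdmissibleSolution

end DeSitter

end

noncomputable section

namespace DeSitter
open Matrix Filter Topology

variable {n : ℕ}

/-! ### The double normal derivative and the conclusion -/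

lemma quadratic_add_smul {U : Matrix (Fin n) (Fin n) ℝ} (hU : Uᵀ = U) (y m : Fin n → ℝ) (a : ℝ) :
    (y + a • m) ⬝ᵥ U *ᵥ (y + a • m)
      = y ⬝ᵥ U *ᵥ y + 2 * a * (y ⬝ᵥ U *ᵥ m) + a ^ 2 * (m ⬝ᵥ U *ᵥ m) := by
  rw [mulVec_add, mulVec_smul, dotProduct_add, add_dotProduct, add_dotProduct, smul_dotProduct,
    smul_dotProduct, dotProduct_smul, dotProduct_smul, dotProduct_mulVec_symm hU y m]
  simp only [smul_eq_mul]
  ring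

/-- In the directions adapted to `p = s m`, a Hessian with bounded tangential and mixed parts and a
very negative normal part gives a curvature matrix with one large eigenvalue. -/
lemma curvMat_rank_one_le {p m : E n} (hp : ‖p‖ < 1) (hm : ‖m‖ = 1)
    (hpm : ∀ e, inner ℝ e m = 0 → inner ℝ p e = 0) {U : Matrix (Fin n) (Fin n) ℝ} (hU : Uᵀ = U)
    {z a1 R' θ C1 : ℝ} (hz : 0 ≤ z) (ha1 : 0 ≤ a1) (hR' : 0 ≤ R') (hθ : 0 < θ)
    (hwa : wFun p * a1 ≤ 1 - θ / 4)
    (htan : ∀ e : E n, inner ℝ e m = 0 → z * |e.ofLp ⬝ᵥ U *ᵥ e.ofLp| ≤ θ / 8 * ‖e‖ ^ 2)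
    (hmix : ∀ e : E n, inner ℝ e m = 0 → z * |e.ofLp ⬝ᵥ U *ᵥ m.ofLp| ≤ C1 * ‖e‖)
    (hnor : z * (m.ofLp ⬝ᵥ U *ᵥ m.ofLp) ≤ -(8 * C1 ^ 2 / θ + a1 + R')) (v : Fin n → ℝ) :
    a1 * (v ⬝ᵥ v) + R' * (m.ofLp ⬝ᵥ v) ^ 2 ≤ v ⬝ᵥ curvMat U p z *ᵥ v := by
  have hw := wFun_pos hp
  have hw1 : wFun p ≤ 1 := Real.sqrt_le_one.2 (by nlinarith [sq_nonneg ‖p‖])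
  have hmm : inner ℝ m m = (1 : ℝ) := by rw [real_inner_self_eq_norm_sq, hm]; norm_num
  have hwsq := wFun_sq hp
  set w := wFun p with hwdef
  set s : ℝ := inner ℝ p m with hs
  have hps : p = s • m := by
    have h1 := hpm (p - s • m) (by rw [inner_sub_left, real_inner_smul_left, hmm]; ring)
    have h2 : inner ℝ (p - s • m) (p - s • m) = (0 : ℝ) := by
      rw [inner_sub_left, h1, real_inner_smul_left, inner_sub_right, real_inner_comm, ← hs,
        inner_smul_right, hmm]; ring
    exact sub_eq_zero.1 (inner_self_eq_zero.1 h2)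
  have hpp : p.ofLp ⬝ᵥ p.ofLp = s ^ 2 := by
    rw [← inner_eq_dotProduct]
    nth_rewrite 1 [hps]
    rw [real_inner_smul_left, real_inner_comm, ← hs]; ring
  rw [hpp] at hwsq
  set y : E n := WithLp.toLp 2 (gammaMat p *ᵥ v) with hy
  set a : ℝ := inner ℝ y m with ha
  set y' := y - a • m with hy'
  have hy'm : inner ℝ y' m = 0 := by
    rw [hy', inner_sub_left, real_inner_smul_left, hmm, ← ha]; ring
  have hyd : y = y' + a • m := by rw [hy']; abel
  have hmv : m.ofLp ⬝ᵥ v = w * a := by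
    have h1 : a = m.ofLp ⬝ᵥ v + 1 / (w * (1 + w)) * (s ^ 2 * (m.ofLp ⬝ᵥ v)) := by
      have h2 : m.ofLp ⬝ᵥ p.ofLp = s := by rw [← inner_eq_dotProduct, real_inner_comm]
      have h3 : p.ofLp ⬝ᵥ v = s * (m.ofLp ⬝ᵥ v) := by
        conv_lhs => rw [hps]
        rw [WithLp.ofLp_smul, smul_dotProduct, smul_eq_mul]
      rw [ha, real_inner_comm, inner_eq_dotProduct, hy]
      show m.ofLp ⬝ᵥ gammaMat p *ᵥ v = _
      rw [gammaMat_eq, add_mulVec, one_mulVec, smul_mulVec, vecMulVec_mulVec, dotProduct_add,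
        dotProduct_smul, ← hwdef, h3]
      simp only [op_smul_eq_smul, dotProduct_smul, smul_eq_mul, h2]
      ring
    rw [h1, show s ^ 2 = 1 - w ^ 2 by linarith]
    field_simp
    ring
  have hvv : v ⬝ᵥ v = ‖y'‖ ^ 2 + w ^ 2 * a ^ 2 := by
    rw [dotProduct_eq_metMat hp v, metMat_quadratic]
    have h1 : (gammaMat p *ᵥ v) ⬝ᵥ (gammaMat p *ᵥ v) = ‖y‖ ^ 2 := dotProduct_self_eq y
    have h2 : p.ofLp ⬝ᵥ (gammaMat p *ᵥ v) = s * a := by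
      have h3 : p.ofLp ⬝ᵥ (gammaMat p *ᵥ v) = inner ℝ p y := (inner_eq_dotProduct p y).symm
      rw [h3]
      conv_lhs => rw [hps]
      rw [real_inner_smul_left, real_inner_comm]
    have h3 : ‖y‖ ^ 2 = ‖y'‖ ^ 2 + a ^ 2 := by
      conv_lhs => rw [hyd]
      rw [norm_add_sq_real, inner_smul_right, hy'm, norm_smul, hm, mul_one, Real.norm_eq_abs, sq_abs]
      ring
    rw [h1, h2, h3, hwsq]; ring
  have hUy : (gammaMat p *ᵥ v) ⬝ᵥ U *ᵥ (gammaMat p *ᵥ v) = y'.ofLp ⬝ᵥ U *ᵥ y'.ofLp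
      + 2 * a * (y'.ofLp ⬝ᵥ U *ᵥ m.ofLp) + a ^ 2 * (m.ofLp ⬝ᵥ U *ᵥ m.ofLp) := by
    have h1 : gammaMat p *ᵥ v = y'.ofLp + a • m.ofLp := congrArg WithLp.ofLp hyd
    rw [h1, quadratic_add_smul hU]
  rw [dotProduct_curvMat hp, convMat_quadratic, ← dotProduct_eq_metMat hp, hUy, hmv, hvv, ← hwdef,
    one_div, le_inv_mul_iff₀ hw]
  set T := y'.ofLp ⬝ᵥ U *ᵥ y'.ofLp
  set X := y'.ofLp ⬝ᵥ U *ᵥ m.ofLp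
  set Q := m.ofLp ⬝ᵥ U *ᵥ m.ofLp
  -- Tangential and mixed terms each spend `θ/8`, together the slack in `w a1 ≤ 1 - θ/4`. The cost
  -- `8 C1²/θ · a²` of Young's inequality is paid by the double normal term.
  have hT : z * T ≤ θ / 8 * ‖y'‖ ^ 2 :=
    (mul_le_mul_of_nonneg_left (le_abs_self T) hz).trans (htan y' hy'm)
  have hX : z * (2 * a * X) ≤ θ / 8 * ‖y'‖ ^ 2 + 8 * C1 ^ 2 / θ * a ^ 2 := by
    have h1 : z * (2 * a * X) ≤ 2 * |a| * (C1 * ‖y'‖) := by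
      calc z * (2 * a * X) ≤ |z * (2 * a * X)| := le_abs_self _
        _ = 2 * |a| * (z * |X|) := by
            rw [abs_mul, abs_mul, abs_mul, abs_of_nonneg hz, abs_two]; ring
        _ ≤ 2 * |a| * (C1 * ‖y'‖) := mul_le_mul_of_nonneg_left (hmix y' hy'm) (by positivity)
    have h2 : θ / 8 * ‖y'‖ ^ 2 + 8 * C1 ^ 2 / θ * a ^ 2 - 2 * |a| * (C1 * ‖y'‖)
        = (θ * ‖y'‖ - 8 * C1 * |a|) ^ 2 / (8 * θ) := by
      rw [← sq_abs a]; field_simp; ring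
    have h3 : 0 ≤ (θ * ‖y'‖ - 8 * C1 * |a|) ^ 2 / (8 * θ) := by positivity
    linarith
  have hQ : z * (a ^ 2 * Q) ≤ -(8 * C1 ^ 2 / θ + a1 + R') * a ^ 2 := by
    calc z * (a ^ 2 * Q) = z * Q * a ^ 2 := by ring
      _ ≤ _ := by gcongr
  have hL1 : w * a1 * ‖y'‖ ^ 2 ≤ (1 - θ / 4) * ‖y'‖ ^ 2 := by gcongr
  have hL2 : w * a1 * (w ^ 2 * a ^ 2) ≤ 1 * a1 * (1 ^ 2 * a ^ 2) := by gcongr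
  have hL3 : w * (R' * (w * a) ^ 2) ≤ R' * a ^ 2 := by
    calc w * (R' * (w * a) ^ 2) = w * (R' * (w ^ 2 * a ^ 2)) := by ring
      _ ≤ 1 * (R' * (1 ^ 2 * a ^ 2)) := by gcongr
      _ = _ := by ring
  have hw2 : 0 ≤ w ^ 2 * a ^ 2 := by positivity
  linarith

/-- The growth condition provides a bound for the largest eigenvalue. -/
lemma IsCurvatureFunction.exists_growth {f : E n → ℝ} (hf : IsCurvatureFunction f) (hn : 0 < n)
    {sig : ℝ} (hsig : 1 < sig) : ∃ θ R' : ℝ, 0 < θ ∧ θ < 1 ∧ 0 ≤ R' ∧ ∃ last : Fin n,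
      sig < f ((sig * (1 - θ)) • oneVec n + EuclideanSpace.single last R') := by
  obtain ⟨eps0, heps0, delta0, hdelta0, hgr⟩ := hf.growth
  set last : Fin n := ⟨n - 1, by omega⟩ with hlast
  have h1 := hgr last (by simp only [hlast]; omega) (eps0 / 2) (by positivity)
  obtain ⟨ρ, hρ, hρ0⟩ := (h1.and (eventually_ge_atTop 0)).exists
  -- Growth at the centre of the ball is carried by homogeneity to `σ(1-θ)·1`; `θ` is chosen so that
  -- `(1-θ)(1 + ε₀/2) = 1 + ε₀/4` still exceeds `1`.
  have h2 := hρ (oneVec n) ⟨Metric.mem_ball_self hdelta0, oneVec_mem⟩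
  set θ := eps0 / (4 * (1 + eps0 / 2)) with hθ
  have hθ0 : 0 < θ := by positivity
  have hθ1 : θ < 1 := by rw [hθ, div_lt_one (by positivity)]; linarith
  have ha : 0 < sig * (1 - θ) := mul_pos (by linarith) (by linarith)
  refine ⟨θ, sig * (1 - θ) * ρ, hθ0, hθ1, by positivity, last, ?_⟩
  have e1 : (sig * (1 - θ)) • oneVec n + EuclideanSpace.single last (sig * (1 - θ) * ρ)
      = (sig * (1 - θ)) • (oneVec n + EuclideanSpace.single last ρ) := by
    ext i
    by_cases hi : i = last
    · subst hi; simp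
    · simp [hi]
  have hmem : oneVec n + EuclideanSpace.single last ρ ∈ posCone n := by
    intro i
    by_cases hi : i = last
    · subst hi; simp [oneVec]; linarith
    · simp [oneVec, hi]
  rw [e1, hf.homog _ ha _ hmem]
  have h3 : (1 - θ) * (1 + eps0 / 2) = 1 + eps0 / 4 := by rw [hθ]; field_simp; ring
  calc sig < sig * (1 + eps0 / 4) := by nlinarith
    _ = sig * (1 - θ) * (1 + eps0 - eps0 / 2) := by rw [← h3]; ring
    _ ≤ _ := by gcongr

/-- The lower bound for the double normal derivative. -/
theorem exists_double_normal_bound {f : E n → ℝ} (hf : IsCurvatureFunction f) {Ω : Set (E n)}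
    (hΩ : IsOpen Ω) (hb : Bornology.IsBounded Ω) {sig : ℝ} (hsig : 1 < sig) {R : ℝ}
    (hR : 0 < R) (C1 : ℝ) :
    ∃ C e1 : ℝ, 0 < e1 ∧ ∀ eps, 0 < eps → eps ≤ e1 → ∀ u, IsAdmissibleSolution f Ω sig eps u →
      ∀ z ∈ frontier Ω, ∀ m, TouchingBalls Ω R z m →
        (∀ e : E n, inner ℝ e m = 0 → eps * |e.ofLp ⬝ᵥ hess u z *ᵥ m.ofLp| ≤ C1 * ‖e‖) →
        -C ≤ eps * (m.ofLp ⬝ᵥ hess u z *ᵥ m.ofLp) := by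
  rcases n.eq_zero_or_pos with hn | hn
  · subst hn
    refine ⟨0, 1, one_pos, fun eps _ _ u _ z _ m ht _ => ?_⟩
    simp [dotProduct]
  obtain ⟨θ, R', hθ0, hθ1, hR', last, hgr⟩ := hf.exists_growth hn hsig
  have hs0 : 0 < sig := by linarith
  have hβ0 := slope_pos hsig
  have hβ1 := slope_lt_one hsig
  have hβ2 := slope_sq hsig
  set β := slope sig with hβ
  -- Slopes within `θ/(2σ²)` of `β` give `w ≤ (1 + θ/2)/σ`; the second bound keeps `slopeHi` at most
  -- `1`.
  set η := min (θ / (2 * sig ^ 2)) (1 - β) with hη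
  have hη0 : 0 < η := lt_min (by positivity) (by linarith)
  have hη1 : η ≤ θ / (2 * sig ^ 2) := min_le_left _ _
  have hη2 : η ≤ 1 - β := min_le_right _ _
  obtain ⟨e1, he1, hslope⟩ := eventually_slope hsig hR hη0
  -- Small enough for `w a1 ≤ 1 - θ/4`, yet above `σ(1-θ)` by `σθ/4`, the loss allowed in passing
  -- from `z` to an interior point where the equation holds.
  set a1 := sig * (1 - 3 * θ / 4) with ha1
  have ha10 : 0 < a1 := mul_pos hs0 (by linarith)
  refine ⟨8 * C1 ^ 2 / θ + a1 + R', min e1 (min (R / 2) (θ * R / 40)), by positivity,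
    fun eps heps hle u hu z hz m ht hmix => ?_⟩
  simp only [le_min_iff] at hle
  obtain ⟨hle1, hleR, hleθ⟩ := hle
  have heR : eps < R := by linarith
  obtain ⟨hlo, hhi⟩ := hslope eps heps hle1
  have hhi1 : slopeHi sig R eps ≤ 1 := by linarith [(abs_le.1 hhi).2]
  have hzc := frontier_subset_closure hz
  have hp := hu.spacelike z hzc
  obtain ⟨hg1, hg2, hg3⟩ := hu.grad_boundary hf hΩ hb hsig heps hR heR hz ht
  by_contra hcon
  push Not at hcon
  set p := grad u z with hpdef
  set s : ℝ := inner ℝ p m with hs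
  have hsβ : β - η ≤ s := by linarith [(abs_le.1 hlo).1]
  have hs1 : s ≤ 1 := hg3.trans hhi1
  -- the bound for `w`
  have hps : s ^ 2 ≤ ‖p‖ ^ 2 := by
    have h1 := abs_real_inner_le_norm p m
    rw [ht.unit, mul_one, ← hs] at h1
    rw [← sq_abs]
    gcongr
  have hw : wFun p ≤ 1 / sig * (1 + θ / 2) := by
    rw [wFun]
    apply Real.sqrt_le_iff.2 ⟨by positivity, ?_⟩
    have h1 : β ^ 2 - 2 * η ≤ s ^ 2 := by
      rcases le_or_gt 0 (β - η) with h | h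
      · have : (β - η) ^ 2 ≤ s ^ 2 := by gcongr
        nlinarith
      · nlinarith [sq_nonneg s]
    have h2 : 2 * η ≤ θ * (1 / sig ^ 2) := by
      calc 2 * η ≤ 2 * (θ / (2 * sig ^ 2)) := by gcongr
        _ = _ := by field_simp
    have h3 : (1 / sig * (1 + θ / 2)) ^ 2 = 1 / sig ^ 2 + θ * (1 / sig ^ 2) + (θ / (2 * sig)) ^ 2 := by
      field_simp; ring
    rw [h3]
    have h4 : 0 ≤ (θ / (2 * sig)) ^ 2 := by positivity
    linarith
  have hwa : wFun p * a1 ≤ 1 - θ / 4 := by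
    calc wFun p * a1 ≤ 1 / sig * (1 + θ / 2) * a1 := by gcongr
      _ = (1 + θ / 2) * (1 - 3 * θ / 4) := by rw [ha1]; field_simp
      _ ≤ 1 - θ / 4 := by nlinarith
  have hcurv := curvMat_rank_one_le hp ht.unit hg1
    (hess_isSymm (hu.contDiffAt_nat hzc 2)) heps.le ha10.le hR' hθ0 hwa
    (fun e he => by
      have h1 := hu.abs_hess_tangential_le hf hΩ hb hsig heps hR heR hhi1 hz ht he
      calc eps * |e.ofLp ⬝ᵥ hess u z *ᵥ e.ofLp| ≤ (θ * R / 40) * (5 / R * ‖e‖ ^ 2) := by gcongr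
        _ = θ / 8 * ‖e‖ ^ 2 := by field_simp; ring) hmix hcon.le
  -- the curvature at interior points close to `z`
  have hδ : 0 < sig * θ / 4 := by positivity
  have hnear := quadratic_near (hu.continuousAt_curvMat hzc) hδ
  obtain ⟨x, hx, hxΩ⟩ := mem_closure_iff_nhds.1 hzc _ hnear
  have ha : 0 < sig * (1 - θ) := mul_pos hs0 (by linarith)
  have hmm : m.ofLp ⬝ᵥ m.ofLp = 1 := by rw [dotProduct_self_eq, ht.unit]; norm_num
  have hfin := le_matFun_of_rank_one_le hf (hu.curvMat_posDef hxΩ) ha hR' hmm (fun v => by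
    have h1 := hx v
    have h2 := hcurv v
    have h3 : sig * (1 - θ) * (v ⬝ᵥ v) = a1 * (v ⬝ᵥ v) - sig * θ / 4 * (v ⬝ᵥ v) := by
      rw [ha1]; ring
    rw [hu.bdry z hz] at h1
    linarith) last
  have heq := hu.eqn x hxΩ
  rw [GFun] at heq
  rw [heq] at hfin
  linarith

/-- Polarization: the form is at most `4C` on `eᵢ + eⱼ` and `C` on each basis vector, and `(4 + 1 +
1)/2 = 3`. -/
lemma abs_apply_le_of_quadratic {U : Matrix (Fin n) (Fin n) ℝ} (hU : Uᵀ = U) {C : ℝ}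
    (h : ∀ v : E n, |v.ofLp ⬝ᵥ U *ᵥ v.ofLp| ≤ C * ‖v‖ ^ 2) (i j : Fin n) : |U i j| ≤ 3 * C := by
  have hij : ∀ i j, (EuclideanSpace.single i (1 : ℝ)).ofLp ⬝ᵥ U *ᵥ (EuclideanSpace.single j (1 : ℝ)).ofLp
      = U i j := fun i j => by simp
  have hn : ∀ i, ‖(EuclideanSpace.single i (1 : ℝ) : E n)‖ = 1 := fun i => by simp
  have h1 := h (EuclideanSpace.single i 1)
  have h2 := h (EuclideanSpace.single j 1)
  have h3 := h (EuclideanSpace.single i 1 + EuclideanSpace.single j 1)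
  have h4 := quadratic_add_smul hU (EuclideanSpace.single i (1 : ℝ)).ofLp
    (EuclideanSpace.single j (1 : ℝ)).ofLp 1
  rw [one_smul, hij, hij, hij] at h4
  rw [WithLp.ofLp_add, h4] at h3
  rw [hij, hn] at h1 h2
  have hC : 0 ≤ C := by have := (abs_nonneg _).trans h1; linarith
  have h5 : C * ‖(EuclideanSpace.single i (1 : ℝ) + EuclideanSpace.single j 1 : E n)‖ ^ 2 ≤ C * 2 ^ 2 := by
    gcongr
    exact (norm_add_le _ _).trans (by rw [hn, hn]; norm_num)
  have h3' := abs_le.1 (h3.trans h5)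
  have h1' := abs_le.1 h1
  have h2' := abs_le.1 h2
  exact abs_le.2 ⟨by linarith, by linarith⟩

lemma hessNorm_le {u : E n → ℝ} {x : E n} {C : ℝ} (hC : 0 ≤ C) (h : ∀ i j, |hess u x i j| ≤ C) :
    hessNorm u x ≤ n * C := by
  rw [hessNorm]
  refine Real.sqrt_le_iff.2 ⟨by positivity, ?_⟩
  calc ∑ i, ∑ j, hess u x i j ^ 2 ≤ ∑ _i : Fin n, ∑ _j : Fin n, C ^ 2 := by
        refine Finset.sum_le_sum fun i _ => Finset.sum_le_sum fun j _ => ?_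
        exact sq_le_sq' (abs_le.1 (h i j)).1 (abs_le.1 (h i j)).2
    _ = (n * C) ^ 2 := by simp; ring

/-- The boundary estimate for the second derivatives. -/
theorem exists_boundary_hess_bound (f : E n → ℝ) (hf : IsCurvatureFunction f)
    (Ω : Set (E n)) (hΩ : IsBoundedSmoothDomain Ω)
    (sig : ℝ) (hsig : 1 < sig) :
    ∃ eps1 : ℝ, 0 < eps1 ∧ ∃ C : ℝ, ∀ eps : ℝ, 0 < eps → eps ≤ eps1 →
      ∀ u : E n → ℝ, IsAdmissibleSolution f Ω sig eps u →
        ∀ x ∈ frontier Ω, u x * hessNorm u x ≤ C := by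
  have hβ1 := slope_lt_one hsig
  obtain ⟨R, K0, r0, hR, hK0, hr0, hfield⟩ := exists_normalField hΩ
  obtain ⟨C1, e1, he1, hmixed⟩ := exists_mixed_bound hf hΩ.isOpen hΩ.bounded hsig hR hK0 hr0
  obtain ⟨C2, e2, he2, hnormal⟩ := exists_double_normal_bound hf hΩ.isOpen hΩ.bounded hsig hR C1
  obtain ⟨e3, he3, hslope⟩ := eventually_slope hsig hR (show 0 < 1 - slope sig by linarith)
  -- The summands bound `ε` times the tangential, mixed and double normal contributions; in the last
  -- one `1` is the upper bound from convexity.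
  set B := 5 + 2 * |C1| + max 1 |C2| with hB
  have hB0 : 0 ≤ B := by positivity
  refine ⟨min e1 (min e2 (min e3 (R / 2))), by positivity, n * (3 * B),
    fun eps heps hle u hu z hz => ?_⟩
  simp only [le_min_iff] at hle
  obtain ⟨hle1, hle2, hle3, hleR⟩ := hle
  have heR : eps < R := by linarith
  have hhi1 : slopeHi sig R eps ≤ 1 := by linarith [(abs_le.1 (hslope eps heps hle3).2).2]
  have hzc := frontier_subset_closure hz
  obtain ⟨N, hN⟩ := hfield z hz
  have ht := hN.touching z hz (by rw [sub_self, norm_zero]; exact hr0.le)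
  set m := N z with hm
  have hm1 : ‖m‖ = 1 := ht.unit
  have hU := hess_isSymm (hu.contDiffAt_nat hzc 2)
  set U := hess u z with hUdef
  have hmix : ∀ e : E n, inner ℝ e m = 0 → eps * |e.ofLp ⬝ᵥ U *ᵥ m.ofLp| ≤ C1 * ‖e‖ := by
    intro e he
    by_cases h0 : e = 0
    · simp [h0]
    have hpos := norm_pos_iff.2 h0
    have h1 := hmixed eps heps hle1 u hu z hz N hN (‖e‖⁻¹ • e)
      (by rw [real_inner_smul_left, he, mul_zero])
      (by rw [norm_smul, norm_inv, norm_norm, inv_mul_cancel₀ hpos.ne'])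
    rw [WithLp.ofLp_smul, smul_dotProduct, smul_eq_mul, abs_mul, abs_inv, abs_norm] at h1
    calc eps * |e.ofLp ⬝ᵥ U *ᵥ m.ofLp|
        = eps * (‖e‖⁻¹ * |e.ofLp ⬝ᵥ U *ᵥ m.ofLp|) * ‖e‖ := by field_simp
      _ ≤ C1 * ‖e‖ := by gcongr
  have hnor := hnormal eps heps hle2 u hu z hz m ht hmix
  have hmmU : eps * |m.ofLp ⬝ᵥ U *ᵥ m.ofLp| ≤ max 1 |C2| := by
    have h1 := hu.hess_quadratic_le_closure hf hΩ.isOpen hΩ.bounded hsig heps hzc m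
    rw [hm1, le_div_iff₀ heps] at h1
    have h2 : eps * |m.ofLp ⬝ᵥ U *ᵥ m.ofLp| = |eps * (m.ofLp ⬝ᵥ U *ᵥ m.ofLp)| := by
      rw [abs_mul, abs_of_pos heps]
    rw [h2, abs_le]
    constructor
    · linarith [le_max_right 1 |C2|, le_abs_self C2]
    · linarith [le_max_left 1 |C2|]
  have hquad : ∀ v : E n, |v.ofLp ⬝ᵥ U *ᵥ v.ofLp| ≤ B / eps * ‖v‖ ^ 2 := by
    intro v
    set a : ℝ := inner ℝ v m with ha
    set e := v - a • m with he
    have hmm : inner ℝ m m = (1 : ℝ) := by rw [real_inner_self_eq_norm_sq, hm1]; norm_num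
    have hem : inner ℝ e m = 0 := by
      rw [he, inner_sub_left, real_inner_smul_left, hmm, ← ha]; ring
    have hve : v = e + a • m := by rw [he]; abel
    have hnv : ‖v‖ ^ 2 = ‖e‖ ^ 2 + a ^ 2 := by
      conv_lhs => rw [hve]
      rw [norm_add_sq_real, inner_smul_right, hem, norm_smul, hm1, mul_one, Real.norm_eq_abs, sq_abs]
      ring
    have h0 : v.ofLp ⬝ᵥ U *ᵥ v.ofLp = e.ofLp ⬝ᵥ U *ᵥ e.ofLp + 2 * a * (e.ofLp ⬝ᵥ U *ᵥ m.ofLp)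
        + a ^ 2 * (m.ofLp ⬝ᵥ U *ᵥ m.ofLp) := by
      have h1 : v.ofLp = e.ofLp + a • m.ofLp := congrArg WithLp.ofLp hve
      rw [h1, quadratic_add_smul hU]
    have ht1 := hu.abs_hess_tangential_le hf hΩ.isOpen hΩ.bounded hsig heps hR heR hhi1 hz ht hem
    have ht2 := hmix e hem
    set T := e.ofLp ⬝ᵥ U *ᵥ e.ofLp
    set X := e.ofLp ⬝ᵥ U *ᵥ m.ofLp
    set Q := m.ofLp ⬝ᵥ U *ᵥ m.ofLp
    have k1 : eps * |T| ≤ 5 * ‖v‖ ^ 2 := by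
      calc eps * |T| ≤ R * (5 / R * ‖e‖ ^ 2) := by gcongr
        _ = 5 * ‖e‖ ^ 2 := by field_simp
        _ ≤ 5 * ‖v‖ ^ 2 := by rw [hnv]; nlinarith [sq_nonneg a]
    have k2 : eps * |2 * a * X| ≤ 2 * |C1| * ‖v‖ ^ 2 := by
      have h1 : |a| * ‖e‖ ≤ ‖v‖ ^ 2 := by
        rw [hnv, ← sq_abs a]; nlinarith [sq_nonneg (|a| - ‖e‖), sq_nonneg (|a| + ‖e‖)]
      calc eps * |2 * a * X| = 2 * |a| * (eps * |X|) := by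
            rw [abs_mul, abs_mul, abs_two]; ring
        _ ≤ 2 * |a| * (|C1| * ‖e‖) := mul_le_mul_of_nonneg_left
            (ht2.trans (mul_le_mul_of_nonneg_right (le_abs_self _) (norm_nonneg _))) (by positivity)
        _ = 2 * |C1| * (|a| * ‖e‖) := by ring
        _ ≤ _ := by gcongr
    have k3 : eps * |a ^ 2 * Q| ≤ max 1 |C2| * ‖v‖ ^ 2 := by
      calc eps * |a ^ 2 * Q| = a ^ 2 * (eps * |Q|) := by
            rw [abs_mul, abs_of_nonneg (sq_nonneg a)]; ring
        _ ≤ ‖v‖ ^ 2 * max 1 |C2| := mul_le_mul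
            (by rw [hnv]; linarith [sq_nonneg ‖e‖]) hmmU (by positivity) (by positivity)
        _ = _ := mul_comm _ _
    have k4 : |v.ofLp ⬝ᵥ U *ᵥ v.ofLp| ≤ |T| + |2 * a * X| + |a ^ 2 * Q| := by
      rw [h0]; exact abs_add_three _ _ _
    rw [div_mul_eq_mul_div, le_div_iff₀ heps]
    calc |v.ofLp ⬝ᵥ U *ᵥ v.ofLp| * eps ≤ (|T| + |2 * a * X| + |a ^ 2 * Q|) * eps := by gcongr
      _ = eps * |T| + eps * |2 * a * X| + eps * |a ^ 2 * Q| := by ring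
      _ ≤ 5 * ‖v‖ ^ 2 + 2 * |C1| * ‖v‖ ^ 2 + max 1 |C2| * ‖v‖ ^ 2 := by gcongr
      _ = B * ‖v‖ ^ 2 := by rw [hB]; ring
  have hfin := hessNorm_le (by positivity) fun i j => abs_apply_le_of_quadratic hU hquad i j
  rw [hu.bdry z hz]
  calc eps * hessNorm u z ≤ eps * (n * (3 * (B / eps))) := by gcongr
    _ = n * (3 * B) := by field_simp

end DeSitter

end

theorem theorem5 {n : ℕ} (f : DeSitter.E n → ℝ) (hf : DeSitter.IsCurvatureFunction f)
    (Ω : Set (DeSitter.E n)) (hΩ : DeSitter.IsBoundedSmoothDomain Ω)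
    (sig : ℝ) (hsig : 1 < sig) :
    ∃ eps1 : ℝ, 0 < eps1 ∧ ∃ C : ℝ, ∀ eps : ℝ, 0 < eps → eps ≤ eps1 →
      ∀ u : DeSitter.E n → ℝ, DeSitter.IsAdmissibleSolution f Ω sig eps u →
        ∀ x ∈ frontier Ω, u x * DeSitter.hessNorm u x ≤ C :=
  DeSitter.exists_boundary_hess_bound f hf Ω hΩ sig hsig
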